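/- For a monic integer polynomial $f$ of degree $n\ge 1$, call a complex root of $f$ dominant if its modulus is maximal among all roots of $f$. The height of $f$ is the maximum of the absolute values of its coefficients. For positive integers $k\le n$ and $H$, let $I_n(k,H)$ (resp. $R_n(k,H)$) be the number of monic integer polynomials $f$ of degree $n$ and height at most $H$ that are irreducible (resp. reducible) in $\mathbb{Z}[x]$ and have exactly $k$ dominant roots, counted with multiplicity. Write $U(H)\sim V(H)$ if $U(H)/V(H)\to 1$ as $H\to\infty$, and $U(H)\asymp V(H)$ if there are constants $c,C>0$, which may depend on $n$ and $k$ but not on $H$, such that $cV(H)\le U(H)\le CV(H)$ for all integers $H$ in the stated range. For every integer $n\ge 3$, \begin{align*} I_n(1,H)&\sim (2H)^n, & R_n(1,H)&\asymp H^{n-1},\\ I_n(2,H)&\asymp H^{n-1/2}, & R_n(2,H)&\asymp H^{n-3/2}, \end{align*} and moreover \begin{align*} I_3(3,H)&\sim 2H, & R_3(3,H)&\asymp H^{2/3},\\ I_4(3,H)&=0, & R_4(3,H)&\asymp H\log H,\\ I_4(4,H)&\asymp H^{3/2}, & R_4(4,H)&\asymp H. \end{align*} The estimates $\asymp$ and the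 equality $I_4(3,H)=0$ hold for all integers $H\ge 1$, except that $R_4(3,H)\asymp H\log H$ is asserted for all integers $H\ge 2$. -/

import Mathlib

open Polynomial

noncomputable section

/-- The house (inclusion radius) `r(f)`: the largest modulus of the complex roots of `f`. -/
def house (f : ℤ[X]) : NNReal :=
  ((f.aroots ℂ).map (fun z => ‖z‖₊)).sup

/-- The number of roots of `f` of maximal modulus, counted with multiplicity. -/
def numDominant (f : ℤ[X]) : ℕ :=
  (f.aroots ℂ).countP (fun z => ‖z‖₊ = house f)

/-- The height of `f`: the maximum of the absolute values of its coefficients. -/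
def polyHeight (f : ℤ[X]) : ℕ :=
  f.support.sup (fun i => (f.coeff i).natAbs)

/-- The monic integer polynomials of degree `n` and height at most `H` with exactly `k`
(not necessarily distinct) roots of maximal modulus. -/
def dominantSet (n k H : ℕ) : Set ℤ[X] :=
  {f | f.Monic ∧ f.natDegree = n ∧ polyHeight f ≤ H ∧ numDominant f = k}

/-- `I_n(k,H)`: the number of irreducible polynomials in `dominantSet n k H`. -/
def irredCount (n k H : ℕ) : ℕ :=
  {f ∈ dominantSet n k H | Irreducible f}.ncard

/-- `R_n(k,H)`: the number of reducible polynomials in `dominantSet n k H`. A monic integer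
polynomial of positive degree is reducible exactly when it is not irreducible. -/
def redCount (n k H : ℕ) : ℕ :=
  {f ∈ dominantSet n k H | ¬ Irreducible f}.ncard

end

/-- The sets that are counted are finite, so `Set.ncard` is their true cardinality. -/
theorem dominantSet_finite (n k H : ℕ) : (dominantSet n k H).Finite := by
  have hfin : (Set.pi Set.univ (fun _ : Fin (n + 1) => Set.Icc (-(H : ℤ)) H)).Finite :=
    Set.Finite.pi fun _ => Set.finite_Icc _ _
  refine Set.Finite.of_finite_image
    (f := fun f : ℤ[X] => fun i : Fin (n + 1) => f.coeff i) (hfin.subset ?_) ?_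
  · rintro _ ⟨f, ⟨-, -, hH, -⟩, rfl⟩ i -
    have h : (f.coeff i).natAbs ≤ H := by
      by_cases hi : (i : ℕ) ∈ f.support
      · exact (Finset.le_sup (f := fun j => (f.coeff j).natAbs) hi).trans hH
      · simp [notMem_support_iff.mp hi]
    simp only [Set.mem_Icc]
    omega
  · rintro f ⟨-, hf, -, -⟩ g ⟨-, hg, -, -⟩ hfg
    ext j
    by_cases hj : j < n + 1
    · exact congrFun hfg ⟨j, hj⟩
    · rw [coeff_eq_zero_of_natDegree_lt (by omega), coeff_eq_zero_of_natDegree_lt (by omega)]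

/-- `U ≪ V ≪ U` for functions of an integer `H ≥ H₀`, with constants independent of `H`. -/
def AsympFrom (H₀ : ℕ) (U V : ℕ → ℝ) : Prop :=
  ∃ c C : ℝ, 0 < c ∧ 0 < C ∧ ∀ H : ℕ, H₀ ≤ H → c * V H ≤ U H ∧ U H ≤ C * V H

/-- `U ∼ V`, i.e. `U / V → 1` as `H → ∞`. -/
def AsympEquiv (U V : ℕ → ℝ) : Prop :=
  Filter.Tendsto (fun H => U H / V H) Filter.atTop (nhds 1)

/-! At a root of large modulus the leading terms of `f` must nearly cancel
(`norm_lead_terms_mul_le`). If the coefficient `a` of `X ^ (n - 1)` is large against `√H`, every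
large root is close to `-a`; the other roots contribute little to the sum `-a` of all roots, so
there is only one large root (`numDominant_eq_one`). If `a` is at most a small multiple of `√H` and
the next coefficient `b` is at least `H / 2`, every large root has its square close to `-b`; the sum
of the squares of the roots then allows exactly two of them, and these are not real, hence conjugate
(`numDominant_eq_two`). So several dominant roots cost a factor `√H`, and for large `H` that order
is attained by two dominant roots.

Reducible polynomials are counted through their factors. The Mahler measure is multiplicative and
comparable with the height, so the heights of monic factors multiply to `O(H)`
(`polyHeight_mul_ge`), and by a dyadic summation (`HasGrowth.pairs`) the factor whose family grows
faster decides the order. This gives `H ^ (n - 1)` for all reducible polynomials. A reducible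
polynomial with two dominant roots either has a proper factor with several dominant roots or
contains one factor twice, up to the sign of its roots (`factor_of_numDominant_eq_two`); both cases
give `O(H ^ (n - 3 / 2))`. The matching lower bounds come from multiplying polynomials of degree `n
- 1` by `X`.

If all roots have modulus `r > 0`, conjugation sends a root `z` to `r ^ 2 / z`. As the sum of the
roots is real, this yields `r ^ 2 * a₁ = a₀ * aₙ₋₁` in degrees three and four. A cubic is then `X ^
3 + c`, or it splits off `X + t` and depends on two parameters of size `O(H ^ (1 / 3))`
(`cubic_form`). Among quartics the biquadratic ones dominate, with `O(H ^ (1 / 2))` middle and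
`O(H)` constant coefficients; reducible quartics are products of two quadratics whose constant terms
agree up to sign.

Let a quartic have exactly three dominant roots and a fourth root `d`. If it is irreducible, a real
dominant root `x` and the other two dominant roots satisfy `y * z = x ^ 2`; an embedding taking `x`
to `d` turns this into `r ^ 2 = d ^ 2`, a contradiction. If it is reducible, `d` is an integer
(`exists_int_small_root`), and the main contribution comes from `(X - d) * (X ^ 3 + c)` with `|c *
d| ≤ H`, a divisor sum of order `H * log H`.

Lower bounds are proved for large `H` and extended to small `H` by an explicit polynomial of height
one (`asympFrom_of_eventually`). -/

/-! ### Heights and boxes of coefficients -/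

theorem polyHeight_le_iff {f : ℤ[X]} {H : ℕ} :
    polyHeight f ≤ H ↔ ∀ i, (f.coeff i).natAbs ≤ H := by
  unfold polyHeight
  rw [Finset.sup_le_iff]
  refine ⟨fun h i => ?_, fun h i _ => h i⟩
  by_cases hi : i ∈ f.support
  · exact h i hi
  · simp [notMem_support_iff.mp hi]

theorem natAbs_coeff_le_polyHeight (f : ℤ[X]) (i : ℕ) : (f.coeff i).natAbs ≤ polyHeight f :=
  polyHeight_le_iff.mp le_rfl i

theorem Polynomial.Monic.one_le_polyHeight {f : ℤ[X]} (hf : f.Monic) : 1 ≤ polyHeight f := by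
  simpa [hf.coeff_natDegree] using natAbs_coeff_le_polyHeight f f.natDegree

/-- The monic integer polynomials of degree `n` and height at most `H`. -/
def monicBox (n H : ℕ) : Set ℤ[X] :=
  {f | f.Monic ∧ f.natDegree = n ∧ polyHeight f ≤ H}

/-- The monic integer polynomials of degree `n` whose `i`-th coefficient lies in `S i`. -/
def coeffBox (n : ℕ) (S : ℕ → Finset ℤ) : Set ℤ[X] :=
  {f | f.Monic ∧ f.natDegree = n ∧ ∀ i < n, f.coeff i ∈ S i}

/-- The monic polynomial of degree `n` with prescribed lower coefficients. -/
noncomputable def monicOfCoeffs {n : ℕ} (v : Fin n → ℤ) : ℤ[X] :=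
  X ^ n + ∑ i : Fin n, C (v i) * X ^ (i : ℕ)

theorem degree_sum_lt {n : ℕ} (v : Fin n → ℤ) :
    (∑ i : Fin n, C (v i) * X ^ (i : ℕ)).degree < (n : WithBot ℕ) :=
  degree_sum_fin_lt v

theorem monic_monicOfCoeffs {n : ℕ} (v : Fin n → ℤ) : (monicOfCoeffs v).Monic :=
  monic_X_pow_add (degree_sum_lt v)

theorem natDegree_monicOfCoeffs {n : ℕ} (v : Fin n → ℤ) : (monicOfCoeffs v).natDegree = n :=
  natDegree_eq_of_degree_eq_some (by
    unfold monicOfCoeffs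
    rw [degree_add_eq_left_of_degree_lt (by rw [degree_X_pow]; exact degree_sum_lt v),
      degree_X_pow])

theorem coeff_monicOfCoeffs {n : ℕ} (v : Fin n → ℤ) (i : Fin n) :
    (monicOfCoeffs v).coeff i = v i := by
  have h : (i : ℕ) ≠ n := i.2.ne
  simp [monicOfCoeffs, coeff_X_pow, h, Fin.val_inj]

theorem monic_ext {n : ℕ} {f g : ℤ[X]} (hf : f.Monic) (hg : g.Monic) (hfn : f.natDegree = n)
    (hgn : g.natDegree = n) (h : ∀ i < n, f.coeff i = g.coeff i) : f = g := by
  ext i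
  rcases lt_trichotomy i n with hi | rfl | hi
  · exact h i hi
  · rw [← hfn, hf.coeff_natDegree, hfn, ← hgn, hg.coeff_natDegree]
  · rw [coeff_eq_zero_of_natDegree_lt (by omega), coeff_eq_zero_of_natDegree_lt (by omega)]

theorem coeffBox_eq_image (n : ℕ) (S : ℕ → Finset ℤ) :
    coeffBox n S = monicOfCoeffs '' ((Fintype.piFinset fun i : Fin n => S i : Finset (Fin n → ℤ)) : Set (Fin n → ℤ)) := by
  ext f
  constructor
  · rintro ⟨hf, hn, hS⟩
    refine ⟨fun i => f.coeff i, by simpa using fun i : Fin n => hS i i.2, ?_⟩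
    exact monic_ext (monic_monicOfCoeffs _) hf (natDegree_monicOfCoeffs _) hn
      fun i hi => coeff_monicOfCoeffs (fun i : Fin n => f.coeff i) ⟨i, hi⟩
  · rintro ⟨v, hv, rfl⟩
    refine ⟨monic_monicOfCoeffs _, natDegree_monicOfCoeffs _, fun i hi => ?_⟩
    rw [show i = ((⟨i, hi⟩ : Fin n) : ℕ) from rfl, coeff_monicOfCoeffs]
    exact (by simpa using hv : ∀ i : Fin n, v i ∈ S i) ⟨i, hi⟩

theorem monicOfCoeffs_injective {n : ℕ} :
    Function.Injective (monicOfCoeffs : (Fin n → ℤ) → ℤ[X]) := fun v w h => by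
  ext i
  rw [← coeff_monicOfCoeffs v, h, coeff_monicOfCoeffs]

theorem coeffBox_finite (n : ℕ) (S : ℕ → Finset ℤ) : (coeffBox n S).Finite := by
  rw [coeffBox_eq_image]
  exact (Finset.finite_toSet _).image _

theorem ncard_coeffBox (n : ℕ) (S : ℕ → Finset ℤ) :
    (coeffBox n S).ncard = ∏ i ∈ Finset.range n, (S i).card := by
  rw [coeffBox_eq_image, Set.ncard_image_of_injective _ monicOfCoeffs_injective,
    Set.ncard_coe_finset, Fintype.card_piFinset, Finset.prod_range]

theorem monicBox_eq_coeffBox (n : ℕ) {H : ℕ} (hH : 1 ≤ H) :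
    monicBox n H = coeffBox n fun _ => Finset.Icc (-(H : ℤ)) H := by
  ext f
  simp only [monicBox, coeffBox, Set.mem_ofPred_eq, Finset.mem_Icc, polyHeight_le_iff]
  refine and_congr_right fun hf => and_congr_right fun hn =>
    ⟨fun h i _ => by have := h i; omega, fun h i => ?_⟩
  rcases lt_trichotomy i n with hi | rfl | hi
  · have := h i hi; omega
  · rw [← hn, hf.coeff_natDegree]; simpa
  · rw [coeff_eq_zero_of_natDegree_lt (by omega)]; simp

theorem monicBox_finite (n H : ℕ) : (monicBox n H).Finite := by
  -- Height `H + 1` avoids `H = 0`, where the leading coefficient `1` breaks the description as a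
  -- box.
  refine (monicBox_eq_coeffBox n (Nat.succ_le_succ (Nat.zero_le H)) ▸
    coeffBox_finite n _ : (monicBox n (H + 1)).Finite).subset ?_
  rintro f ⟨h1, h2, h3⟩
  exact ⟨h1, h2, by omega⟩

theorem ncard_monicBox (n : ℕ) {H : ℕ} (hH : 1 ≤ H) : (monicBox n H).ncard = (2 * H + 1) ^ n := by
  rw [monicBox_eq_coeffBox n hH, ncard_coeffBox]
  simp only [Int.card_Icc, Finset.prod_const, Finset.card_range]
  congr 1
  omega

theorem dominantSet_subset (n k H : ℕ) : dominantSet n k H ⊆ monicBox n H :=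
  fun _ h => ⟨h.1, h.2.1, h.2.2.1⟩

theorem dominantSet_mono (n k : ℕ) {H H' : ℕ} (h : H ≤ H') :
    dominantSet n k H ⊆ dominantSet n k H' :=
  fun _ hf => ⟨hf.1, hf.2.1, hf.2.2.1.trans h, hf.2.2.2⟩

/-! ### Growth exponents of families of sets -/

/-- The family `A H` of sets is finite of cardinality `O(H ^ e)`. -/
def HasGrowth {α : Type*} (A : ℕ → Set α) (e : ℝ) : Prop :=
  ∃ C : ℝ, ∀ H : ℕ, 1 ≤ H → (A H).Finite ∧ ((A H).ncard : ℝ) ≤ C * (H : ℝ) ^ e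

namespace HasGrowth

variable {α β : Type*} {A B : ℕ → Set α} {a b e : ℝ}

theorem subset (hB : HasGrowth B e) (h : ∀ H, 1 ≤ H → A H ⊆ B H) : HasGrowth A e := by
  obtain ⟨C, hC⟩ := hB
  refine ⟨C, fun H hH => ⟨(hC H hH).1.subset (h H hH), ?_⟩⟩
  exact le_trans (by exact_mod_cast Set.ncard_le_ncard (h H hH) (hC H hH).1) (hC H hH).2

theorem exists_nonneg (hA : HasGrowth A e) :
    ∃ C : ℝ, 0 ≤ C ∧ ∀ H : ℕ, 1 ≤ H → (A H).Finite ∧ ((A H).ncard : ℝ) ≤ C * (H : ℝ) ^ e := by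
  obtain ⟨C, hC⟩ := hA
  refine ⟨max C 0, le_max_right _ _, fun H hH => ⟨(hC H hH).1, (hC H hH).2.trans ?_⟩⟩
  gcongr
  exact le_max_left _ _

theorem mono (hA : HasGrowth A a) (h : a ≤ e) : HasGrowth A e := by
  obtain ⟨C, hC0, hC⟩ := hA.exists_nonneg
  refine ⟨C, fun H hH => ⟨(hC H hH).1, (hC H hH).2.trans ?_⟩⟩
  have : (1 : ℝ) ≤ H := by exact_mod_cast hH
  gcongr

theorem union (hA : HasGrowth A e) (hB : HasGrowth B e) :
    HasGrowth (fun H => A H ∪ B H) e := by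
  obtain ⟨C, hC⟩ := hA
  obtain ⟨D, hD⟩ := hB
  refine ⟨C + D, fun H hH => ⟨(hC H hH).1.union (hD H hH).1, ?_⟩⟩
  have h1 : ((A H ∪ B H).ncard : ℝ) ≤ (A H).ncard + (B H).ncard := by
    exact_mod_cast Set.ncard_union_le _ _
  linarith [(hC H hH).2, (hD H hH).2]

theorem image {A : ℕ → Set β} (hA : HasGrowth A e) (g : β → α) :
    HasGrowth (fun H => g '' A H) e := by
  obtain ⟨C, hC⟩ := hA
  refine ⟨C, fun H hH => ⟨(hC H hH).1.image g, le_trans ?_ (hC H hH).2⟩⟩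
  exact_mod_cast Set.ncard_image_le (hC H hH).1

theorem empty : HasGrowth (fun _ => (∅ : Set α)) e :=
  ⟨0, fun _ _ => ⟨Set.finite_empty, by simp⟩⟩

theorem biUnion_range {A : ℕ → ℕ → Set α} (n : ℕ) (h : ∀ i < n, HasGrowth (A i) e) :
    HasGrowth (fun H => ⋃ i < n, A i H) e := by
  induction n with
  | zero => simpa using empty
  | succ n ih =>
    refine ((ih fun i hi => h i (by omega)).union (h n (by omega))).subset fun H _ => ?_
    intro x hx
    simp only [Set.mem_iUnion, exists_prop] at hx
    obtain ⟨i, hi, hx⟩ := hx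
    rcases Nat.lt_succ_iff_lt_or_eq.mp hi with hi | rfl
    · exact Or.inl (by simpa using ⟨i, hi, hx⟩)
    · exact Or.inr hx

theorem prod {B : ℕ → Set β} (hA : HasGrowth A a) (hB : HasGrowth B b) :
    HasGrowth (fun H => A H ×ˢ B H) (a + b) := by
  obtain ⟨C, hC0, hC⟩ := hA.exists_nonneg
  obtain ⟨D, hD0, hD⟩ := hB.exists_nonneg
  refine ⟨C * D, fun H hH => ⟨(hC H hH).1.prod (hD H hH).1, ?_⟩⟩
  have h0 : (0 : ℝ) < H := by exact_mod_cast hH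
  rw [Set.ncard_prod, Real.rpow_add h0]
  push_cast
  calc ((A H).ncard : ℝ) * (B H).ncard ≤ (C * (H : ℝ) ^ a) * (D * (H : ℝ) ^ b) := by
        gcongr
        · exact (hC H hH).2
        · exact (hD H hH).2
    _ = _ := by ring

theorem int_abs_le (K : ℝ) (hK : 0 ≤ K) (he : 0 ≤ e) :
    HasGrowth (fun H => {x : ℤ | |(x : ℝ)| ≤ K * (H : ℝ) ^ e}) e := by
  refine ⟨2 * K + 1, fun H hH => ?_⟩
  have h0 : (1 : ℝ) ≤ H := by exact_mod_cast hH
  have h1 : (1 : ℝ) ≤ (H : ℝ) ^ e := Real.one_le_rpow h0 he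
  have h2 : {x : ℤ | |(x : ℝ)| ≤ K * (H : ℝ) ^ e} ⊆
      (Finset.Icc (-⌊K * (H : ℝ) ^ e⌋) ⌊K * (H : ℝ) ^ e⌋ : Finset ℤ) := by
    intro x hx
    rw [Set.mem_ofPred_eq, abs_le] at hx
    simp only [Finset.coe_Icc, Set.mem_Icc]
    refine ⟨neg_le.mp (Int.le_floor.mpr (by push_cast; linarith)), Int.le_floor.mpr hx.2⟩
  have hnn : 0 ≤ K * (H : ℝ) ^ e := by positivity
  refine ⟨(Finset.finite_toSet _).subset h2, ?_⟩
  have h3 := Set.ncard_le_ncard h2 (Finset.finite_toSet _)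
  rw [Set.ncard_coe_finset, Int.card_Icc] at h3
  have h4 : (0 : ℤ) ≤ ⌊K * (H : ℝ) ^ e⌋ := Int.floor_nonneg.mpr hnn
  have h5 : ((⌊K * (H : ℝ) ^ e⌋ + 1 - -⌊K * (H : ℝ) ^ e⌋).toNat : ℝ) ≤
      2 * (K * (H : ℝ) ^ e) + 1 := by
    have : ((⌊K * (H : ℝ) ^ e⌋ + 1 - -⌊K * (H : ℝ) ^ e⌋).toNat : ℤ) =
      2 * ⌊K * (H : ℝ) ^ e⌋ + 1 := by omega
    have h6 : ((⌊K * (H : ℝ) ^ e⌋ + 1 - -⌊K * (H : ℝ) ^ e⌋).toNat : ℝ) =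
      2 * (⌊K * (H : ℝ) ^ e⌋ : ℝ) + 1 := by exact_mod_cast this
    rw [h6]
    linarith [Int.floor_le (K * (H : ℝ) ^ e)]
  have h7 := (Nat.cast_le (α := ℝ)).mpr h3
  nlinarith

theorem _root_.hasGrowth_monicBox (n : ℕ) : HasGrowth (monicBox n) n := by
  refine ⟨3 ^ n, fun H hH => ⟨monicBox_finite n H, ?_⟩⟩
  rw [ncard_monicBox n hH, Real.rpow_natCast, ← mul_pow]
  have : (1 : ℝ) ≤ H := by exact_mod_cast hH
  push_cast
  gcongr
  linarith

/-- If `a < e`, a set with `O(T ^ a)` elements of weight at most `T` and another one with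
`O(T ^ e)` such elements have together `O(H ^ e)` pairs with product of weights `O(H)`. -/
theorem pairs {A : Set α} {B : Set β} {w : α → ℕ} {w' : β → ℕ}
    (hA : HasGrowth (fun T => {x ∈ A | w x ≤ T}) a) (hB : HasGrowth (fun T => {x ∈ B | w' x ≤ T}) e)
    (hw : ∀ x ∈ A, 1 ≤ w x) (hw' : ∀ x ∈ B, 1 ≤ w' x) (ha : 0 ≤ a) (hae : a < e) (D : ℕ) :
    HasGrowth (fun H => {p : α × β | p.1 ∈ A ∧ p.2 ∈ B ∧ w p.1 * w' p.2 ≤ D * H}) e := by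
  obtain ⟨C, hC0, hC⟩ := hA.exists_nonneg
  obtain ⟨C', hC'0, hC'⟩ := hB.exists_nonneg
  -- Dyadic decomposition: if `w x` lies in `[2 ^ j, 2 ^ (j + 1))`, then `w' y ≤ D * H / 2 ^ j`, so
  -- the block has `O(2 ^ (j * a) * (H / 2 ^ j) ^ e) = O(H ^ e * q ^ j)` pairs. Since `a < e`, the
  -- sum over `j` is a convergent geometric series.
  set q : ℝ := 2 ^ (a - e) with hq
  have hq0 : 0 < q := by positivity
  have hq1 : q < 1 := Real.rpow_lt_one_of_one_lt_of_neg (by norm_num) (by linarith)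
  refine ⟨C * C' * 2 ^ a * (D : ℝ) ^ e * (1 - q)⁻¹, fun H hH => ?_⟩
  set S := {p : α × β | p.1 ∈ A ∧ p.2 ∈ B ∧ w p.1 * w' p.2 ≤ D * H}
  set L := Nat.log 2 (D * H) + 1
  -- The growth hypotheses only cover bounds `T ≥ 1`, so blocks with `D * H / 2 ^ j = 0` are
  -- replaced by `∅`.
  set F : ℕ → Set (α × β) := fun j =>
    if 2 ^ j ≤ D * H then {x ∈ A | w x ≤ 2 ^ (j + 1)} ×ˢ {x ∈ B | w' x ≤ D * H / 2 ^ j} else ∅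
  have hsub : S ⊆ ⋃ j ∈ Finset.range L, F j := by
    rintro ⟨x, y⟩ ⟨hx, hy, hxy⟩
    simp only at hx hy hxy
    have hx1 := hw x hx
    have hy1 := hw' y hy
    have hj1 : 2 ^ Nat.log 2 (w x) ≤ w x := Nat.pow_log_le_self 2 (by omega)
    have hj2 : w x < 2 ^ (Nat.log 2 (w x) + 1) := Nat.lt_pow_succ_log_self (by norm_num) _
    have hwD : w x ≤ D * H := le_trans (Nat.le_mul_of_pos_right _ hy1) hxy
    simp only [Set.mem_iUnion, Finset.mem_range]
    refine ⟨Nat.log 2 (w x), Nat.lt_succ_of_le (Nat.log_mono_right hwD), ?_⟩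
    simp only [F]
    rw [if_pos (hj1.trans hwD)]
    refine ⟨⟨hx, hj2.le⟩, ⟨hy, ?_⟩⟩
    rw [Nat.le_div_iff_mul_le (by positivity)]
    calc w' y * 2 ^ Nat.log 2 (w x) ≤ w' y * w x := Nat.mul_le_mul_left _ hj1
      _ ≤ D * H := by rw [mul_comm]; exact hxy
  have hF : ∀ j, (F j).Finite ∧
      ((F j).ncard : ℝ) ≤ C * C' * 2 ^ a * ((D * H : ℕ) : ℝ) ^ e * q ^ j := by
    intro j
    by_cases hj : 2 ^ j ≤ D * H
    · simp only [F, if_pos hj]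
      obtain ⟨f1, g1⟩ := hC (2 ^ (j + 1)) Nat.one_le_two_pow
      obtain ⟨f2, g2⟩ := hC' (D * H / 2 ^ j) (by
        rw [Nat.le_div_iff_mul_le (by positivity)]; simpa using hj)
      refine ⟨f1.prod f2, ?_⟩
      rw [Set.ncard_prod]
      push_cast
      have h1 : ((D * H / 2 ^ j : ℕ) : ℝ) ≤ ((D * H : ℕ) : ℝ) / 2 ^ j := by
        refine Nat.cast_div_le.trans ?_
        push_cast; rfl
      have h2 : ((D * H / 2 ^ j : ℕ) : ℝ) ^ e ≤ (((D * H : ℕ) : ℝ) / 2 ^ j) ^ e :=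
        Real.rpow_le_rpow (Nat.cast_nonneg _) h1 (by linarith)
      rw [Real.div_rpow (Nat.cast_nonneg _) (by positivity)] at h2
      have h3 : ((2 ^ (j + 1) : ℕ) : ℝ) ^ a = 2 ^ a * ((2 : ℝ) ^ a) ^ j := by
        push_cast
        rw [← Real.rpow_natCast, ← Real.rpow_mul (by norm_num), mul_comm,
          Real.rpow_mul (by norm_num), Real.rpow_natCast, pow_succ, mul_comm]
      have h4 : ((2 : ℝ) ^ j) ^ e = ((2 : ℝ) ^ e) ^ j := by
        rw [← Real.rpow_natCast, ← Real.rpow_mul (by norm_num), mul_comm,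
          Real.rpow_mul (by norm_num), Real.rpow_natCast]
      have h5 : q ^ j = ((2 : ℝ) ^ a) ^ j / ((2 : ℝ) ^ e) ^ j := by
        rw [hq, Real.rpow_sub (by norm_num), div_pow]
      rw [h3] at g1
      rw [h4] at h2
      calc _ ≤ (C * (2 ^ a * ((2 : ℝ) ^ a) ^ j)) * (C' * (((D * H : ℕ) : ℝ) ^ e / (2 ^ e) ^ j)) := by
            gcongr
            exact g2.trans (by gcongr)
        _ = _ := by rw [h5]; push_cast; ring
    · simp only [F, if_neg hj]
      exact ⟨Set.finite_empty, by simp; positivity⟩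
  have hfin : (⋃ j ∈ Finset.range L, F j).Finite :=
    Set.Finite.biUnion (Finset.finite_toSet _) fun j _ => (hF j).1
  refine ⟨hfin.subset hsub, ?_⟩
  have h1 : (S.ncard : ℝ) ≤ ∑ j ∈ Finset.range L, ((F j).ncard : ℝ) := by
    have := (Set.ncard_le_ncard hsub hfin).trans (Finset.set_ncard_biUnion_le _ _)
    exact_mod_cast this
  refine h1.trans ((Finset.sum_le_sum fun j _ => (hF j).2).trans ?_)
  rw [← Finset.mul_sum]
  have h2 : ∑ j ∈ Finset.range L, q ^ j ≤ (1 - q)⁻¹ := by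
    rw [← tsum_geometric_of_lt_one hq0.le hq1]
    exact (summable_geometric_of_lt_one hq0.le hq1).sum_le_tsum _ fun _ _ => by positivity
  push_cast
  rw [Real.mul_rpow (Nat.cast_nonneg _) (Nat.cast_nonneg _)]
  calc _ ≤ C * C' * 2 ^ a * ((D : ℝ) ^ e * (H : ℝ) ^ e) * (1 - q)⁻¹ := by gcongr
    _ = _ := by ring

end HasGrowth

/-- Assemble `AsympFrom` from an upper bound, an eventual lower bound, and positivity. -/
theorem asympFrom_of_eventually {H₀ : ℕ} {U V : ℕ → ℝ} {C c : ℝ} (hV : ∀ H, H₀ ≤ H → 0 ≤ V H)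
    (hup : ∀ H, H₀ ≤ H → U H ≤ C * V H) (hpos : ∀ H, H₀ ≤ H → 1 ≤ U H) (hc : 0 < c)
    (hlow : ∀ᶠ H in Filter.atTop, c * V H ≤ U H) : AsympFrom H₀ U V := by
  obtain ⟨N, hN⟩ := Filter.eventually_atTop.mp hlow
  -- `M` bounds `V` at the finitely many `H < N`; there `1 ≤ U H` already gives the lower bound with
  -- constant `M⁻¹`.
  set M : ℝ := 1 + ∑ H ∈ Finset.range N, |V H|
  have hM : 1 ≤ M := by
    have : 0 ≤ ∑ H ∈ Finset.range N, |V H| := Finset.sum_nonneg fun _ _ => abs_nonneg _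
    simp only [M]; linarith
  refine ⟨min c M⁻¹, max C 1, lt_min hc (by positivity), by positivity, fun H hH => ⟨?_, ?_⟩⟩
  · by_cases hHN : N ≤ H
    · refine le_trans ?_ (hN H hHN)
      exact mul_le_mul_of_nonneg_right (min_le_left _ _) (hV H hH)
    · refine le_trans ?_ (hpos H hH)
      have h1 : V H ≤ M := by
        have := Finset.single_le_sum (f := fun H => |V H|) (fun _ _ => abs_nonneg _)
          (Finset.mem_range.mpr (not_le.mp hHN))
        simp only [M]
        linarith [le_abs_self (V H)]
      calc min c M⁻¹ * V H ≤ M⁻¹ * M := by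
            exact mul_le_mul (min_le_right _ _) h1 (hV H hH) (by positivity)
        _ = 1 := inv_mul_cancel₀ (by positivity)
  · exact (hup H hH).trans (mul_le_mul_of_nonneg_right (le_max_left _ _) (hV H hH))

/-! ### Roots, their moduli and power sums -/

section Roots

variable {f g h : ℤ[X]}

theorem aroots_splits_eq (hf : f.Monic) :
    f.map (algebraMap ℤ ℂ) = ((f.aroots ℂ).map fun z => X - C z).prod := by
  have := (IsAlgClosed.splits (f.map (algebraMap ℤ ℂ))).eq_prod_roots
  rwa [(hf.map _).leadingCoeff, C_1, one_mul] at this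

theorem card_aroots (hf : f.Monic) : (f.aroots ℂ).card = f.natDegree := by
  rw [← hf.natDegree_map (algebraMap ℤ ℂ)]
  exact (splits_iff_card_roots.mp (IsAlgClosed.splits _))

theorem mem_aroots_iff (hf : f.Monic) {z : ℂ} : z ∈ f.aroots ℂ ↔ aeval z f = 0 := by
  rw [mem_aroots, and_iff_right hf.ne_zero]

theorem aroots_mul_monic (hf : f.Monic) (hg : g.Monic) :
    (f * g).aroots ℂ = f.aroots ℂ + g.aroots ℂ :=
  aroots_mul (hf.mul hg).ne_zero

theorem nnnorm_le_house {z : ℂ} (hz : z ∈ f.aroots ℂ) : ‖z‖₊ ≤ house f :=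
  Multiset.le_sup (Multiset.mem_map_of_mem _ hz)

theorem house_le {r : NNReal} (h : ∀ z ∈ f.aroots ℂ, ‖z‖₊ ≤ r) : house f ≤ r :=
  Multiset.sup_le.mpr fun b hb => by
    obtain ⟨z, hz, rfl⟩ := Multiset.mem_map.mp hb
    exact h z hz

theorem house_eq {r : NNReal} (h : ∀ z ∈ f.aroots ℂ, ‖z‖₊ ≤ r) {w : ℂ} (hw : w ∈ f.aroots ℂ)
    (hwr : ‖w‖₊ = r) : house f = r :=
  le_antisymm (house_le h) (hwr ▸ nnnorm_le_house hw)

theorem exists_nnnorm_eq_house (hf : f.Monic) (hd : 1 ≤ f.natDegree) :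
    ∃ z ∈ f.aroots ℂ, ‖z‖₊ = house f := by
  have hne : f.aroots ℂ ≠ 0 := by
    intro h0
    have := card_aroots hf
    simp [h0] at this
    omega
  obtain ⟨w, hw⟩ := Multiset.exists_mem_of_ne_zero hne
  obtain ⟨z, hz, hmax⟩ := (f.aroots ℂ).toFinset.exists_max_image (fun z => ‖z‖₊)
    ⟨w, Multiset.mem_toFinset.mpr hw⟩
  rw [Multiset.mem_toFinset] at hz
  exact ⟨z, hz, (house_eq (fun y hy => hmax y (Multiset.mem_toFinset.mpr hy)) hz rfl).symm⟩

theorem numDominant_eq_countP {r : NNReal} (h : ∀ z ∈ f.aroots ℂ, ‖z‖₊ ≤ r) {w : ℂ}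
    (hw : w ∈ f.aroots ℂ) (hwr : ‖w‖₊ = r) :
    numDominant f = (f.aroots ℂ).countP fun z => ‖z‖₊ = r := by
  unfold numDominant
  rw [house_eq h hw hwr]

theorem numDominant_le (hf : f.Monic) : numDominant f ≤ f.natDegree :=
  card_aroots hf ▸ Multiset.countP_le_card _ _

theorem one_le_numDominant (hf : f.Monic) (hd : 1 ≤ f.natDegree) : 1 ≤ numDominant f := by
  obtain ⟨z, hz, h⟩ := exists_nnnorm_eq_house hf hd
  exact Multiset.countP_pos.mpr ⟨z, hz, h⟩

theorem numDominant_eq_natDegree_iff (hf : f.Monic) :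
    numDominant f = f.natDegree ↔ ∀ z ∈ f.aroots ℂ, ‖z‖₊ = house f := by
  rw [← card_aroots hf]
  exact Multiset.countP_eq_card

theorem numDominant_eq_natDegree_of_forall (hf : f.Monic) (hd : 1 ≤ f.natDegree) {r : NNReal}
    (h : ∀ z ∈ f.aroots ℂ, ‖z‖₊ = r) : numDominant f = f.natDegree := by
  obtain ⟨z, hz, hzr⟩ := exists_nnnorm_eq_house hf hd
  exact (numDominant_eq_natDegree_iff hf).mpr fun w hw => by rw [h w hw, ← hzr, h z hz]

theorem map_conj_aroots (f : ℤ[X]) :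
    (f.aroots ℂ).map (starRingEnd ℂ) = f.aroots ℂ := by
  have h1 : ((f.map (algebraMap ℤ ℂ)).map (starRingEnd ℂ)) = f.map (algebraMap ℤ ℂ) := by
    rw [Polynomial.map_map]
    congr 1
    exact RingHom.ext_int _ _
  have h2 := (IsAlgClosed.splits (f.map (algebraMap ℤ ℂ))).roots_map (starRingEnd ℂ)
  rw [h1] at h2
  exact h2.symm

theorem conj_mem_aroots {z : ℂ} (hz : z ∈ f.aroots ℂ) : starRingEnd ℂ z ∈ f.aroots ℂ := by
  rw [← map_conj_aroots f]
  exact Multiset.mem_map_of_mem _ hz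

theorem nnnorm_conj (z : ℂ) : ‖starRingEnd ℂ z‖₊ = ‖z‖₊ := by
  ext; simp

/-- Multiplying by `X` does not change the nonzero dominant roots. -/
theorem numDominant_mul_of_lt (hf : f.Monic) (hg : g.Monic) (hd : 1 ≤ f.natDegree)
    (h : ∀ z ∈ g.aroots ℂ, ‖z‖₊ < house f) : numDominant (f * g) = numDominant f := by
  obtain ⟨w, hw, hwf⟩ := exists_nnnorm_eq_house hf hd
  have hm := aroots_mul_monic hf hg
  rw [numDominant_eq_countP (f := f * g) (r := house f) (w := w) _ (by rw [hm]; simp [hw]) hwf, hm,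
    Multiset.countP_add, Multiset.countP_eq_zero.mpr (fun z hz => (h z hz).ne), add_zero]
  · rfl
  · intro z hz
    rw [hm, Multiset.mem_add] at hz
    exact hz.elim nnnorm_le_house fun hz => (h z hz).le

theorem sum_aroots (hf : f.Monic) (hd : 1 ≤ f.natDegree) :
    (f.aroots ℂ).sum = -(f.coeff (f.natDegree - 1) : ℂ) := by
  have h1 := multiset_prod_X_sub_C_coeff_card_pred (f.aroots ℂ) (by rw [card_aroots hf]; omega)
  rw [← aroots_splits_eq hf, card_aroots hf, coeff_map] at h1
  simp only [algebraMap_int_eq, eq_intCast] at h1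
  rw [h1, neg_neg]

theorem sum_map_sq (s : Multiset ℂ) :
    (s.map fun z => z ^ 2).sum = s.sum ^ 2 - 2 * s.esymm 2 := by
  induction s using Multiset.induction with
  | empty => simp [Multiset.esymm, Multiset.powersetCard_zero_right]
  | cons a s ih =>
    have : (a ::ₘ s).esymm 2 = s.esymm 2 + a * s.sum := by
      simpa [Multiset.esymm, Multiset.powersetCard_cons, Multiset.powersetCard_one] using
        Multiset.sum_map_mul_left (s := s) (f := id) (a := a)
    rw [Multiset.map_cons, Multiset.sum_cons, ih, Multiset.sum_cons, this]
    ring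

theorem sum_sq_aroots (hf : f.Monic) (hd : 2 ≤ f.natDegree) :
    ((f.aroots ℂ).map fun z => z ^ 2).sum =
      (f.coeff (f.natDegree - 1) : ℂ) ^ 2 - 2 * (f.coeff (f.natDegree - 2) : ℂ) := by
  have h1 := Multiset.prod_X_sub_C_coeff (f.aroots ℂ) (k := f.natDegree - 2)
    (by rw [card_aroots hf]; omega)
  rw [← aroots_splits_eq hf, card_aroots hf, coeff_map,
    show f.natDegree - (f.natDegree - 2) = 2 by omega] at h1
  simp only [algebraMap_int_eq, eq_intCast] at h1
  rw [sum_map_sq, sum_aroots hf (by omega), h1]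
  ring

/-- Serves to count roots: `k` values near `c` sum to nearly `k * c`, so a known power sum
determines `k`. With `c = 0` it bounds the contribution of the small roots. -/
theorem norm_sum_map_sub_le {s : Multiset ℂ} {g : ℂ → ℂ} {c : ℂ} {ε : ℝ}
    (h : ∀ z ∈ s, ‖g z - c‖ ≤ ε) : ‖(s.map g).sum - s.card * c‖ ≤ s.card * ε := by
  induction s using Multiset.induction with
  | empty => simp
  | cons a s ih =>
    rw [Multiset.map_cons, Multiset.sum_cons, Multiset.card_cons]
    push_cast
    have h1 := h a (Multiset.mem_cons_self _ _)
    have h2 := ih fun z hz => h z (Multiset.mem_cons_of_mem hz)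
    calc ‖g a + (s.map g).sum - (s.card + 1) * c‖
        = ‖(g a - c) + ((s.map g).sum - s.card * c)‖ := by congr 1; ring
      _ ≤ ε + s.card * ε := (norm_add_le _ _).trans (add_le_add h1 h2)
      _ = _ := by ring

/-- The geometric sum is at most `r ^ m / (r - 1)`, and `r / (r - 1) ≤ 2`. -/
theorem sum_range_pow_mul_le {r : ℝ} (hr : 2 ≤ r) (m : ℕ) :
    (∑ i ∈ Finset.range m, r ^ i) * r ≤ 2 * r ^ m := by
  induction m with
  | zero => simp
  | succ m ih =>
    rw [Finset.sum_range_succ, add_mul, pow_succ]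
    have : 0 ≤ r ^ m := by positivity
    nlinarith

/-- If the lower coefficients of `f` are at most `H` in modulus, then at a root of modulus at
least `2` the leading `n - m` terms of `f` nearly cancel. -/
theorem norm_lead_terms_mul_le {n m H : ℕ} (hmn : m ≤ n) (hn : f.natDegree = n)
    (hH : polyHeight f ≤ H) {z : ℂ} (hz : aeval z f = 0) (h2 : 2 ≤ ‖z‖) :
    ‖∑ i ∈ Finset.range (n + 1 - m), (f.coeff (m + i) : ℂ) * z ^ i‖ * ‖z‖ ≤ 2 * H := by
  have hz0 : 0 < ‖z‖ := by linarith
  rw [aeval_eq_sum_range, hn, show n + 1 = m + (n + 1 - m) by omega, Finset.sum_range_add] at hz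
  have h1 : ‖∑ i ∈ Finset.range m, f.coeff i • z ^ i‖ ≤ H * ∑ i ∈ Finset.range m, ‖z‖ ^ i := by
    rw [Finset.mul_sum]
    refine (norm_sum_le _ _).trans (Finset.sum_le_sum fun i _ => ?_)
    rw [zsmul_eq_mul, norm_mul, norm_pow, Complex.norm_intCast]
    gcongr
    have := polyHeight_le_iff.mp hH i
    rw [← Int.cast_abs, Int.abs_eq_natAbs]
    exact_mod_cast this
  have h3 : ∑ i ∈ Finset.range (n + 1 - m), f.coeff (m + i) • z ^ (m + i) =
      z ^ m * ∑ i ∈ Finset.range (n + 1 - m), (f.coeff (m + i) : ℂ) * z ^ i := by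
    rw [Finset.mul_sum]
    refine Finset.sum_congr rfl fun i _ => ?_
    rw [zsmul_eq_mul, pow_add]; ring
  rw [h3] at hz
  set T := ∑ i ∈ Finset.range (n + 1 - m), (f.coeff (m + i) : ℂ) * z ^ i
  have h4 : ‖z‖ ^ m * ‖T‖ ≤ H * ∑ i ∈ Finset.range m, ‖z‖ ^ i := by
    rw [← norm_pow, ← norm_mul, eq_neg_of_add_eq_zero_right hz, norm_neg]
    exact h1
  have h5 := sum_range_pow_mul_le h2 m
  have h6 : 0 < ‖z‖ ^ m := by positivity
  have h7 : ‖z‖ ^ m * (‖T‖ * ‖z‖) ≤ ‖z‖ ^ m * (2 * H) := by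
    calc ‖z‖ ^ m * (‖T‖ * ‖z‖) = (‖z‖ ^ m * ‖T‖) * ‖z‖ := by ring
      _ ≤ (H * ∑ i ∈ Finset.range m, ‖z‖ ^ i) * ‖z‖ := by gcongr
      _ = H * ((∑ i ∈ Finset.range m, ‖z‖ ^ i) * ‖z‖) := by ring
      _ ≤ H * (2 * ‖z‖ ^ m) := by gcongr
      _ = _ := by ring
  exact le_of_mul_le_mul_left h7 h6

/-- A polynomial with a large second coefficient has a single dominant root. -/
theorem numDominant_eq_one {n H : ℕ} (hf : f.Monic) (hn : f.natDegree = n) (hn1 : 1 ≤ n)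
    (hH1 : 1 ≤ H) (hH : polyHeight f ≤ H)
    (ha : 64 * (n : ℤ) ^ 2 * H ≤ f.coeff (n - 1) ^ 2) : numDominant f = 1 := by
  classical
  set a : ℂ := (f.coeff (n - 1) : ℂ) with hadef
  set A : ℝ := ‖a‖ with hA
  have hn1' : (1 : ℝ) ≤ n := by exact_mod_cast hn1
  have hH1' : (1 : ℝ) ≤ H := by exact_mod_cast hH1
  have hA2 : 64 * (n : ℝ) ^ 2 * H ≤ A ^ 2 := by
    rw [hA, hadef, Complex.norm_intCast, sq_abs]
    exact_mod_cast ha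
  have hA8 : 8 * (n : ℝ) ≤ A := by
    refine le_of_sq_le_sq ?_ (norm_nonneg _)
    nlinarith [sq_nonneg (n : ℝ)]
  -- With this threshold the small roots sum to at most `n * R = A / 4`, while a large root differs
  -- from `-a` by at most `2 * H / R`, which is at most `A / 8` by the hypothesis on `a`.
  set R : ℝ := A / (4 * n) with hR
  have hR2 : 2 ≤ R := by
    rw [hR, le_div_iff₀ (by positivity)]; linarith
  have hbig : ∀ z ∈ f.aroots ℂ, R ≤ ‖z‖ → ‖z - -a‖ ≤ A / 8 := by
    intro z hz hzR
    have h1 := norm_lead_terms_mul_le (m := n - 1) (by omega) hn hH ((mem_aroots_iff hf).mp hz)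
      (hR2.trans hzR)
    rw [show n + 1 - (n - 1) = 2 by omega, Finset.sum_range_succ, Finset.sum_range_one,
      show n - 1 + 1 = n by omega] at h1
    nth_rewrite 2 [← hn] at h1
    rw [hf.coeff_natDegree] at h1
    simp only [add_zero, pow_zero, mul_one, Int.cast_one, one_mul, pow_one] at h1
    rw [sub_neg_eq_add, add_comm]
    have h2 : ‖a + z‖ * R ≤ 2 * H := le_trans (by gcongr) h1
    have h3 : 2 * (H : ℝ) ≤ A / 8 * R := by
      rw [hR, div_mul_div_comm, le_div_iff₀ (by positivity)]
      nlinarith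
    exact le_of_mul_le_mul_right (h2.trans h3) (by linarith)
  set s := f.aroots ℂ
  set b := s.filter fun z => R ≤ ‖z‖ with hb
  set t := s.filter fun z => ¬ R ≤ ‖z‖ with ht
  have hst : b + t = s := Multiset.filter_add_not _ _
  have hsum : b.sum + t.sum = -a := by
    rw [← Multiset.sum_add, hst, sum_aroots hf (by omega), hn]
  have htb : ‖t.sum‖ ≤ A / 4 := by
    have h1 := norm_sum_map_sub_le (s := t) (g := id) (c := 0) (ε := R) (by
      intro z hz
      rw [ht, Multiset.mem_filter] at hz
      simpa using (not_le.mp hz.2).le)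
    rw [Multiset.map_id, mul_zero, sub_zero] at h1
    have h2 : (t.card : ℝ) ≤ n := by
      have : t.card ≤ s.card := Multiset.card_le_card (Multiset.filter_le _ _)
      rw [card_aroots hf, hn] at this
      exact_mod_cast this
    refine h1.trans ?_
    calc (t.card : ℝ) * R ≤ n * R := by gcongr
      _ = A / 4 := by rw [hR]; field_simp
  have hbb := norm_sum_map_sub_le (s := b) (g := id) (c := -a) (ε := A / 8) (by
      intro z hz
      rw [hb, Multiset.mem_filter] at hz
      exact hbig z hz.1 hz.2)
  rw [Multiset.map_id] at hbb
  -- For `k` large roots, `|k - 1| ≤ 1 / 4 + k / 8`, whose only solution in naturals is `k = 1`.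
  have hk : |(b.card : ℝ) - 1| * A ≤ A / 4 + b.card * (A / 8) := by
    have h1 : ((b.card : ℂ) - 1) * a = t.sum + (b.sum - b.card * -a) := by
      linear_combination -hsum
    have h2 : ‖((b.card : ℂ) - 1) * a‖ = |(b.card : ℝ) - 1| * A := by
      rw [norm_mul]
      congr 1
      rw [← Complex.ofReal_natCast, ← Complex.ofReal_one, ← Complex.ofReal_sub, Complex.norm_real,
        Real.norm_eq_abs]
    rw [← h2, h1]
    exact (norm_add_le _ _).trans (add_le_add htb hbb)
  have hApos : 0 < A := by linarith
  have hk' : |(b.card : ℝ) - 1| ≤ 1 / 4 + b.card / 8 := by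
    refine le_of_mul_le_mul_right ?_ hApos
    linarith
  rw [abs_le] at hk'
  have hcard : b.card = 1 := by
    have h1 : b.card < 2 := by
      have : (b.card : ℝ) < 2 := by linarith
      exact_mod_cast this
    have h2 : 0 < b.card := by
      have : (0 : ℝ) < b.card := by linarith
      exact_mod_cast this
    omega
  obtain ⟨w, hw⟩ := Multiset.card_eq_one.mp hcard
  have hwb : w ∈ b := by rw [hw]; simp
  have hws := Multiset.mem_filter.mp hwb
  have hsmall : ∀ z ∈ t, ‖z‖₊ < ‖w‖₊ := by
    intro z hz
    rw [ht, Multiset.mem_filter, not_le] at hz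
    exact hz.2.trans_le hws.2
  rw [numDominant_eq_countP (r := ‖w‖₊) (w := w) _ hws.1 rfl]
  · change s.countP _ = 1
    rw [← hst, Multiset.countP_add, Multiset.countP_eq_zero.mpr fun z hz => (hsmall z hz).ne,
      Multiset.countP_eq_card.mpr (by simp [hw]), hcard]
  · intro z hz
    change z ∈ s at hz
    rw [← hst, Multiset.mem_add, hw, Multiset.mem_singleton] at hz
    rcases hz with rfl | hz
    · rfl
    · exact (hsmall z hz).le

/-- A polynomial with small second and large positive third coefficient has a conjugate pair of
dominant roots. -/
theorem numDominant_eq_two {n H : ℕ} (hf : f.Monic) (hn : f.natDegree = n) (hn2 : 2 ≤ n)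
    (hH1 : (256 * n) ^ 2 ≤ H) (hH : polyHeight f ≤ H)
    (ha : 4096 * f.coeff (n - 1) ^ 2 ≤ H) (hb : (H : ℤ) ≤ 2 * f.coeff (n - 2)) :
    numDominant f = 2 := by
  classical
  set a : ℂ := (f.coeff (n - 1) : ℂ) with hadef
  set b : ℂ := (f.coeff (n - 2) : ℂ) with hbdef
  set B : ℝ := (f.coeff (n - 2) : ℝ) with hBdef
  have hbB : b = (B : ℂ) := by simp [hbdef, hBdef]
  set s : ℝ := Real.sqrt H with hs
  have hs2 : s ^ 2 = H := Real.sq_sqrt (Nat.cast_nonneg _)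
  have hs0 : 0 ≤ s := Real.sqrt_nonneg _
  have hn2' : (2 : ℝ) ≤ n := by exact_mod_cast hn2
  have hsn : 256 * (n : ℝ) ≤ s := Real.le_sqrt_of_sq_le (by exact_mod_cast hH1)
  have hA : ‖a‖ ≤ s / 64 := by
    refine le_of_sq_le_sq ?_ (by positivity)
    rw [hadef, Complex.norm_intCast, sq_abs, div_pow, hs2]
    have : 4096 * (f.coeff (n - 1) : ℝ) ^ 2 ≤ H := by exact_mod_cast ha
    linarith
  have hB1 : s ^ 2 ≤ 2 * B := by rw [hs2, hBdef]; exact_mod_cast hb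
  have hB2 : ‖b‖ ≤ s ^ 2 := by
    rw [hs2, hbdef, Complex.norm_intCast, ← Int.cast_abs, Int.abs_eq_natAbs]
    exact_mod_cast polyHeight_le_iff.mp hH (n - 2)
  -- Now the squares of the small roots sum to at most `n * R ^ 2 ≤ H / 16`, and for large roots the
  -- error `2 * H / R` is at most `H / 32`.
  set R : ℝ := s / (4 * n) with hR
  have hR64 : 64 ≤ R := by
    rw [hR, le_div_iff₀ (by positivity)]; linarith
  have hbig : ∀ z ∈ f.aroots ℂ, R ≤ ‖z‖ → ‖z ^ 2 - -b‖ ≤ B / 8 := by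
    intro z hz hzR
    have h1 := norm_lead_terms_mul_le (m := n - 2) (by omega) hn hH ((mem_aroots_iff hf).mp hz)
      (by linarith)
    rw [show n + 1 - (n - 2) = 3 by omega, Finset.sum_range_succ, Finset.sum_range_succ,
      Finset.sum_range_one, show n - 2 + 1 = n - 1 by omega, show n - 2 + 2 = n by omega] at h1
    nth_rewrite 3 [← hn] at h1
    rw [hf.coeff_natDegree] at h1
    simp only [add_zero, pow_zero, mul_one, Int.cast_one, one_mul, pow_one] at h1
    change ‖b + a * z + z ^ 2‖ * ‖z‖ ≤ 2 * H at h1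
    rw [← hs2] at h1
    set r := ‖z‖
    set T := b + a * z + z ^ 2
    have h2 : ‖T‖ * R ≤ 2 * s ^ 2 := le_trans (by gcongr) h1
    have h3 : ‖T‖ ≤ s ^ 2 / 32 := by
      nlinarith [norm_nonneg T]
    -- Beyond `2 * √H` the term `z ^ 2` exceeds the error, `b` and `a * z` together. The bound on
    -- `r` makes `a * z` negligible, leaving `z ^ 2` close to `-b`.
    have hr : r ≤ 2 * s := by
      by_contra! hlt
      have h4 : ‖z ^ 2‖ ≤ ‖T‖ + ‖b‖ + ‖a * z‖ := by
        have : z ^ 2 = T - b - a * z := by simp only [T]; ring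
        rw [this]
        exact (norm_sub_le _ _).trans (add_le_add_left (norm_sub_le _ _) _)
      rw [norm_pow, norm_mul] at h4
      change r ^ 2 ≤ ‖T‖ + ‖b‖ + ‖a‖ * r at h4
      have h5 : ‖a‖ * r ≤ s / 64 * r := by gcongr
      nlinarith
    have h6 : z ^ 2 - -b = T - a * z := by simp only [T]; ring
    rw [h6]
    have h7 : ‖a * z‖ ≤ s / 64 * (2 * s) := by
      rw [norm_mul]; gcongr
    have := norm_sub_le T (a * z)
    nlinarith
  set S := f.aroots ℂ
  set g := S.filter fun z => R ≤ ‖z‖ with hg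
  set t := S.filter fun z => ¬ R ≤ ‖z‖ with ht
  have hst : g + t = S := Multiset.filter_add_not _ _
  have hsum : (g.map fun z => z ^ 2).sum + (t.map fun z => z ^ 2).sum = a ^ 2 - 2 * b := by
    rw [← Multiset.sum_add, ← Multiset.map_add, hst, sum_sq_aroots hf (by omega), hn]
  have htb : ‖(t.map fun z => z ^ 2).sum‖ ≤ s ^ 2 / 16 := by
    have h1 := norm_sum_map_sub_le (s := t) (g := fun z => z ^ 2) (c := 0) (ε := R ^ 2) (by
      intro z hz
      rw [ht, Multiset.mem_filter] at hz
      rw [sub_zero, norm_pow]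
      have := (not_le.mp hz.2).le
      gcongr)
    rw [mul_zero, sub_zero] at h1
    have h2 : (t.card : ℝ) ≤ n := by
      have : t.card ≤ S.card := Multiset.card_le_card (Multiset.filter_le _ _)
      rw [card_aroots hf, hn] at this
      exact_mod_cast this
    refine h1.trans ?_
    calc (t.card : ℝ) * R ^ 2 ≤ n * R ^ 2 := by gcongr
      _ = s ^ 2 / (16 * n) := by rw [hR]; field_simp; ring
      _ ≤ s ^ 2 / 16 := by gcongr; linarith
  have hgb := norm_sum_map_sub_le (s := g) (g := fun z => z ^ 2) (c := -b) (ε := B / 8) (by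
      intro z hz
      rw [hg, Multiset.mem_filter] at hz
      exact hbig z hz.1 hz.2)
  have hBpos : 0 < B := by nlinarith
  have hnb : ‖b‖ = B := by rw [hbB, Complex.norm_real, Real.norm_of_nonneg hBpos.le]
  -- Here `|k - 2| ≤ 1 / 4 + k / 8` forces `k = 2`.
  have hk : |(g.card : ℝ) - 2| * B ≤ B / 4 + g.card * (B / 8) := by
    have h1 : ((g.card : ℂ) - 2) * b = (t.map fun z => z ^ 2).sum - a ^ 2
        + ((g.map fun z => z ^ 2).sum - g.card * -b) := by
      linear_combination -hsum
    have h2 : ‖((g.card : ℂ) - 2) * b‖ = |(g.card : ℝ) - 2| * B := by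
      rw [norm_mul, hnb]
      congr 1
      rw [← Complex.ofReal_natCast, ← Complex.ofReal_ofNat, ← Complex.ofReal_sub, Complex.norm_real,
        Real.norm_eq_abs]
    rw [← h2, h1]
    have h3 : ‖a ^ 2‖ ≤ (s / 64) ^ 2 := by rw [norm_pow]; gcongr
    have h4 := norm_sub_le (t.map fun z => z ^ 2).sum (a ^ 2)
    refine (norm_add_le _ _).trans (add_le_add ?_ hgb)
    nlinarith
  have hk' : |(g.card : ℝ) - 2| ≤ 1 / 4 + g.card / 8 := by
    refine le_of_mul_le_mul_right ?_ hBpos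
    linarith
  rw [abs_le] at hk'
  have hcard : g.card = 2 := by
    have h1 : g.card < 3 := by
      have : (g.card : ℝ) < 3 := by linarith
      exact_mod_cast this
    have h2 : 1 < g.card := by
      have : (1 : ℝ) < g.card := by linarith
      exact_mod_cast this
    omega
  obtain ⟨w, w', hw⟩ := Multiset.card_eq_two.mp hcard
  have hwb : w ∈ g := by rw [hw]; simp
  have hws := Multiset.mem_filter.mp hwb
  have hcw : starRingEnd ℂ w ∈ g :=
    Multiset.mem_filter.mpr ⟨conj_mem_aroots hws.1, by simpa using hws.2⟩
  -- The square of a real number is nonnegative, so it cannot lie within `B / 8` of `-B`.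
  have hne : starRingEnd ℂ w ≠ w := by
    intro h
    obtain ⟨x, hx⟩ := Complex.conj_eq_iff_real.mp h
    have h1 := hbig w hws.1 hws.2
    rw [hx, hbB, sub_neg_eq_add, ← Complex.ofReal_pow, ← Complex.ofReal_add, Complex.norm_real,
      Real.norm_of_nonneg (by positivity)] at h1
    nlinarith [sq_nonneg x]
  have hw' : starRingEnd ℂ w = w' := by
    rw [hw] at hcw
    simpa [hne] using hcw
  have hnw : ‖w'‖₊ = ‖w‖₊ := by rw [← hw', nnnorm_conj]
  have hsmall : ∀ z ∈ t, ‖z‖₊ < ‖w‖₊ := by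
    intro z hz
    rw [ht, Multiset.mem_filter, not_le] at hz
    exact hz.2.trans_le hws.2
  rw [numDominant_eq_countP (r := ‖w‖₊) (w := w) _ hws.1 rfl]
  · change S.countP _ = 2
    rw [← hst, Multiset.countP_add, Multiset.countP_eq_zero.mpr fun z hz => (hsmall z hz).ne,
      Multiset.countP_eq_card.mpr (by simp [hw, hnw]), hcard]
  · intro z hz
    change z ∈ S at hz
    rw [← hst, Multiset.mem_add, hw, Multiset.insert_eq_cons, Multiset.mem_cons,
      Multiset.mem_singleton] at hz
    rcases hz with (rfl | rfl) | hz
    · rfl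
    · exact hnw.le
    · exact (hsmall z hz).le

end Roots

/-! ### Heights of products, and negated roots -/

section Heights

/-- The Mahler measure of an integer polynomial. -/
noncomputable abbrev intMahler (f : ℤ[X]) : ℝ := f.mapMahlerMeasure (Int.castRingHom ℂ)

theorem isometry_intCast_complex : Isometry (Int.castRingHom ℂ) := by
  refine AddMonoidHomClass.isometry_of_norm _ fun z => ?_
  simp [Complex.norm_intCast, Int.norm_eq_abs]

theorem intMahler_le (f : ℤ[X]) : intMahler f ≤ (f.natDegree + 1) * polyHeight f := by
  refine (mapMahlerMeasure_le_sum_norm_coeff f _ isometry_intCast_complex).trans ?_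
  rw [sum_over_range _ (by simp)]
  calc ∑ i ∈ Finset.range (f.natDegree + 1), ‖f.coeff i‖
      ≤ ∑ i ∈ Finset.range (f.natDegree + 1), (polyHeight f : ℝ) := by
        refine Finset.sum_le_sum fun i _ => ?_
        rw [Int.norm_eq_abs, ← Int.cast_abs, Int.abs_eq_natAbs]
        exact_mod_cast natAbs_coeff_le_polyHeight f i
    _ = _ := by simp

theorem polyHeight_le_intMahler (f : ℤ[X]) :
    (polyHeight f : ℝ) ≤ 2 ^ f.natDegree * intMahler f := by
  have h0 : 0 ≤ intMahler f := mapMahlerMeasure_nonneg _ _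
  have h : polyHeight f ≤ ⌊2 ^ f.natDegree * intMahler f⌋₊ := by
    rw [polyHeight_le_iff]
    intro i
    refine Nat.le_floor ?_
    have h1 := norm_coeff_le_choose_mul_mapMahlerMeasure _ isometry_intCast_complex i f
    rw [Int.norm_eq_abs] at h1
    calc ((f.coeff i).natAbs : ℝ) ≤ (f.natDegree.choose i : ℝ) * intMahler f := by
          rwa [Nat.cast_natAbs, Int.cast_abs]
      _ ≤ 2 ^ f.natDegree * intMahler f := by
        gcongr
        exact_mod_cast Nat.choose_le_two_pow _ _
  exact (Nat.cast_le.mpr h).trans (Nat.floor_le (by positivity))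

/-- The Mahler measure is multiplicative and agrees with the height up to constants depending on the
degree. Hence the factors of a polynomial of height `H` cannot all be large. -/
theorem polyHeight_mul_ge {f g : ℤ[X]} (hf : f.Monic) (hg : g.Monic) :
    polyHeight f * polyHeight g ≤
      2 ^ (f * g).natDegree * ((f * g).natDegree + 1) * polyHeight (f * g) := by
  have h1 := polyHeight_le_intMahler f
  have h2 := polyHeight_le_intMahler g
  have h3 := intMahler_le (f * g)
  have h4 : intMahler (f * g) = intMahler f * intMahler g := mapMahlerMeasure_mul _ _ _
  have h5 : 0 ≤ intMahler f := mapMahlerMeasure_nonneg _ _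
  have h : ((polyHeight f * polyHeight g : ℕ) : ℝ) ≤
      (2 ^ (f * g).natDegree * ((f * g).natDegree + 1) * polyHeight (f * g) : ℕ) := by
    push_cast
    calc (polyHeight f : ℝ) * polyHeight g
        ≤ (2 ^ f.natDegree * intMahler f) * (2 ^ g.natDegree * intMahler g) := by gcongr
      _ = 2 ^ (f * g).natDegree * intMahler (f * g) := by
        rw [hf.natDegree_mul hg, pow_add, h4]; ring
      _ ≤ 2 ^ (f * g).natDegree * (((f * g).natDegree + 1) * polyHeight (f * g)) := by gcongr
      _ = _ := by ring
  exact_mod_cast h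

theorem polyHeight_mul_mul_ge {f g h : ℤ[X]} (hf : f.Monic) (hg : g.Monic) (hh : h.Monic) :
    polyHeight f * polyHeight g * polyHeight h ≤
      (2 ^ (f * g * h).natDegree * ((f * g * h).natDegree + 1)) ^ 2 * polyHeight (f * g * h) := by
  have h1 := polyHeight_mul_ge hf hg
  have h2 := polyHeight_mul_ge (hf.mul hg) hh
  set d := (f * g * h).natDegree
  have hd : (f * g).natDegree ≤ d := by
    simp only [d]
    rw [(hf.mul hg).natDegree_mul hh]; omega
  calc polyHeight f * polyHeight g * polyHeight h
      ≤ 2 ^ d * (d + 1) * polyHeight (f * g) * polyHeight h := by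
        refine Nat.mul_le_mul_right _ (h1.trans ?_)
        gcongr
        norm_num
    _ = 2 ^ d * (d + 1) * (polyHeight (f * g) * polyHeight h) := by ring
    _ ≤ 2 ^ d * (d + 1) * (2 ^ d * (d + 1) * polyHeight (f * g * h)) := by gcongr
    _ = _ := by ring

/-- The monic polynomial whose roots are the negatives of the roots of `f`. -/
noncomputable def negRoots (f : ℤ[X]) : ℤ[X] := (-1) ^ f.natDegree * f.comp (-X)

theorem negRoots_monic {f : ℤ[X]} (hf : f.Monic) : (negRoots f).Monic :=
  hf.neg_one_pow_natDegree_mul_comp_neg_X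

theorem natAbs_coeff_negRoots (f : ℤ[X]) (i : ℕ) :
    ((negRoots f).coeff i).natAbs = (f.coeff i).natAbs := by
  have h : ((-1) ^ f.natDegree : ℤ[X]) = C ((-1) ^ f.natDegree) := by simp
  rw [negRoots, h, coeff_C_mul, show (-X : ℤ[X]) = C (-1) * X by simp, comp_C_mul_X_coeff]
  simp [Int.natAbs_mul, Int.natAbs_pow]

theorem polyHeight_negRoots (f : ℤ[X]) : polyHeight (negRoots f) = polyHeight f := by
  refine eq_of_forall_ge_iff fun H => ?_
  simp only [polyHeight_le_iff, natAbs_coeff_negRoots]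

theorem natDegree_negRoots {f : ℤ[X]} : (negRoots f).natDegree = f.natDegree := by
  have h : ((-1) ^ f.natDegree : ℤ[X]) = C ((-1) ^ f.natDegree) := by simp
  rw [negRoots, h, natDegree_C_mul (by simp), natDegree_comp]
  simp

theorem minpoly_neg_eq_negRoots {α : ℂ} (hα : IsIntegral ℤ α) :
    minpoly ℤ (-α) = negRoots (minpoly ℤ α) := by
  have hinj : Function.Injective (algebraMap ℤ ℚ) := (algebraMap ℤ ℚ).injective_int
  apply Polynomial.map_injective _ hinj
  have h1 := minpoly.isIntegrallyClosed_eq_field_fractions' ℚ hα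
  have h2 := minpoly.isIntegrallyClosed_eq_field_fractions' ℚ hα.neg
  rw [← h2, minpoly.neg, h1, negRoots, natDegree_map_eq_of_injective hinj]
  simp [Polynomial.map_comp]

end Heights

/-! ### Upper bounds: reducible polynomials and several dominant roots -/

section UpperBounds

/-- By `polyHeight_mul_ge` the heights of the two factors multiply to `O(H)`, so `HasGrowth.pairs`
with the height as weight applies. -/
theorem HasGrowth.mul {A B : Set ℤ[X]} {a e : ℝ} (hAm : ∀ g ∈ A, g.Monic) (hBm : ∀ g ∈ B, g.Monic)
    (hA : HasGrowth (fun T => {x ∈ A | polyHeight x ≤ T}) a)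
    (hB : HasGrowth (fun T => {x ∈ B | polyHeight x ≤ T}) e) (ha : 0 ≤ a) (hae : a < e) (n : ℕ) :
    HasGrowth (fun H => {f ∈ monicBox n H | ∃ g ∈ A, ∃ h ∈ B, g * h = f}) e := by
  refine ((hA.pairs hB (fun g hg => (hAm g hg).one_le_polyHeight)
    (fun g hg => (hBm g hg).one_le_polyHeight) ha hae (2 ^ n * (n + 1))).image
    (fun p : ℤ[X] × ℤ[X] => p.1 * p.2)).subset ?_
  rintro H - f ⟨⟨-, hn, hH⟩, g, hg, h, hh, rfl⟩
  refine ⟨(g, h), ⟨hg, hh, ?_⟩, rfl⟩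
  refine (polyHeight_mul_ge (hAm g hg) (hBm h hh)).trans ?_
  rw [hn]
  gcongr

theorem hasGrowth_monic_degree (j : ℕ) :
    HasGrowth (fun T => {x ∈ {f : ℤ[X] | f.Monic ∧ f.natDegree = j} | polyHeight x ≤ T}) j :=
  (hasGrowth_monicBox j).subset fun _ _ _ h => ⟨h.1.1, h.1.2, h.2⟩

theorem exists_factor_of_not_irreducible {f : ℤ[X]} (hf : f.Monic) (hd : 1 ≤ f.natDegree)
    (h : ¬ Irreducible f) : ∃ g h : ℤ[X], g.Monic ∧ h.Monic ∧ g * h = f ∧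
      1 ≤ g.natDegree ∧ 2 * g.natDegree ≤ f.natDegree ∧ g.natDegree + h.natDegree = f.natDegree := by
  rw [hf.irreducible_iff_natDegree'] at h
  push Not at h
  obtain ⟨g, k, hg, hh, rfl, hdeg⟩ := h (by rintro h1; simp [h1] at hd)
  rw [Finset.mem_Ioc] at hdeg
  have := hg.natDegree_mul hh
  exact ⟨k, g, hh, hg, mul_comm _ _, by omega, by omega, by omega⟩

/-- Van der Waerden's bound for the number of reducible polynomials. -/
theorem hasGrowth_reducible {n : ℕ} (hn : 3 ≤ n) :
    HasGrowth (fun H => {f ∈ monicBox n H | ¬ Irreducible f}) ((n : ℝ) - 1) := by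
  have hn' : (3 : ℝ) ≤ n := by exact_mod_cast hn
  refine (HasGrowth.biUnion_range (n / 2) (A := fun i H => {f ∈ monicBox n H |
    ∃ g ∈ {f : ℤ[X] | f.Monic ∧ f.natDegree = i + 1},
      ∃ h ∈ {f : ℤ[X] | f.Monic ∧ f.natDegree = n - (i + 1)}, g * h = f}) ?_).subset ?_
  · intro i hi
    -- The smaller factor has degree at most `n / 2 < n - 1` because `n ≥ 3`; this is the strict
    -- inequality of exponents that keeps a logarithm out of the bound.
    have hi2 : ((i + 1 : ℕ) : ℝ) * 2 ≤ n := by exact_mod_cast (by omega : (i + 1) * 2 ≤ n)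
    refine HasGrowth.mul (fun _ h => h.1) (fun _ h => h.1) (hasGrowth_monic_degree (i + 1))
      ((hasGrowth_monic_degree (n - (i + 1))).mono ?_) (Nat.cast_nonneg _) (by linarith) n
    rw [Nat.cast_sub (by omega)]
    push_cast
    have : (0 : ℝ) ≤ i := by positivity
    linarith
  · rintro H - f ⟨hf, hred⟩
    obtain ⟨g, h, hg, hh, hgh, h1, h2, h3⟩ :=
      exists_factor_of_not_irreducible hf.1 (by rw [hf.2.1]; omega) hred
    have hfn := hf.2.1
    simp only [Set.mem_iUnion, exists_prop]
    exact ⟨g.natDegree - 1, by omega, hf, g, ⟨hg, by omega⟩, h, ⟨hh, by omega⟩, hgh⟩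

/-- Few polynomials have more than one dominant root. -/
theorem hasGrowth_numDominant_ne_one {n : ℕ} (hn : 1 ≤ n) :
    HasGrowth (fun H => {f ∈ monicBox n H | numDominant f ≠ 1}) ((n : ℝ) - 1 / 2) := by
  obtain ⟨m, rfl⟩ : ∃ m, n = m + 1 := ⟨n - 1, by omega⟩
  refine ⟨3 ^ m * (17 * (m + 1)), fun H hH => ⟨(monicBox_finite _ H).subset fun _ h => h.1, ?_⟩⟩
  -- By `numDominant_eq_one` the coefficient of `X ^ m` is confined to `[-N, N]` with `N = O(√H)`;
  -- the others range freely.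
  set N := Nat.sqrt (64 * (m + 1) ^ 2 * H) with hN
  set S : ℕ → Finset ℤ := fun i => if i = m then Finset.Icc (-(N : ℤ)) N else
    Finset.Icc (-(H : ℤ)) H with hS
  have hsub : {f ∈ monicBox (m + 1) H | numDominant f ≠ 1} ⊆ coeffBox (m + 1) S := by
    rintro f ⟨⟨hf, hn, hfH⟩, hnd⟩
    refine ⟨hf, hn, fun i _ => ?_⟩
    by_cases him : i = m
    · simp only [hS, if_pos him, Finset.mem_Icc]
      have h1 : f.coeff i ^ 2 < 64 * ((m + 1 : ℕ) : ℤ) ^ 2 * H := by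
        by_contra! h
        refine hnd (numDominant_eq_one hf hn (by omega) hH hfH ?_)
        rwa [show m + 1 - 1 = i by omega]
      have h2 : (f.coeff i).natAbs ≤ N := by
        rw [hN, Nat.le_sqrt']
        have : ((f.coeff i).natAbs : ℤ) ^ 2 < 64 * ((m + 1 : ℕ) : ℤ) ^ 2 * H := by
          rwa [Int.natAbs_sq]
        exact le_of_lt (by exact_mod_cast this)
      omega
    · simp only [hS, if_neg him, Finset.mem_Icc]
      have := polyHeight_le_iff.mp hfH i
      omega
  have h1 := Set.ncard_le_ncard hsub (coeffBox_finite _ _)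
  rw [ncard_coeffBox, Finset.prod_range_succ] at h1
  have h2 : ∏ i ∈ Finset.range m, (S i).card = (2 * H + 1) ^ m := by
    rw [Finset.prod_congr rfl (g := fun _ => 2 * H + 1), Finset.prod_const, Finset.card_range]
    intro i hi
    simp only [hS, if_neg (Finset.mem_range.mp hi).ne, Int.card_Icc]
    omega
  have h3 : (S m).card = 2 * N + 1 := by
    simp only [hS, if_pos, Int.card_Icc]
    omega
  rw [h2, h3] at h1
  have hH1 : (1 : ℝ) ≤ H := by exact_mod_cast hH
  have hs1 : 1 ≤ Real.sqrt H := Real.one_le_sqrt.mpr hH1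
  have hN2 : (N : ℝ) ≤ 8 * (m + 1) * Real.sqrt H := by
    refine (Real.nat_sqrt_le_real_sqrt).trans ?_
    rw [Real.sqrt_le_left (by positivity), mul_pow, Real.sq_sqrt (by positivity)]
    push_cast
    nlinarith
  have h4 : ((2 * H + 1 : ℕ) : ℝ) ≤ 3 * H := by push_cast; linarith
  have h5 : ((2 * N + 1 : ℕ) : ℝ) ≤ 17 * (m + 1) * Real.sqrt H := by
    push_cast
    have : (1 : ℝ) ≤ (m + 1) * Real.sqrt H := by
      nlinarith [(Nat.cast_nonneg m : (0 : ℝ) ≤ m)]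
    nlinarith
  calc ((_ : ℕ) : ℝ) ≤ (((2 * H + 1) ^ m * (2 * N + 1) : ℕ) : ℝ) := by exact_mod_cast h1
    _ = ((2 * H + 1 : ℕ) : ℝ) ^ m * ((2 * N + 1 : ℕ) : ℝ) := by push_cast; ring
    _ ≤ (3 * H) ^ m * (17 * (m + 1) * Real.sqrt H) := by gcongr
    _ = 3 ^ m * (17 * (m + 1)) * ((H : ℝ) ^ m * Real.sqrt H) := by rw [mul_pow]; ring
    _ = _ := by
      rw [show (((m + 1 : ℕ) : ℝ) - 1 / 2) = m + 1 / 2 by push_cast; ring,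
        Real.rpow_add (by linarith), Real.rpow_natCast, Real.sqrt_eq_rpow]

theorem isIntegral_of_mem_aroots {f : ℤ[X]} (hf : f.Monic) {z : ℂ} (hz : z ∈ f.aroots ℂ) :
    IsIntegral ℤ z :=
  ⟨f, hf, by rw [← aeval_def]; exact (mem_aroots_iff hf).mp hz⟩

theorem exists_eq_minpoly_mul {f : ℤ[X]} (hf : f.Monic) {z : ℂ} (hz : z ∈ f.aroots ℂ) :
    ∃ h : ℤ[X], h.Monic ∧ f = minpoly ℤ z * h := by
  have hi := isIntegral_of_mem_aroots hf hz
  obtain ⟨h, hh⟩ := minpoly.isIntegrallyClosed_dvd hi ((mem_aroots_iff hf).mp hz)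
  exact ⟨h, (minpoly.monic hi).of_mul_monic_left (hh ▸ hf), hh⟩

/-- A reducible polynomial with two dominant roots either has a proper factor with several dominant
roots or is of the form `p * p' * q` with `p'` equal to `p` up to the sign of the roots. -/
theorem factor_of_numDominant_eq_two {f : ℤ[X]} (hf : f.Monic) (hd : 1 ≤ f.natDegree)
    (hred : ¬ Irreducible f) (h2 : numDominant f = 2) :
    (∃ p h : ℤ[X], p.Monic ∧ h.Monic ∧ numDominant p ≠ 1 ∧ 2 ≤ p.natDegree ∧ 1 ≤ h.natDegree ∧
      f = p * h) ∨
    ∃ p q : ℤ[X], p.Monic ∧ q.Monic ∧ 1 ≤ p.natDegree ∧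
      (f = p * p * q ∨ f = p * negRoots p * q) := by
  obtain ⟨α, hα, hαf⟩ := exists_nnnorm_eq_house hf hd
  have hi := isIntegral_of_mem_aroots hf hα
  obtain ⟨h, hh, hfh⟩ := exists_eq_minpoly_mul hf hα
  set p := minpoly ℤ α with hp
  have hpm : p.Monic := minpoly.monic hi
  have hpd : 1 ≤ p.natDegree := minpoly.natDegree_pos hi
  have hroots : f.aroots ℂ = p.aroots ℂ + h.aroots ℂ := by rw [hfh]; exact aroots_mul_monic hpm hh
  have hαp : α ∈ p.aroots ℂ := (mem_aroots_iff hpm).mpr (minpoly.aeval ℤ α)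
  have hle : ∀ z ∈ p.aroots ℂ, ‖z‖₊ ≤ house f := fun z hz =>
    nnnorm_le_house (by rw [hroots]; simp [hz])
  have hpn := numDominant_eq_countP hle hαp hαf
  have hcount : (p.aroots ℂ).countP (fun z => ‖z‖₊ = house f) +
      (h.aroots ℂ).countP (fun z => ‖z‖₊ = house f) = 2 := by
    rw [← h2, ← Multiset.countP_add, ← hroots]
    rfl
  by_cases h1 : numDominant p = 1
  · right
    have hp1 : (h.aroots ℂ).countP (fun z => ‖z‖₊ = house f) = 1 := by omega
    obtain ⟨β, hβ, hβf⟩ := Multiset.countP_pos.mp (by omega :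
      0 < (h.aroots ℂ).countP (fun z => ‖z‖₊ = house f))
    -- A root that is alone on its circle is fixed by conjugation. Thus `α` and `β` are real of
    -- equal modulus, so `β = ±α`, and the minimal polynomial of `β` divides the cofactor `h`.
    have real_of {g : ℤ[X]} {z : ℂ} (hz : z ∈ g.aroots ℂ) (hzf : ‖z‖₊ = house f)
        (hc : (g.aroots ℂ).countP (fun z => ‖z‖₊ = house f) = 1) : starRingEnd ℂ z = z := by
      rw [Multiset.countP_eq_card_filter, Multiset.card_eq_one] at hc
      obtain ⟨w, hw⟩ := hc
      have e1 : z = w := by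
        rw [← Multiset.mem_singleton, ← hw, Multiset.mem_filter]; exact ⟨hz, hzf⟩
      have e2 : starRingEnd ℂ z = w := by
        rw [← Multiset.mem_singleton, ← hw, Multiset.mem_filter, nnnorm_conj]
        exact ⟨conj_mem_aroots hz, hzf⟩
      rw [e2, e1]
    obtain ⟨x, hx⟩ := Complex.conj_eq_iff_real.mp (real_of hαp hαf (by omega))
    obtain ⟨y, hy⟩ := Complex.conj_eq_iff_real.mp (real_of hβ hβf hp1)
    have hxy : β = α ∨ β = -α := by
      have : ‖β‖ = ‖α‖ := congrArg NNReal.toReal (hβf.trans hαf.symm)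
      rw [hx, hy, Complex.norm_real, Complex.norm_real, Real.norm_eq_abs, Real.norm_eq_abs,
        abs_eq_abs] at this
      rcases this with h | h
      · left; rw [hx, hy, h]
      · right; rw [hx, hy, h]; simp
    obtain ⟨q, hq, hhq⟩ := exists_eq_minpoly_mul hh hβ
    refine ⟨p, q, hpm, hq, hpd, ?_⟩
    rcases hxy with rfl | rfl
    · left; rw [hfh, hhq, mul_assoc]
    · right; rw [hfh, hhq, minpoly_neg_eq_negRoots hi, mul_assoc]
  · left
    refine ⟨p, h, hpm, hh, h1, ?_, ?_, hfh⟩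
    · have := one_le_numDominant hpm hpd
      have := numDominant_le hpm
      omega
    · by_contra! h0
      have : h = 1 := hh.natDegree_eq_zero.mp (by omega)
      rw [this, mul_one] at hfh
      rw [hfh] at hred
      exact hred (minpoly.irreducible hi)

theorem hasGrowth_reducible_numDominant_two {n : ℕ} (hn : 3 ≤ n) :
    HasGrowth (fun H => {f ∈ dominantSet n 2 H | ¬ Irreducible f}) ((n : ℝ) - 3 / 2) := by
  have hn' : (3 : ℝ) ≤ n := by exact_mod_cast hn
  -- A proper factor with several dominant roots: its cofactor has degree `i + 1 ≤ n - 2`, and the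
  -- factor itself has growth exponent `n - (i + 1) - 1 / 2 ≤ n - 3 / 2`.
  have g1 : HasGrowth (fun H => ⋃ i < n - 2, {f ∈ monicBox n H |
      ∃ g ∈ {f : ℤ[X] | f.Monic ∧ f.natDegree = i + 1},
      ∃ h ∈ {f : ℤ[X] | f.Monic ∧ f.natDegree = n - (i + 1) ∧ numDominant f ≠ 1}, g * h = f})
      ((n : ℝ) - 3 / 2) := by
    refine HasGrowth.biUnion_range (n - 2) fun i hi => ?_
    have hi2 : ((i + 1 : ℕ) : ℝ) ≤ n - 2 := by
      have : ((i + 1 + 2 : ℕ) : ℝ) ≤ n := by exact_mod_cast (by omega : i + 1 + 2 ≤ n)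
      push_cast at this ⊢
      linarith
    refine HasGrowth.mul (fun _ h => h.1) (fun _ h => h.1) (hasGrowth_monic_degree (i + 1))
      (((hasGrowth_numDominant_ne_one (n := n - (i + 1)) (by omega)).subset
        fun H _ f hf => ⟨⟨hf.1.1, hf.1.2.1, hf.2⟩, hf.1.2.2⟩).mono ?_)
      (Nat.cast_nonneg _) (by linarith) n
    rw [Nat.cast_sub (by omega)]
    push_cast
    have : (0 : ℝ) ≤ i := by positivity
    linarith
  -- A repeated factor `p`, up to the sign of its roots: with weight `polyHeight p ^ 2` the exponent
  -- of `p` is halved to at most `n / 4`, below `n - 3 / 2`, and the cofactor has degree at most `n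
  -- - 2`.
  have g2 : HasGrowth (fun H => ⋃ i < n - 1, {p : ℤ[X] × ℤ[X] |
      p.1 ∈ {f : ℤ[X] | f.Monic ∧ f.natDegree = i} ∧
      p.2 ∈ {f : ℤ[X] | f.Monic ∧ 4 * f.natDegree ≤ 2 * n} ∧
      polyHeight p.1 * polyHeight p.2 ^ 2 ≤ ((2 ^ n * (n + 1)) ^ 2) * H}) ((n : ℝ) - 3 / 2) := by
    refine HasGrowth.biUnion_range (n - 1) fun i hi => ?_
    have hi2 : (i : ℝ) ≤ n - 2 := by
      have : ((i + 2 : ℕ) : ℝ) ≤ n := by exact_mod_cast (by omega : i + 2 ≤ n)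
      push_cast at this
      linarith
    refine HasGrowth.pairs (A := {f : ℤ[X] | f.Monic ∧ f.natDegree = i}) (w := polyHeight)
      (B := {f : ℤ[X] | f.Monic ∧ 4 * f.natDegree ≤ 2 * n}) (w' := fun p => polyHeight p ^ 2)
      (hasGrowth_monic_degree i) ?_ (fun _ h => h.1.one_le_polyHeight)
      (fun _ h => Nat.one_le_pow _ _ h.1.one_le_polyHeight) (Nat.cast_nonneg i) (by linarith) _
    refine (HasGrowth.biUnion_range (n / 2 + 1) (A := fun k T => monicBox k (Nat.sqrt T))
      ?_).subset ?_
    · intro k hk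
      obtain ⟨C, hC0, hC⟩ := (hasGrowth_monicBox k).exists_nonneg
      refine ⟨C, fun H hH => ⟨monicBox_finite _ _, ?_⟩⟩
      refine ((hC (Nat.sqrt H) (Nat.le_sqrt'.mpr (by simpa))).2).trans ?_
      have hH1 : (1 : ℝ) ≤ H := by exact_mod_cast hH
      have h1 : ((Nat.sqrt H : ℕ) : ℝ) ≤ (H : ℝ) ^ (1 / 2 : ℝ) := by
        rw [← Real.sqrt_eq_rpow]; exact Real.nat_sqrt_le_real_sqrt
      have h2 : (k : ℝ) * 2 ≤ n := by exact_mod_cast (by omega : k * 2 ≤ n)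
      gcongr
      calc ((Nat.sqrt H : ℕ) : ℝ) ^ (k : ℝ) ≤ ((H : ℝ) ^ (1 / 2 : ℝ)) ^ (k : ℝ) := by gcongr
        _ = (H : ℝ) ^ (1 / 2 * (k : ℝ)) := by rw [← Real.rpow_mul (by linarith)]
        _ ≤ _ := Real.rpow_le_rpow_of_exponent_le hH1 (by linarith)
    · rintro T - p ⟨⟨hp, hpd⟩, hpT⟩
      simp only [Set.mem_iUnion, exists_prop]
      exact ⟨p.natDegree, by omega, hp, rfl, Nat.le_sqrt'.mpr hpT⟩
  refine ((g1.union (g2.image fun p => p.2 * p.2 * p.1)).union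
    (g2.image fun p => p.2 * negRoots p.2 * p.1)).subset ?_
  rintro H - f ⟨hf, hred⟩
  have hfn := hf.2.1
  rcases factor_of_numDominant_eq_two hf.1 (by omega) hred hf.2.2.2 with
    ⟨p, h, hp, hh, hp1, hpd, hhd, hph⟩ | ⟨p, q, hp, hq, hpd, hpq⟩
  · refine Or.inl (Or.inl ?_)
    have hdeg := hp.natDegree_mul hh
    rw [← hph, hfn] at hdeg
    simp only [Set.mem_iUnion, exists_prop]
    exact ⟨h.natDegree - 1, by omega, dominantSet_subset _ _ _ hf, h, ⟨hh, by omega⟩, p,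
      ⟨hp, by omega, hp1⟩, by rw [hph, mul_comm]⟩
  · have key : ∀ p' : ℤ[X], p'.Monic → p'.natDegree = p.natDegree → polyHeight p' = polyHeight p →
        f = p * p' * q → (q, p) ∈ ⋃ i < n - 1, {p : ℤ[X] × ℤ[X] |
          p.1 ∈ {f : ℤ[X] | f.Monic ∧ f.natDegree = i} ∧
          p.2 ∈ {f : ℤ[X] | f.Monic ∧ 4 * f.natDegree ≤ 2 * n} ∧
          polyHeight p.1 * polyHeight p.2 ^ 2 ≤ ((2 ^ n * (n + 1)) ^ 2) * H} := by
      intro p' hp' hd' hh' hfp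
      have hdeg := (hp.mul hp').natDegree_mul hq
      rw [← hfp, hfn, hp.natDegree_mul hp', hd'] at hdeg
      simp only [Set.mem_iUnion, exists_prop]
      refine ⟨q.natDegree, by omega, ⟨hq, rfl⟩, ⟨hp, show 4 * p.natDegree ≤ 2 * n by omega⟩, ?_⟩
      have h1 := polyHeight_mul_mul_ge hp hp' hq
      rw [← hfp, hfn, hh'] at h1
      calc polyHeight q * polyHeight p ^ 2 = polyHeight p * polyHeight p * polyHeight q := by ring
        _ ≤ _ := h1
        _ ≤ _ := by gcongr; exact hf.2.2.1
    rcases hpq with h | h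
    · exact Or.inl (Or.inr ⟨(q, p), key p hp rfl rfl h, h.symm⟩)
    · exact Or.inr ⟨(q, p), key _ (negRoots_monic hp) natDegree_negRoots (polyHeight_negRoots p) h,
        h.symm⟩

end UpperBounds

/-! ### Monotonicity of the counts and assembly of estimates -/

section Counts

theorem irredCount_mono (n k : ℕ) {H H' : ℕ} (h : H ≤ H') : irredCount n k H ≤ irredCount n k H' :=
  Set.ncard_le_ncard (fun _ hf => ⟨dominantSet_mono n k h hf.1, hf.2⟩)
    ((dominantSet_finite n k H').subset fun _ hf => hf.1)

theorem redCount_mono (n k : ℕ) {H H' : ℕ} (h : H ≤ H') : redCount n k H ≤ redCount n k H' :=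
  Set.ncard_le_ncard (fun _ hf => ⟨dominantSet_mono n k h hf.1, hf.2⟩)
    ((dominantSet_finite n k H').subset fun _ hf => hf.1)

theorem one_le_irredCount {n k H : ℕ} {f : ℤ[X]} (hf : f ∈ dominantSet n k 1) (hi : Irreducible f)
    (hH : 1 ≤ H) : 1 ≤ irredCount n k H := by
  refine le_trans ?_ (irredCount_mono n k hH)
  exact (Set.ncard_pos ((dominantSet_finite n k 1).subset fun _ hf => hf.1)).mpr ⟨f, hf, hi⟩

theorem one_le_redCount {n k H : ℕ} {f : ℤ[X]} (hf : f ∈ dominantSet n k 1) (hi : ¬ Irreducible f)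
    (hH : 1 ≤ H) : 1 ≤ redCount n k H := by
  refine le_trans ?_ (redCount_mono n k hH)
  exact (Set.ncard_pos ((dominantSet_finite n k 1).subset fun _ hf => hf.1)).mpr ⟨f, hf, hi⟩

theorem irredCount_add_redCount (n k H : ℕ) :
    irredCount n k H + redCount n k H = (dominantSet n k H).ncard := by
  rw [irredCount, redCount, ← Set.ncard_union_eq
    (Set.disjoint_left.mpr fun f h1 h2 => h2.2 h1.2)
    ((dominantSet_finite n k H).subset fun _ hf => hf.1)
    ((dominantSet_finite n k H).subset fun _ hf => hf.1)]
  congr 1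
  ext f
  simp only [Set.mem_union, Set.mem_ofPred_eq]
  tauto

/-- `AsympFrom` for a counting function of sets that grow as a power of `H`. -/
theorem asympFrom_rpow {U : ℕ → ℕ} {H₀ : ℕ} {e c : ℝ} (hH₀ : 1 ≤ H₀)
    (hup : ∃ C : ℝ, ∀ H, 1 ≤ H → (U H : ℝ) ≤ C * (H : ℝ) ^ e) (hpos : ∀ H, H₀ ≤ H → 1 ≤ U H)
    (hc : 0 < c) (hlow : ∀ᶠ H : ℕ in Filter.atTop, c * (H : ℝ) ^ e ≤ U H) :
    AsympFrom H₀ (fun H => (U H : ℝ)) (fun H => (H : ℝ) ^ e) := by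
  obtain ⟨C, hC⟩ := hup
  exact asympFrom_of_eventually (C := C) (fun H _ => by positivity) (fun H hH => hC H (hH₀.trans hH))
    (fun H hH => by exact_mod_cast hpos H hH) hc hlow

theorem HasGrowth.upper {α : Type*} {A : ℕ → Set α} {e : ℝ} (h : HasGrowth A e) :
    ∃ C : ℝ, ∀ H, 1 ≤ H → ((A H).ncard : ℝ) ≤ C * (H : ℝ) ^ e :=
  let ⟨C, hC⟩ := h
  ⟨C, fun H hH => (hC H hH).2⟩

/-- A lower-order term does not affect a lower bound of a given order. -/
theorem eventually_sub_rpow_ge {U : ℕ → ℝ} {a e c C : ℝ} (hc : 0 < c) (hae : a < e)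
    (h : ∀ᶠ H : ℕ in Filter.atTop, c * (H : ℝ) ^ e - C * (H : ℝ) ^ a ≤ U H) :
    ∀ᶠ H : ℕ in Filter.atTop, c / 2 * (H : ℝ) ^ e ≤ U H := by
  have h1 : Filter.Tendsto (fun H : ℕ => C * (H : ℝ) ^ (-(e - a))) Filter.atTop (nhds 0) := by
    have := ((tendsto_rpow_neg_atTop (sub_pos.mpr hae)).comp
      tendsto_natCast_atTop_atTop).const_mul C
    simpa using this
  filter_upwards [h, h1.eventually (gt_mem_nhds (by positivity : 0 < c / 2)),
    Filter.eventually_ge_atTop 1] with H h2 h3 h4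
  have h0 : (0 : ℝ) < H := by exact_mod_cast h4
  have h5 : C * (H : ℝ) ^ a = C * (H : ℝ) ^ (-(e - a)) * (H : ℝ) ^ e := by
    rw [mul_assoc, ← Real.rpow_add h0]
    ring_nf
  have h6 : 0 < (H : ℝ) ^ e := by positivity
  nlinarith

end Counts

/-! ### One dominant root -/

section OneDominant

/-- Almost all polynomials are irreducible with one dominant root. -/
theorem asympEquiv_irredCount_one {n : ℕ} (hn : 3 ≤ n) :
    AsympEquiv (fun H => (irredCount n 1 H : ℝ)) (fun H => (2 * (H : ℝ)) ^ n) := by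
  obtain ⟨C, hC0, hC⟩ := (((hasGrowth_reducible hn).mono (by linarith : (n : ℝ) - 1 ≤ n - 1 / 2)).union
    (hasGrowth_numDominant_ne_one (n := n) (by omega))).exists_nonneg
  have hlow : ∀ H : ℕ, 1 ≤ H →
      1 - C * (H : ℝ) ^ (-(1 / 2 : ℝ)) ≤ irredCount n 1 H / (2 * (H : ℝ)) ^ n := by
    intro H hH
    have h0 : (1 : ℝ) ≤ H := by exact_mod_cast hH
    obtain ⟨hfin, hcard⟩ := hC H hH
    have hsub : monicBox n H ⊆ {f ∈ dominantSet n 1 H | Irreducible f} ∪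
        ({f ∈ monicBox n H | ¬ Irreducible f} ∪ {f ∈ monicBox n H | numDominant f ≠ 1}) := by
      intro f hf
      by_cases h1 : Irreducible f
      · by_cases h2 : numDominant f = 1
        · exact Or.inl ⟨⟨hf.1, hf.2.1, hf.2.2, h2⟩, h1⟩
        · exact Or.inr (Or.inr ⟨hf, h2⟩)
      · exact Or.inr (Or.inl ⟨hf, h1⟩)
    have h1 := (Set.ncard_le_ncard hsub (((dominantSet_finite n 1 H).subset fun _ hf => hf.1).union
      hfin)).trans (Set.ncard_union_le _ _)
    rw [ncard_monicBox n hH] at h1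
    have h2 : ((2 * H + 1 : ℕ) : ℝ) ^ n ≤ irredCount n 1 H + C * (H : ℝ) ^ ((n : ℝ) - 1 / 2) := by
      refine le_trans ?_ (add_le_add_right hcard _)
      exact_mod_cast h1
    have h3 : (2 * (H : ℝ)) ^ n ≤ ((2 * H + 1 : ℕ) : ℝ) ^ n := by
      gcongr; push_cast; linarith
    rw [le_div_iff₀ (by positivity), sub_mul, one_mul]
    have h4 : (H : ℝ) ^ ((n : ℝ) - 1 / 2) ≤ (H : ℝ) ^ (-(1 / 2 : ℝ)) * (2 * (H : ℝ)) ^ n := by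
      rw [sub_eq_neg_add, Real.rpow_add (by linarith), Real.rpow_natCast]
      gcongr
      linarith
    nlinarith
  have hup : ∀ H : ℕ, 1 ≤ H →
      irredCount n 1 H / (2 * (H : ℝ)) ^ n ≤ (1 + 1 / 2 * (H : ℝ)⁻¹) ^ n := by
    intro H hH
    have h0 : (1 : ℝ) ≤ H := by exact_mod_cast hH
    rw [div_le_iff₀ (by positivity), ← mul_pow]
    have h1 : irredCount n 1 H ≤ (2 * H + 1) ^ n := by
      rw [← ncard_monicBox n hH]
      exact Set.ncard_le_ncard (fun f hf => dominantSet_subset _ _ _ hf.1) (monicBox_finite n H)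
    have h2 : (1 + 1 / 2 * (H : ℝ)⁻¹) * (2 * H) = 2 * H + 1 := by field_simp
    rw [h2]
    exact_mod_cast h1
  have t1 : Filter.Tendsto (fun H : ℕ => 1 - C * (H : ℝ) ^ (-(1 / 2 : ℝ))) Filter.atTop (nhds 1) := by
    have := (((tendsto_rpow_neg_atTop (by norm_num : (0 : ℝ) < 1 / 2)).comp
      tendsto_natCast_atTop_atTop).const_mul C).const_sub 1
    simpa using this
  have t2 : Filter.Tendsto (fun H : ℕ => (1 + 1 / 2 * (H : ℝ)⁻¹) ^ n) Filter.atTop (nhds 1) := by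
    have := (((tendsto_inv_atTop_nhds_zero_nat (𝕜 := ℝ)).const_mul (1 / 2)).const_add 1).pow n
    simpa using this
  exact tendsto_of_tendsto_of_tendsto_of_le_of_le' t1 t2
    (Filter.eventually_atTop.mpr ⟨1, hlow⟩) (Filter.eventually_atTop.mpr ⟨1, hup⟩)

theorem aroots_X_pow (m : ℕ) : ∀ z ∈ ((X : ℤ[X]) ^ m).aroots ℂ, z = 0 := by
  intro z hz
  have := (mem_aroots_iff (monic_X_pow m)).mp hz
  simp only [map_pow, aeval_X] at this
  exact eq_zero_of_pow_eq_zero this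

theorem eq_X_pow_of_house_eq_zero {g : ℤ[X]} (hg : g.Monic) (h : house g = 0) :
    g = X ^ g.natDegree := by
  have h1 : ∀ z ∈ g.aroots ℂ, z = 0 := fun z hz => by
    have := nnnorm_le_house hz
    rwa [h, nonpos_iff_eq_zero, nnnorm_eq_zero] at this
  have h2 := aroots_splits_eq hg
  rw [Multiset.eq_replicate_of_mem h1, card_aroots hg] at h2
  apply Polynomial.map_injective (algebraMap ℤ ℂ) (algebraMap ℤ ℂ).injective_int
  rw [h2]
  simp

theorem polyHeight_mul_X (g : ℤ[X]) : polyHeight (g * X) = polyHeight g := by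
  refine eq_of_forall_ge_iff fun H => ?_
  simp only [polyHeight_le_iff]
  refine ⟨fun h i => by simpa using h (i + 1), fun h i => ?_⟩
  cases i with
  | zero => simp
  | succ i => simpa using h i

theorem not_irreducible_mul_monic {g h : ℤ[X]} (hg : g.Monic) (hh : h.Monic) (h1 : 1 ≤ g.natDegree)
    (h2 : 1 ≤ h.natDegree) : ¬ Irreducible (g * h) := by
  intro hi
  rcases hi.isUnit_or_isUnit rfl with hu | hu
  · rw [hg.isUnit_iff] at hu; simp [hu] at h1
  · rw [hh.isUnit_iff] at hu; simp [hu] at h2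

/-- Multiplication by `X` is injective, preserves the height and only adds the root `0`. The sole
exception is `X ^ n`, whose dominant root is `0` itself; it accounts for the `+ 1`. -/
theorem ncard_dominantSet_le_redCount {n k H : ℕ} (hn : 1 ≤ n) :
    (dominantSet n k H).ncard ≤ redCount (n + 1) k H + 1 := by
  have h1 : (dominantSet n k H \ {X ^ n}).ncard ≤ redCount (n + 1) k H := by
    refine Set.ncard_le_ncard_of_injOn (fun g => g * X) ?_
      (fun f _ g _ h => mul_right_cancel₀ X_ne_zero h)
      ((dominantSet_finite (n + 1) k H).subset fun _ hf => hf.1)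
    rintro g ⟨⟨hg, hgn, hgH, hgk⟩, hgX⟩
    have hh : 0 < house g := by
      rw [pos_iff_ne_zero]
      intro h0
      exact hgX (hgn ▸ eq_X_pow_of_house_eq_zero hg h0)
    refine ⟨⟨hg.mul monic_X, ?_, by rwa [polyHeight_mul_X], ?_⟩, ?_⟩
    · rw [hg.natDegree_mul monic_X, hgn, natDegree_X]
    · rw [numDominant_mul_of_lt hg monic_X (by omega) ?_, hgk]
      intro z hz
      rw [← pow_one (X : ℤ[X])] at hz
      rwa [aroots_X_pow 1 z hz, nnnorm_zero]
    · exact not_irreducible_mul_monic hg monic_X (by omega) (by simp)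
  have h2 := Set.ncard_le_ncard_sdiff_add_ncard (dominantSet n k H) {X ^ n} (Set.finite_singleton _)
  rw [Set.ncard_singleton] at h2
  omega

theorem aroots_X_sub_one : ((X - 1 : ℤ[X]).aroots ℂ) = {1} := by
  have : (X - 1 : ℤ[X]) = X - C 1 := by simp
  rw [this, aroots_X_sub_C]
  simp

theorem house_X_sub_one : house (X - 1 : ℤ[X]) = 1 :=
  house_eq (by simp [aroots_X_sub_one]) (w := 1) (by simp [aroots_X_sub_one]) (by simp)

theorem monic_X_sub_one : (X - 1 : ℤ[X]).Monic := by simpa using monic_X_sub_C (1 : ℤ)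

theorem natDegree_X_sub_one : (X - 1 : ℤ[X]).natDegree = 1 := by
  simpa using natDegree_X_sub_C (1 : ℤ)

theorem mul_X_pow_mem_dominantSet {g : ℤ[X]} {d k H m : ℕ} (hg : g ∈ dominantSet d k H)
    (hd : 1 ≤ d) (h0 : 0 < house g) : g * X ^ m ∈ dominantSet (d + m) k H := by
  obtain ⟨hgm, hgd, hgH, hgk⟩ := hg
  refine ⟨hgm.mul (monic_X_pow m), ?_, ?_, ?_⟩
  · rw [hgm.natDegree_mul (monic_X_pow m), hgd, natDegree_X_pow]
  · have : polyHeight (g * X ^ m) = polyHeight g := by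
      induction m with
      | zero => simp
      | succ m ih => rw [pow_succ, ← mul_assoc, polyHeight_mul_X, ih]
    rwa [this]
  · rw [numDominant_mul_of_lt hgm (monic_X_pow m) (by omega) ?_, hgk]
    intro z hz
    rwa [aroots_X_pow m z hz, nnnorm_zero]

theorem one_le_redCount_one {n : ℕ} (hn : 2 ≤ n) {H : ℕ} (hH : 1 ≤ H) : 1 ≤ redCount n 1 H := by
  obtain ⟨m, rfl⟩ : ∃ m, n = 1 + m := ⟨n - 1, by omega⟩
  have hX : (X - 1 : ℤ[X]) ∈ dominantSet 1 1 1 := by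
    refine ⟨monic_X_sub_one, natDegree_X_sub_one, ?_, ?_⟩
    · rw [polyHeight_le_iff]
      intro i
      simp only [coeff_sub, coeff_X, coeff_one]
      split_ifs <;> simp_all
    · rw [numDominant, house_X_sub_one, aroots_X_sub_one, Multiset.countP_eq_card.mpr (by simp)]
      simp
  refine one_le_redCount (mul_X_pow_mem_dominantSet (m := m) hX le_rfl ?_) ?_ hH
  · rw [house_X_sub_one]; exact one_pos
  · exact not_irreducible_mul_monic monic_X_sub_one (monic_X_pow m) natDegree_X_sub_one.ge
      (by rw [natDegree_X_pow]; omega)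

/-- For the lower bound, all but `O(H ^ (n - 3 / 2))` monic polynomials of degree `n - 1` have one
dominant root, and multiplying them by `X` gives reducible ones of degree `n`. -/
theorem asympFrom_redCount_one {n : ℕ} (hn : 3 ≤ n) :
    AsympFrom 1 (fun H => (redCount n 1 H : ℝ)) (fun H => (H : ℝ) ^ ((n : ℝ) - 1)) := by
  refine asympFrom_rpow le_rfl ((hasGrowth_reducible hn).subset fun H _ f hf =>
    ⟨dominantSet_subset _ _ _ hf.1, hf.2⟩).upper (fun H hH => one_le_redCount_one (by omega) hH)
    (c := 1 / 2) (by norm_num) ?_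
  obtain ⟨m, rfl⟩ : ∃ m, n = m + 1 := ⟨n - 1, by omega⟩
  obtain ⟨C, hC0, hC⟩ := (hasGrowth_numDominant_ne_one (n := m) (by omega)).exists_nonneg
  have hm : (2 : ℝ) ≤ m := by exact_mod_cast (by omega : 2 ≤ m)
  rw [show ((m + 1 : ℕ) : ℝ) - 1 = m by push_cast; ring]
  refine eventually_sub_rpow_ge (C := C + 1) (a := (m : ℝ) - 1 / 2) one_pos (by linarith) ?_
  refine Filter.eventually_atTop.mpr ⟨1, fun H hH => ?_⟩
  have h0 : (1 : ℝ) ≤ H := by exact_mod_cast hH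
  obtain ⟨hfin, hcard⟩ := hC H hH
  have hsub : monicBox m H ⊆ dominantSet m 1 H ∪ {f ∈ monicBox m H | numDominant f ≠ 1} := by
    intro f hf
    by_cases h2 : numDominant f = 1
    · exact Or.inl ⟨hf.1, hf.2.1, hf.2.2, h2⟩
    · exact Or.inr ⟨hf, h2⟩
  have h1 := (Set.ncard_le_ncard hsub ((dominantSet_finite m 1 H).union hfin)).trans
    (Set.ncard_union_le _ _)
  rw [ncard_monicBox m hH] at h1
  have h2 := h1.trans (add_le_add_left (ncard_dominantSet_le_redCount (n := m) (k := 1) (H := H)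
    (by omega)) _)
  have h3 : ((2 * H + 1 : ℕ) : ℝ) ^ m ≤ redCount (m + 1) 1 H + 1 +
      ({f ∈ monicBox m H | numDominant f ≠ 1}.ncard : ℝ) := by exact_mod_cast h2
  have h4 : (H : ℝ) ^ m ≤ ((2 * H + 1 : ℕ) : ℝ) ^ m := by
    gcongr; linarith
  have h5 : 1 ≤ (H : ℝ) ^ ((m : ℝ) - 1 / 2) := Real.one_le_rpow h0 (by linarith)
  rw [Real.rpow_natCast]
  nlinarith

end OneDominant

/-! ### Two dominant roots -/

section TwoDominant

/-- There are many polynomials with two dominant roots. -/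
theorem ncard_dominantSet_two_ge {m H : ℕ} (hm : 2 ≤ m) (hH : (256 * m) ^ 2 ≤ H) :
    1 / 128 * (H : ℝ) ^ ((m : ℝ) - 1 / 2) ≤ (dominantSet m 2 H).ncard := by
  obtain ⟨k, rfl⟩ : ∃ k, m = k + 2 := ⟨m - 2, by omega⟩
  have hH1 : 1 ≤ H := le_trans (Nat.one_le_pow _ _ (by omega)) hH
  set N := Nat.sqrt (H / 4096) with hN
  -- The second coefficient has size at most `√H / 64` and the third lies in `[H / 2, H]`, as
  -- `numDominant_eq_two` demands; all others are free.
  set S : ℕ → Finset ℤ := fun i => if i = k + 1 then Finset.Icc (-(N : ℤ)) N else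
    if i = k then Finset.Icc (((H + 1) / 2 : ℕ) : ℤ) H else Finset.Icc (-(H : ℤ)) H with hS
  have hN2 : N ^ 2 ≤ H / 4096 := Nat.sqrt_le' _
  have hN3 : H / 4096 < (N + 1) ^ 2 := Nat.lt_succ_sqrt' _
  have hNH : N ≤ H := (Nat.sqrt_le_self _).trans (Nat.div_le_self _ _)
  have hsub : coeffBox (k + 2) S ⊆ dominantSet (k + 2) 2 H := by
    rintro f ⟨hf, hn, hfS⟩
    have h1 := hfS (k + 1) (by omega)
    have h2 := hfS k (by omega)
    simp only [hS, if_pos, Finset.mem_Icc] at h1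
    simp only [hS, if_neg (by omega : ¬ k = k + 1), if_pos, Finset.mem_Icc] at h2
    have hbox : f ∈ monicBox (k + 2) H := by
      rw [monicBox_eq_coeffBox _ hH1]
      refine ⟨hf, hn, fun i hi => ?_⟩
      have h3 := hfS i hi
      simp only [hS] at h3
      rw [Finset.mem_Icc]
      split_ifs at h3 <;> rw [Finset.mem_Icc] at h3 <;> omega
    refine ⟨hf, hn, hbox.2.2, numDominant_eq_two hf hn (by omega) hH hbox.2.2 ?_ ?_⟩
    · rw [show k + 2 - 1 = k + 1 by omega]
      have h4 : f.coeff (k + 1) ^ 2 ≤ (N : ℤ) ^ 2 := sq_le_sq' h1.1 h1.2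
      have h5 : 4096 * N ^ 2 ≤ H := by omega
      have h6 : 4096 * (N : ℤ) ^ 2 ≤ H := by exact_mod_cast h5
      linarith
    · rw [show k + 2 - 2 = k by omega]
      omega
  have h1 := Set.ncard_le_ncard hsub (dominantSet_finite _ _ _)
  rw [ncard_coeffBox, Finset.prod_range_succ, Finset.prod_range_succ] at h1
  have h2 : ∏ i ∈ Finset.range k, (S i).card = (2 * H + 1) ^ k := by
    rw [Finset.prod_congr rfl (g := fun _ => 2 * H + 1), Finset.prod_const, Finset.card_range]
    intro i hi
    have := Finset.mem_range.mp hi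
    simp only [hS, if_neg (by omega : ¬ i = k + 1), if_neg (by omega : ¬ i = k), Int.card_Icc]
    omega
  have h3 : (S (k + 1)).card = 2 * N + 1 := by
    simp only [hS, if_pos, Int.card_Icc]
    omega
  have h4 : (S k).card = H + 1 - (H + 1) / 2 := by
    simp only [hS, if_neg (by omega : ¬ k = k + 1), if_pos, Int.card_Icc]
    omega
  rw [h2, h3, h4] at h1
  have hH1' : (1 : ℝ) ≤ H := by exact_mod_cast hH1
  have h5 : (H : ℝ) / 2 ≤ ((H + 1 - (H + 1) / 2 : ℕ) : ℝ) := by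
    rw [div_le_iff₀ (by norm_num)]
    exact_mod_cast (by omega : H ≤ (H + 1 - (H + 1) / 2) * 2)
  have h6 : Real.sqrt H / 64 ≤ ((2 * N + 1 : ℕ) : ℝ) := by
    have h7 : H ≤ 4096 * (N + 1) ^ 2 := by omega
    have h8 : Real.sqrt H ≤ 64 * (N + 1) := by
      rw [Real.sqrt_le_left (by positivity)]
      have : (H : ℝ) ≤ 4096 * (N + 1) ^ 2 := by exact_mod_cast h7
      linarith
    push_cast
    have : (0 : ℝ) ≤ N := Nat.cast_nonneg _
    linarith
  have h7 : (H : ℝ) ≤ ((2 * H + 1 : ℕ) : ℝ) := by push_cast; linarith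
  calc 1 / 128 * (H : ℝ) ^ (((k + 2 : ℕ) : ℝ) - 1 / 2)
      = (H : ℝ) ^ k * (H / 2) * (Real.sqrt H / 64) := by
        rw [show (((k + 2 : ℕ) : ℝ) - 1 / 2) = k + 1 + 1 / 2 by push_cast; ring,
          Real.rpow_add (by linarith), Real.rpow_add (by linarith), Real.rpow_natCast,
          Real.sqrt_eq_rpow, Real.rpow_one]
        ring
    _ ≤ ((2 * H + 1 : ℕ) : ℝ) ^ k * ((H + 1 - (H + 1) / 2 : ℕ) : ℝ) * ((2 * N + 1 : ℕ) : ℝ) := by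
        gcongr
    _ ≤ _ := by exact_mod_cast h1

theorem nodup_aroots {f : ℤ[X]} (hf : f.Monic) (hi : Irreducible f) : (f.aroots ℂ).Nodup := by
  have h1 : Irreducible (f.map (algebraMap ℤ ℚ)) :=
    (hf.irreducible_iff_irreducible_map_fraction_map).mp hi
  have h2 := nodup_roots (h1.separable.map (f := algebraMap ℚ ℂ))
  rw [Polynomial.map_map] at h2
  exact h2

theorem numDominant_eq_two_of_pair {f : ℤ[X]} (hf : f.Monic) (hi : Irreducible f) {z z' : ℂ}
    (hz : z ∈ f.aroots ℂ) (hz' : z' ∈ f.aroots ℂ) (hne : z ≠ z') (hzf : ‖z‖₊ = house f)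
    (hzf' : ‖z'‖₊ = house f) (h : ∀ w ∈ f.aroots ℂ, ‖w‖₊ = house f → w = z ∨ w = z') :
    numDominant f = 2 := by
  have : (f.aroots ℂ).filter (fun w => ‖w‖₊ = house f) = {z, z'} := by
    refine (Multiset.Nodup.ext ((nodup_aroots hf hi).filter _) (by simp [hne])).mpr fun w => ?_
    rw [Multiset.mem_filter, Multiset.insert_eq_cons, Multiset.mem_cons, Multiset.mem_singleton]
    constructor
    · exact fun hw => h w hw.1 hw.2
    · rintro (rfl | rfl)
      · exact ⟨hz, hzf⟩
      · exact ⟨hz', hzf'⟩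
  rw [numDominant, Multiset.countP_eq_card_filter, this]
  simp

theorem norm_coeff_zero_eq_prod {f : ℤ[X]} (hf : f.Monic) :
    ‖(f.coeff 0 : ℂ)‖ = ((f.aroots ℂ).map fun z => ‖z‖).prod := by
  rw [show (f.coeff 0 : ℂ) = (f.map (algebraMap ℤ ℂ)).coeff 0 by simp, aroots_splits_eq hf]
  generalize f.aroots ℂ = s
  induction s using Multiset.induction with
  | empty => simp
  | cons a s ih => rw [Multiset.map_cons, Multiset.prod_cons, mul_coeff_zero, norm_mul, ih]; simp

/-- The moduli of the roots multiply to `|f 0| ≥ 1`, so they are not all below `1`. -/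
theorem one_le_house {f : ℤ[X]} (hf : f.Monic) (hd : 1 ≤ f.natDegree) (h0 : f.coeff 0 ≠ 0) :
    1 ≤ house f := by
  by_contra! hlt
  have key : ∀ s : Multiset ℂ, (∀ z ∈ s, ‖z‖ < 1) → s ≠ 0 → (s.map fun z => ‖z‖).prod < 1 := by
    intro s
    induction s using Multiset.induction with
    | empty => simp
    | cons a s ih =>
      intro hs _
      have h1 := hs a (Multiset.mem_cons_self _ _)
      rw [Multiset.map_cons, Multiset.prod_cons]
      by_cases hs0 : s = 0
      · simpa [hs0] using h1
      · have h2 := ih (fun z hz => hs z (Multiset.mem_cons_of_mem hz)) hs0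
        have h3 : 0 ≤ (s.map fun z => ‖z‖).prod :=
          Multiset.prod_nonneg (by simp +contextual [Multiset.mem_map])
        nlinarith [norm_nonneg a]
  have h1 := key (f.aroots ℂ) (fun z hz => (NNReal.coe_lt_coe.mpr ((nnnorm_le_house hz).trans_lt hlt)))
    (by intro h; have := card_aroots hf; rw [h] at this; simp at this; omega)
  rw [← norm_coeff_zero_eq_prod hf, Complex.norm_intCast, ← Int.cast_abs] at h1
  have h2 : |f.coeff 0| < 1 := by exact_mod_cast h1
  exact h0 (Int.abs_lt_one_iff.mp h2)

theorem sq_norm_add_one (z : ℂ) : ‖z + 1‖ ^ 2 = ‖z‖ ^ 2 + 2 * z.re + 1 := by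
  rw [Complex.sq_norm, Complex.sq_norm, Complex.normSq_apply, Complex.normSq_apply]
  simp
  ring

/-- For odd `n`, the dominant roots of `X ^ n + X ^ (n - 1) - 1` are a pair of conjugates. -/
theorem exists_irreducible_two_odd {m : ℕ} (hm : 1 ≤ m) :
    ∃ f ∈ dominantSet (2 * m + 1) 2 1, Irreducible f := by
  set f : ℤ[X] := X ^ (2 * m + 1) + X ^ (2 * m) - 1 with hfdef
  have htri : f = trinomial 0 (2 * m) (2 * m + 1) (-1) 1 1 := by
    simp only [hfdef, trinomial, C_neg, C_1]; ring
  have hf : f.Monic := htri ▸ trinomial_monic (by omega) (by omega)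
  have hd : f.natDegree = 2 * m + 1 := htri ▸ trinomial_natDegree (by omega) (by omega) one_ne_zero
  have hroot : ∀ z ∈ f.aroots ℂ, z ^ (2 * m) * (z + 1) = 1 := by
    intro z hz
    have := (mem_aroots_iff hf).mp hz
    simp only [hfdef, map_sub, map_add, map_pow, aeval_X, map_one] at this
    linear_combination this
  have hi : Irreducible f := by
    rw [htri]
    -- It suffices that `f` and its mirror have no common complex root. Up to sign the mirror is `X
    -- ^ n - X - 1`, so the computation used for that polynomial applies.
    apply IsUnitTrinomial.irreducible_of_coprime' ⟨0, 2 * m, 2 * m + 1, by omega, by omega,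
      -1, 1, 1, rfl⟩
    rintro z ⟨h1, h2⟩
    apply X_pow_sub_X_sub_one_irreducible_aux (n := 2 * m + 1) z
    rw [trinomial_mirror (by omega) (by omega) (-1 : ℤˣ).ne_zero (1 : ℤˣ).ne_zero] at h2
    simp only [trinomial, aeval_add, aeval_mul, aeval_X_pow, Units.val_neg, Units.val_one,
      map_neg, map_one] at h1 h2
    rw [show 2 * m + 1 - 2 * m + 0 = 1 by omega] at h2
    constructor
    · linear_combination -h2
    · linear_combination z * h1 + z * h2
  have h0 : f.coeff 0 ≠ 0 := by
    rw [htri, show (trinomial 0 (2 * m) (2 * m + 1) (-1 : ℤ) 1 1).coeff 0 = -1 from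
      trinomial_trailing_coeff' (by omega) (by omega)]
    norm_num
  have hhouse := one_le_house hf (by omega) h0
  refine ⟨f, ⟨hf, hd, ?_, ?_⟩, hi⟩
  · rw [polyHeight_le_iff]
    intro i
    simp only [hfdef, coeff_sub, coeff_add, coeff_X_pow, coeff_one]
    split_ifs <;> omega
  · obtain ⟨z, hz, hzf⟩ := exists_nnnorm_eq_house hf (by omega)
    refine numDominant_eq_two_of_pair hf hi hz (conj_mem_aroots hz) ?_ hzf
      (by rw [nnnorm_conj, hzf]) ?_
    · intro hc
      obtain ⟨x, hx⟩ := Complex.conj_eq_iff_real.mp hc.symm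
      have h1 := hroot z hz
      rw [hx] at h1
      have h2 : x ^ (2 * m) * (x + 1) = 1 := by exact_mod_cast h1
      have h3 : 1 ≤ |x| := by
        have : (1 : ℝ) ≤ ‖z‖ := by rw [← hzf] at hhouse; exact hhouse
        rwa [hx, Complex.norm_real] at this
      have h4 : 1 ≤ x ^ (2 * m) := by
        rw [pow_mul, ← sq_abs, ← pow_mul]
        exact one_le_pow₀ h3
      rcases le_abs.mp h3 with h5 | h5 <;> nlinarith
    · intro w hw hwf
      have hnorm : ‖w‖ = ‖z‖ := congrArg NNReal.toReal (hwf.trans hzf.symm)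
      have h1 : ∀ y ∈ f.aroots ℂ, ‖y‖ ^ (2 * m) * ‖y + 1‖ = 1 := fun y hy => by
        rw [← norm_pow, ← norm_mul, hroot y hy, norm_one]
      have hz1 : (1 : ℝ) ≤ ‖z‖ := by rw [← hzf] at hhouse; exact hhouse
      -- The root equation makes `‖z + 1‖` a function of `‖z‖`. The two moduli determine the real
      -- part, and then `z` up to conjugation.
      have h2 : ‖w + 1‖ = ‖z + 1‖ := by
        have e1 := h1 w hw
        rw [hnorm, ← h1 z hz] at e1
        exact mul_left_cancel₀ (by positivity) e1
      have h3 := sq_norm_add_one w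
      have h4 := sq_norm_add_one z
      rw [h2, hnorm] at h3
      have hre : w.re = z.re := by linarith
      have him : w.im ^ 2 = z.im ^ 2 := by
        have e1 : ‖w‖ ^ 2 = ‖z‖ ^ 2 := by rw [hnorm]
        rw [Complex.sq_norm, Complex.sq_norm, Complex.normSq_apply, Complex.normSq_apply, hre] at e1
        linarith
      rcases sq_eq_sq_iff_eq_or_eq_neg.mp him with h | h
      · exact Or.inl (Complex.ext hre h)
      · exact Or.inr (Complex.ext (by simpa using hre) (by simpa using h))

/-- The dominant roots of `X ^ (2 * m) - X ^ 2 - 1` are two opposite real numbers. -/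
theorem exists_irreducible_two_even {m : ℕ} (hm : 2 ≤ m) :
    ∃ f ∈ dominantSet (2 * m) 2 1, Irreducible f := by
  set f : ℤ[X] := X ^ (2 * m) - X ^ 2 - 1 with hfdef
  have htri : f = trinomial 0 2 (2 * m) (-1) (-1) 1 := by
    simp only [hfdef, trinomial, C_neg, C_1]; ring
  have hf : f.Monic := htri ▸ trinomial_monic (by omega) (by omega)
  have hd : f.natDegree = 2 * m := htri ▸ trinomial_natDegree (by omega) (by omega) one_ne_zero
  have hroot : ∀ z, z ∈ f.aroots ℂ ↔ (z ^ 2) ^ m = z ^ 2 + 1 := by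
    intro z
    rw [mem_aroots_iff hf]
    simp only [hfdef, map_sub, map_pow, aeval_X, map_one]
    rw [← pow_mul]
    constructor <;> intro h <;> linear_combination h
  have hi : Irreducible f := by
    rw [htri]
    apply IsUnitTrinomial.irreducible_of_coprime' ⟨0, 2, 2 * m, by omega, by omega,
      -1, -1, 1, rfl⟩
    rintro z ⟨h1, h2⟩
    -- As `f` is `X ^ m - X - 1` composed with `X ^ 2`, the same obstruction is applied at `z ^ 2`.
    apply X_pow_sub_X_sub_one_irreducible_aux (n := m) (z ^ 2)
    rw [trinomial_mirror (by omega) (by omega) (-1 : ℤˣ).ne_zero (1 : ℤˣ).ne_zero] at h2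
    simp only [trinomial, aeval_add, aeval_mul, aeval_X_pow, Units.val_neg, Units.val_one,
      map_neg, map_one, add_zero] at h1 h2
    have e1 : z ^ (2 * m - 2) * z ^ 2 = z ^ (2 * m) := by
      rw [← pow_add]; congr 1; omega
    rw [← pow_mul]
    constructor
    · linear_combination h1
    · linear_combination -z ^ 2 * h1 - z ^ 2 * h2 - e1
  obtain ⟨x, hx, hx0⟩ : ∃ x ∈ Set.Icc (1 : ℝ) 2, x ^ m - x - 1 = 0 := by
    have h1 : (0 : ℝ) ∈ Set.Icc ((1 : ℝ) ^ m - 1 - 1) (2 ^ m - 2 - 1) := by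
      constructor
      · norm_num
      · have : (2 : ℝ) ^ 2 ≤ 2 ^ m := pow_le_pow_right₀ (by norm_num) hm
        linarith
    exact intermediate_value_Icc (f := fun x : ℝ => x ^ m - x - 1) (by norm_num)
      (by fun_prop) h1
  have hx1 : 1 ≤ x := hx.1
  set y : ℝ := Real.sqrt x
  have hy2 : y ^ 2 = x := Real.sq_sqrt (by linarith)
  have hy0 : 0 < y := Real.sqrt_pos.mpr (by linarith)
  have hyroot : ((y : ℂ) ^ 2) ^ m = (y : ℂ) ^ 2 + 1 := by
    rw [← Complex.ofReal_pow, hy2, ← Complex.ofReal_pow, ← Complex.ofReal_one,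
      ← Complex.ofReal_add]
    congr 1
    linarith
  have hmem : (y : ℂ) ∈ f.aroots ℂ := (hroot _).mpr hyroot
  have hmem' : (-y : ℂ) ∈ f.aroots ℂ := (hroot _).mpr (by rw [neg_sq]; exact hyroot)
  have hbd : ∀ z ∈ f.aroots ℂ, ‖z‖ ^ 2 ≤ x := by
    intro z hz
    -- The triangle inequality gives `t ^ m ≤ t + 1`, that is `t * (t ^ (m - 1) - 1) ≤ 1`. The left
    -- side is increasing and equals `1` at `x < t`.
    by_contra! hlt
    set t := ‖z‖ ^ 2
    have h1 : t ^ m ≤ t + 1 := by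
      have := congrArg norm ((hroot z).mp hz)
      rw [norm_pow, norm_pow] at this
      change t ^ m = _ at this
      rw [this]
      refine (norm_add_le _ _).trans ?_
      rw [norm_pow, norm_one]
    obtain ⟨k, rfl⟩ : ∃ k, m = k + 1 := ⟨m - 1, by omega⟩
    have h2 : x ^ k ≤ t ^ k := by gcongr
    rw [pow_succ] at h1 hx0
    have h3 : 1 < x ^ k := by
      by_contra! h
      nlinarith
    nlinarith
  have hhouse : house f = ‖(y : ℂ)‖₊ := by
    refine house_eq ?_ hmem rfl
    intro z hz
    rw [← NNReal.coe_le_coe, coe_nnnorm, coe_nnnorm, Complex.norm_real, Real.norm_of_nonneg hy0.le]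
    refine le_of_sq_le_sq ?_ hy0.le
    rw [hy2]
    exact hbd z hz
  refine ⟨f, ⟨hf, hd, ?_, ?_⟩, hi⟩
  · rw [polyHeight_le_iff]
    intro i
    simp only [hfdef, coeff_sub, coeff_X_pow, coeff_one]
    split_ifs <;> omega
  · refine numDominant_eq_two_of_pair hf hi hmem hmem' ?_ hhouse.symm (by rw [hhouse, nnnorm_neg]) ?_
    · rw [ne_eq, self_eq_neg]
      exact_mod_cast hy0.ne'
    · intro w hw hwf
      have h1 : ‖w ^ 2‖ = x := by
        have : ‖w‖ = ‖(y : ℂ)‖ := congrArg NNReal.toReal (hwf.trans hhouse)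
        rw [norm_pow, this, Complex.norm_real, Real.norm_of_nonneg hy0.le, hy2]
      -- Equality in the triangle inequality forces `w ^ 2` to be the positive real `x`.
      have h2 : ‖w ^ 2 + 1‖ = x + 1 := by
        rw [← (hroot w).mp hw, norm_pow, h1]; linarith
      have h3 := sq_norm_add_one (w ^ 2)
      rw [h1, h2] at h3
      have hre : (w ^ 2).re = x := by linarith
      have him : (w ^ 2).im = 0 := by
        have e1 : ‖w ^ 2‖ ^ 2 = x ^ 2 := by rw [h1]
        rw [Complex.sq_norm, Complex.normSq_apply, hre] at e1
        nlinarith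
      have h4 : w ^ 2 = (y : ℂ) ^ 2 := by
        rw [← Complex.ofReal_pow, hy2]
        exact Complex.ext (by simpa using hre) (by simpa using him)
      exact sq_eq_sq_iff_eq_or_eq_neg.mp h4

theorem one_le_irredCount_two {n : ℕ} (hn : 3 ≤ n) {H : ℕ} (hH : 1 ≤ H) :
    1 ≤ irredCount n 2 H := by
  rcases Nat.even_or_odd' n with ⟨m, rfl | rfl⟩
  · obtain ⟨f, hf, hi⟩ := exists_irreducible_two_even (m := m) (by omega)
    exact one_le_irredCount hf hi hH
  · obtain ⟨f, hf, hi⟩ := exists_irreducible_two_odd (m := m) (by omega)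
    exact one_le_irredCount hf hi hH

theorem asympFrom_irredCount_two {n : ℕ} (hn : 3 ≤ n) :
    AsympFrom 1 (fun H => (irredCount n 2 H : ℝ)) (fun H => (H : ℝ) ^ ((n : ℝ) - 1 / 2)) := by
  refine asympFrom_rpow le_rfl ((hasGrowth_numDominant_ne_one (n := n) (by omega)).subset
    fun H _ f hf => ⟨dominantSet_subset _ _ _ hf.1, by rw [hf.1.2.2.2]; norm_num⟩).upper
    (fun H hH => one_le_irredCount_two hn hH) (c := 1 / 128 / 2) (by norm_num) ?_
  obtain ⟨C, hC⟩ := hasGrowth_reducible_numDominant_two hn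
  refine eventually_sub_rpow_ge (C := C) (a := (n : ℝ) - 3 / 2) (by norm_num) (by linarith) ?_
  refine Filter.eventually_atTop.mpr ⟨(256 * n) ^ 2, fun H hH => ?_⟩
  have hH1 : 1 ≤ H := le_trans (Nat.one_le_pow _ _ (by omega)) hH
  have h1 := ncard_dominantSet_two_ge (m := n) (by omega) hH
  rw [← irredCount_add_redCount] at h1
  have h2 : (redCount n 2 H : ℝ) ≤ _ := (hC H hH1).2
  push_cast at h1
  linarith

theorem one_le_redCount_two {n : ℕ} (hn : 3 ≤ n) {H : ℕ} (hH : 1 ≤ H) : 1 ≤ redCount n 2 H := by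
  obtain ⟨m, rfl⟩ : ∃ m, n = 2 + m := ⟨n - 2, by omega⟩
  have hm : (X ^ 2 - 1 : ℤ[X]).Monic := by
    simpa using monic_X_pow_sub_C (1 : ℤ) (n := 2) (by norm_num)
  have hd : (X ^ 2 - 1 : ℤ[X]).natDegree = 2 := by
    simpa using natDegree_X_pow_sub_C (n := 2) (r := (1 : ℤ))
  have hroots : ∀ z ∈ (X ^ 2 - 1 : ℤ[X]).aroots ℂ, ‖z‖₊ = 1 := by
    intro z hz
    have := (mem_aroots_iff hm).mp hz
    simp only [map_sub, map_pow, aeval_X, map_one, sub_eq_zero] at this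
    rcases sq_eq_sq_iff_eq_or_eq_neg.mp (this.trans (one_pow 2).symm) with rfl | rfl <;> simp
  have hX : (X ^ 2 - 1 : ℤ[X]) ∈ dominantSet 2 2 1 := by
    refine ⟨hm, hd, ?_, (numDominant_eq_natDegree_of_forall hm (by omega) hroots).trans hd⟩
    rw [polyHeight_le_iff]
    intro i
    simp only [coeff_sub, coeff_X_pow, coeff_one]
    split_ifs <;> simp_all
  refine one_le_redCount (mul_X_pow_mem_dominantSet (m := m) hX (by norm_num) ?_) ?_ hH
  · obtain ⟨z, hz, hzf⟩ := exists_nnnorm_eq_house hm (by omega)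
    rw [← hzf, hroots z hz]; exact one_pos
  · exact not_irreducible_mul_monic hm (monic_X_pow m) (by omega) (by rw [natDegree_X_pow]; omega)

theorem asympFrom_redCount_two {n : ℕ} (hn : 3 ≤ n) :
    AsympFrom 1 (fun H => (redCount n 2 H : ℝ)) (fun H => (H : ℝ) ^ ((n : ℝ) - 3 / 2)) := by
  refine asympFrom_rpow le_rfl (hasGrowth_reducible_numDominant_two hn).upper
    (fun H hH => one_le_redCount_two hn hH) (c := 1 / 128 / 2) (by norm_num) ?_
  obtain ⟨m, rfl⟩ : ∃ m, n = m + 1 := ⟨n - 1, by omega⟩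
  have hm : (2 : ℝ) ≤ m := by exact_mod_cast (by omega : 2 ≤ m)
  rw [show ((m + 1 : ℕ) : ℝ) - 3 / 2 = m - 1 / 2 by push_cast; ring]
  refine eventually_sub_rpow_ge (C := 1) (a := 0) (by norm_num) (by linarith) ?_
  refine Filter.eventually_atTop.mpr ⟨(256 * m) ^ 2, fun H hH => ?_⟩
  have h1 := ncard_dominantSet_two_ge (m := m) (by omega) hH
  have h2 : ((dominantSet m 2 H).ncard : ℝ) ≤ redCount (m + 1) 2 H + 1 := by
    exact_mod_cast ncard_dominantSet_le_redCount (n := m) (k := 2) (H := H) (by omega)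
  rw [Real.rpow_zero]
  linarith

end TwoDominant

/-! ### Cubics and quartics with all roots on one circle -/

section EqualModuli

theorem norm_coeff_zero_of_forall {f : ℤ[X]} (hf : f.Monic) {r : ℝ}
    (h : ∀ z ∈ f.aroots ℂ, ‖z‖ = r) : |(f.coeff 0 : ℝ)| = r ^ f.natDegree := by
  have h1 := norm_coeff_zero_eq_prod hf
  rw [Multiset.map_congr rfl h, Multiset.map_const', Multiset.prod_replicate, card_aroots hf,
    Complex.norm_intCast] at h1
  exact h1

theorem abs_coeff_pred_le {f : ℤ[X]} (hf : f.Monic) (hd : 1 ≤ f.natDegree) {r : ℝ}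
    (h : ∀ z ∈ f.aroots ℂ, ‖z‖ ≤ r) :
    |(f.coeff (f.natDegree - 1) : ℝ)| ≤ f.natDegree * r := by
  have h1 := norm_sum_map_sub_le (s := f.aroots ℂ) (g := id) (c := 0) (ε := r)
    (fun z hz => by simpa using h z hz)
  rwa [Multiset.map_id, mul_zero, sub_zero, sum_aroots hf hd, norm_neg, Complex.norm_intCast,
    card_aroots hf] at h1

theorem norm_eq_house_of_numDominant {f : ℤ[X]} (hf : f.Monic) (h : numDominant f = f.natDegree) :
    ∀ z ∈ f.aroots ℂ, ‖z‖ = house f := fun z hz =>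
  congrArg NNReal.toReal ((numDominant_eq_natDegree_iff hf).mp h z hz)

theorem mul_conj_of_norm {z : ℂ} {r : ℝ} (h : ‖z‖ = r) :
    z * starRingEnd ℂ z = ((r ^ 2 : ℝ) : ℂ) := by
  rw [Complex.mul_conj, Complex.normSq_eq_norm_sq, h]

theorem eq_cubic {f : ℤ[X]} (hf : f.Monic) (hd : f.natDegree = 3) :
    f = X ^ 3 + C (f.coeff 2) * X ^ 2 + C (f.coeff 1) * X + C (f.coeff 0) := by
  conv_lhs => rw [hf.as_sum, hd]
  simp only [Finset.sum_range_succ, Finset.sum_range_zero, pow_zero, mul_one, pow_one]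
  ring

theorem eq_quadratic {f : ℤ[X]} (hf : f.Monic) (hd : f.natDegree = 2) :
    f = X ^ 2 + C (f.coeff 1) * X + C (f.coeff 0) := by
  conv_lhs => rw [hf.as_sum, hd]
  simp only [Finset.sum_range_succ, Finset.sum_range_zero, pow_zero, mul_one, pow_one]
  ring

theorem eq_quartic {f : ℤ[X]} (hf : f.Monic) (hd : f.natDegree = 4) :
    f = X ^ 4 + C (f.coeff 3) * X ^ 3 + C (f.coeff 2) * X ^ 2 + C (f.coeff 1) * X
      + C (f.coeff 0) := by
  conv_lhs => rw [hf.as_sum, hd]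
  simp only [Finset.sum_range_succ, Finset.sum_range_zero, pow_zero, mul_one, pow_one]
  ring

theorem coeffs_of_aroots_eq_three {f : ℤ[X]} (hf : f.Monic) {x y z : ℂ}
    (h : f.aroots ℂ = {x, y, z}) : (f.coeff 2 : ℂ) = -(x + y + z) ∧
      (f.coeff 1 : ℂ) = x * y + x * z + y * z ∧ (f.coeff 0 : ℂ) = -(x * y * z) := by
  have h1 := aroots_splits_eq hf
  rw [h] at h1
  simp only [Multiset.insert_eq_cons, Multiset.map_cons, Multiset.prod_cons, Multiset.map_singleton,
    Multiset.prod_singleton] at h1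
  have h2 : (X - C x) * ((X - C y) * (X - C z)) = X ^ 3 + C (-(x + y + z)) * X ^ 2
      + C (x * y + x * z + y * z) * X + C (-(x * y * z)) := by
    simp only [C_neg, C_add, C_mul]; ring
  rw [h2] at h1
  have h3 : ∀ i, (f.coeff i : ℂ) = (f.map (algebraMap ℤ ℂ)).coeff i := fun i => by simp
  refine ⟨?_, ?_, ?_⟩ <;>
  · rw [h3, h1]
    simp only [coeff_add, coeff_C_mul, coeff_X_pow, coeff_X, coeff_C]
    norm_num

theorem coeffs_of_aroots_eq_four {f : ℤ[X]} (hf : f.Monic) {w x y z : ℂ}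
    (h : f.aroots ℂ = {w, x, y, z}) : (f.coeff 3 : ℂ) = -(w + x + y + z) ∧
      (f.coeff 2 : ℂ) = w * x + w * y + w * z + x * y + x * z + y * z ∧
      (f.coeff 1 : ℂ) = -(w * x * y + w * x * z + w * y * z + x * y * z) ∧
      (f.coeff 0 : ℂ) = w * x * y * z := by
  have h1 := aroots_splits_eq hf
  rw [h] at h1
  simp only [Multiset.insert_eq_cons, Multiset.map_cons, Multiset.prod_cons, Multiset.map_singleton,
    Multiset.prod_singleton] at h1
  have h2 : (X - C w) * ((X - C x) * ((X - C y) * (X - C z))) = X ^ 4 + C (-(w + x + y + z)) * X ^ 3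
      + C (w * x + w * y + w * z + x * y + x * z + y * z) * X ^ 2
      + C (-(w * x * y + w * x * z + w * y * z + x * y * z)) * X + C (w * x * y * z) := by
    simp only [C_neg, C_add, C_mul]; ring
  rw [h2] at h1
  have h3 : ∀ i, (f.coeff i : ℂ) = (f.map (algebraMap ℤ ℂ)).coeff i := fun i => by simp
  refine ⟨?_, ?_, ?_, ?_⟩ <;>
  · rw [h3, h1]
    simp only [coeff_add, coeff_C_mul, coeff_X_pow, coeff_X, coeff_C]
    norm_num

theorem coeffs_of_aroots_eq_two {f : ℤ[X]} (hf : f.Monic) {x y : ℂ}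
    (h : f.aroots ℂ = {x, y}) : (f.coeff 1 : ℂ) = -(x + y) ∧ (f.coeff 0 : ℂ) = x * y := by
  have h1 := aroots_splits_eq hf
  rw [h] at h1
  simp only [Multiset.insert_eq_cons, Multiset.map_cons, Multiset.prod_cons, Multiset.map_singleton,
    Multiset.prod_singleton] at h1
  have h2 : (X - C x) * (X - C y) = X ^ 2 + C (-(x + y)) * X + C (x * y) := by
    simp only [C_neg, C_add, C_mul]; ring
  rw [h2] at h1
  have h3 : ∀ i, (f.coeff i : ℂ) = (f.map (algebraMap ℤ ℂ)).coeff i := fun i => by simp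
  refine ⟨?_, ?_⟩ <;>
  · rw [h3, h1]
    simp only [coeff_add, coeff_C_mul, coeff_X_pow, coeff_X, coeff_C]
    norm_num

theorem conj_neg_intCast {a : ℤ} {e : ℂ} (h : (a : ℂ) = -e) : starRingEnd ℂ e = e := by
  rw [show e = ((-a : ℤ) : ℂ) by push_cast; rw [h]; ring]
  exact map_intCast (starRingEnd ℂ) _

/-- Multiply the product of the roots by the conjugate of their sum: each `z * conj z` becomes `r ^
2`, which leaves `r ^ 2` times the second symmetric function. The sum is its own conjugate because
it is an integer. `quartic_relation` is the same with the third symmetric function. -/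
theorem cubic_relation {f : ℤ[X]} (hf : f.Monic) (hd : f.natDegree = 3) {r : ℝ}
    (h : ∀ z ∈ f.aroots ℂ, ‖z‖ = r) :
    r ^ 2 * (f.coeff 1 : ℝ) = f.coeff 0 * f.coeff 2 := by
  obtain ⟨x, y, z, hs⟩ := Multiset.card_eq_three.mp ((card_aroots hf).trans hd)
  obtain ⟨h2, h1, h0⟩ := coeffs_of_aroots_eq_three hf hs
  have hx := mul_conj_of_norm (h x (by simp [hs]))
  have hy := mul_conj_of_norm (h y (by simp [hs]))
  have hz := mul_conj_of_norm (h z (by simp [hs]))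
  have hc := conj_neg_intCast h2
  rw [map_add, map_add] at hc
  have key : ((r ^ 2 : ℝ) : ℂ) * (f.coeff 1 : ℂ) = f.coeff 0 * f.coeff 2 := by
    rw [h0, h1, h2]
    linear_combination (x * y * z) * hc - y * z * hx - x * z * hy - x * y * hz
  exact_mod_cast key

theorem quartic_relation {f : ℤ[X]} (hf : f.Monic) (hd : f.natDegree = 4) {r : ℝ}
    (h : ∀ z ∈ f.aroots ℂ, ‖z‖ = r) :
    r ^ 2 * (f.coeff 1 : ℝ) = f.coeff 0 * f.coeff 3 := by
  obtain ⟨w, x, y, z, hs⟩ := Multiset.card_eq_four.mp ((card_aroots hf).trans hd)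
  obtain ⟨h3, h2, h1, h0⟩ := coeffs_of_aroots_eq_four hf hs
  have hw := mul_conj_of_norm (h w (by simp [hs]))
  have hx := mul_conj_of_norm (h x (by simp [hs]))
  have hy := mul_conj_of_norm (h y (by simp [hs]))
  have hz := mul_conj_of_norm (h z (by simp [hs]))
  have hc := conj_neg_intCast h3
  rw [map_add, map_add, map_add] at hc
  have key : ((r ^ 2 : ℝ) : ℂ) * (f.coeff 1 : ℂ) = f.coeff 0 * f.coeff 3 := by
    rw [h0, h1, h3]
    linear_combination -(w * x * y * z) * hc + x * y * z * hw + w * y * z * hx + w * x * z * hy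
      + w * x * y * hz
  exact_mod_cast key

theorem quartic_abs_coeff_two_le {f : ℤ[X]} (hf : f.Monic) (hd : f.natDegree = 4) {r : ℝ}
    (h : ∀ z ∈ f.aroots ℂ, ‖z‖ = r) : |(f.coeff 2 : ℝ)| ≤ 6 * r ^ 2 := by
  obtain ⟨w, x, y, z, hs⟩ := Multiset.card_eq_four.mp ((card_aroots hf).trans hd)
  obtain ⟨-, h2, -, -⟩ := coeffs_of_aroots_eq_four hf hs
  have hw := h w (by simp [hs])
  have hx := h x (by simp [hs])
  have hy := h y (by simp [hs])
  have hz := h z (by simp [hs])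
  rw [← Complex.norm_intCast, h2]
  calc _ ≤ ‖w * x‖ + ‖w * y‖ + ‖w * z‖ + ‖x * y‖ + ‖x * z‖ + ‖y * z‖ := by
        refine (norm_add_le _ _).trans (add_le_add_left ?_ _)
        refine (norm_add_le _ _).trans (add_le_add_left ?_ _)
        refine (norm_add_le _ _).trans (add_le_add_left ?_ _)
        exact norm_add₃_le
    _ = _ := by simp only [norm_mul, hw, hx, hy, hz]; ring

/-- The shape of integer cubics with all roots on a circle around the origin. -/
theorem cubic_form {f : ℤ[X]} (hf : f.Monic) (hd : f.natDegree = 3) (h : numDominant f = 3) :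
    (∃ c : ℤ, f = X ^ 3 + C c) ∨
    ∃ a t : ℤ, |a| ≤ 3 * |t| ∧ (house f : ℝ) = |(t : ℝ)| ∧
      f = (X + C t) * (X ^ 2 + C (a - t) * X + C (t ^ 2)) := by
  have hr := norm_eq_house_of_numDominant hf (h.trans hd.symm)
  set r : ℝ := NNReal.toReal (house f)
  have hr0 : 0 ≤ r := (house f).2
  have h1 := cubic_relation hf hd hr
  have h2 := norm_coeff_zero_of_forall hf hr
  have h3 := abs_coeff_pred_le hf (by omega) fun z hz => (hr z hz).le
  rw [hd] at h2 h3
  have hcub := eq_cubic hf hd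
  set a0 := f.coeff 0
  set a1 := f.coeff 1
  set a2 := f.coeff 2
  by_cases hr1 : r = 0
  · left
    refine ⟨0, ?_⟩
    rw [eq_X_pow_of_house_eq_zero hf (NNReal.coe_eq_zero.mp hr1), hd]
    simp
  have ha0 : (a0 : ℝ) ≠ 0 := by
    intro h0
    rw [h0, abs_zero] at h2
    exact hr1 (eq_zero_of_pow_eq_zero h2.symm)
  by_cases ha2 : a2 = 0
  · left
    rw [ha2, Int.cast_zero, mul_zero] at h1
    have ha1 : a1 = 0 := by
      rcases mul_eq_zero.mp h1 with h | h
      · exact absurd (eq_zero_of_pow_eq_zero h) hr1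
      · exact_mod_cast h
    refine ⟨a0, ?_⟩
    rw [hcub, ha2, ha1]
    simp
  · right
    have h4 : (a0 : ℝ) ^ 2 = r ^ 6 := by
      rw [← sq_abs, h2]; ring
    -- Cubing the relation and using `a0 ^ 2 = r ^ 6` eliminates `r`. Then `a2` divides `a1`, and
    -- the quotient `t` satisfies `t ^ 3 = a0`, so `-t` is a root.
    have h5 : a1 ^ 3 = a0 * a2 ^ 3 := by
      have : (a0 : ℝ) ^ 2 * (a1 : ℝ) ^ 3 = (a0 : ℝ) ^ 2 * (a0 * a2 ^ 3) := by
        have e : (r ^ 2 * a1) ^ 3 = ((a0 : ℝ) * a2) ^ 3 := by rw [h1]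
        rw [mul_pow, mul_pow] at e
        calc (a0 : ℝ) ^ 2 * (a1 : ℝ) ^ 3 = (r ^ 2) ^ 3 * (a1 : ℝ) ^ 3 := by rw [h4]; ring
          _ = _ := by rw [e]; ring
      exact_mod_cast mul_left_cancel₀ (pow_ne_zero 2 ha0) this
    obtain ⟨t, ht⟩ := (Int.pow_dvd_pow_iff (a := a2) (b := a1) (n := 3) (by norm_num)).mp
      ⟨a0, by rw [h5]; ring⟩
    have h6 : a0 = t ^ 3 := by
      rw [ht, mul_pow, mul_comm] at h5
      exact (mul_right_cancel₀ (pow_ne_zero 3 ha2) h5).symm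
    have h7 : r = |(t : ℝ)| := by
      rw [h6] at h2
      push_cast at h2
      rw [abs_pow] at h2
      exact (pow_left_injective₀ h2 hr0).symm
    refine ⟨a2, t, ?_, h7, ?_⟩
    · rw [h7] at h3
      exact_mod_cast h3
    · rw [hcub, h6, ht]
      simp only [C_mul, C_pow, C_sub]
      ring
where
  pow_left_injective₀ {x y : ℝ} (h : |x| ^ 3 = y ^ 3) (hy : 0 ≤ y) : |x| = y :=
    (pow_left_inj₀ (abs_nonneg x) hy (by norm_num)).mp h

theorem forall_norm_of_mul {g h : ℤ[X]} (hg : g.Monic) (hh : h.Monic) {r : ℝ}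
    (hr : ∀ z ∈ (g * h).aroots ℂ, ‖z‖ = r) :
    (∀ z ∈ g.aroots ℂ, ‖z‖ = r) ∧ ∀ z ∈ h.aroots ℂ, ‖z‖ = r := by
  rw [aroots_mul_monic hg hh] at hr
  exact ⟨fun z hz => hr z (by simp [hz]), fun z hz => hr z (by simp [hz])⟩

theorem numDominant_of_forall_norm {f : ℤ[X]} (hf : f.Monic) (hd : 1 ≤ f.natDegree) {r : ℝ}
    (h : ∀ z ∈ f.aroots ℂ, ‖z‖ = r) : numDominant f = f.natDegree := by
  obtain ⟨w, hw, -⟩ := exists_nnnorm_eq_house hf hd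
  exact numDominant_eq_natDegree_of_forall hf hd (r := ‖w‖₊)
    fun z hz => NNReal.eq ((h z hz).trans (h w hw).symm)

theorem eq_linear {f : ℤ[X]} (hf : f.Monic) (hd : f.natDegree = 1) : f = X + C (f.coeff 0) := by
  conv_lhs => rw [hf.as_sum, hd]
  simp

theorem natDegree_X_add_C_mul_X_add_C (s t : ℤ) :
    ((X + C s) * (X + C t)).Monic ∧ ((X + C s) * (X + C t)).natDegree = 2 := by
  refine ⟨(monic_X_add_C s).mul (monic_X_add_C t), ?_⟩
  rw [(monic_X_add_C s).natDegree_mul (monic_X_add_C t), natDegree_X_add_C, natDegree_X_add_C]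

/-- The monic quadratic polynomial with coefficients `b` and `c`. -/
noncomputable def quad (b c : ℤ) : ℤ[X] := X ^ 2 + C b * X + C c

theorem quad_eq (b c : ℤ) : quad b c = C 1 * X ^ 2 + C b * X + C c := by
  rw [quad, C_1, one_mul]

theorem natDegree_quad (b c : ℤ) : (quad b c).natDegree = 2 := by
  rw [quad_eq]; exact natDegree_quadratic one_ne_zero

theorem monic_quad (b c : ℤ) : (quad b c).Monic := by
  rw [Monic, quad_eq]; exact leadingCoeff_quadratic one_ne_zero

/-- A reducible quartic with all roots of equal modulus is a product of two quadratics. -/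
theorem exists_quadratic_factors {f : ℤ[X]} (hf : f.Monic) (hd : f.natDegree = 4)
    (h : numDominant f = 4) (hred : ¬ Irreducible f) :
    ∃ g h : ℤ[X], g.Monic ∧ h.Monic ∧ g.natDegree = 2 ∧ h.natDegree = 2 ∧ g * h = f := by
  have hr := norm_eq_house_of_numDominant hf (h.trans hd.symm)
  set r : ℝ := NNReal.toReal (house f)
  obtain ⟨g, k, hg, hk, rfl, h1, h2, h3⟩ := exists_factor_of_not_irreducible hf (by omega) hred
  rw [hd] at h2 h3
  obtain ⟨hgr, hkr⟩ := forall_norm_of_mul hg hk hr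
  obtain h1 | h1 : g.natDegree = 1 ∨ g.natDegree = 2 := by omega
  · have hk3 : k.natDegree = 3 := by omega
    have hg1 := eq_linear hg h1
    set m := g.coeff 0
    have hm := norm_coeff_zero_of_forall hg hgr
    -- It suffices to split a linear factor off the cubic `k`, to be grouped with `X + C m`. In the
    -- case `k = X ^ 3 + c` this works because `|c| = |m| ^ 3`.
    have key : ∀ s b c : ℤ, k = (X + C s) * quad b c → ∃ g' h' : ℤ[X], g'.Monic ∧ h'.Monic ∧
        g'.natDegree = 2 ∧ h'.natDegree = 2 ∧ g' * h' = g * k := fun s b c hk' =>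
      ⟨(X + C m) * (X + C s), quad b c, (natDegree_X_add_C_mul_X_add_C m s).1, monic_quad b c,
        (natDegree_X_add_C_mul_X_add_C m s).2, natDegree_quad b c, by rw [hk', hg1, mul_assoc]⟩
    rcases cubic_form hk hk3 ((numDominant_of_forall_norm hk (by omega) hkr).trans hk3) with
      ⟨c, hc⟩ | ⟨a, t, -, -, hat⟩
    · have hc1 := norm_coeff_zero_of_forall hk hkr
      have hc0 : k.coeff 0 = c := by rw [hc]; simp
      rw [hk3, hc0] at hc1
      rw [h1, pow_one] at hm
      rw [← hm, ← abs_pow, abs_eq_abs] at hc1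
      rcases hc1 with hc1 | hc1
      · have hc2 : c = m ^ 3 := by exact_mod_cast hc1
        refine key m (-m) (m ^ 2) ?_
        rw [hc, hc2, quad]
        simp only [C_neg, C_pow]
        ring
      · have hc2 : c = -m ^ 3 := by exact_mod_cast hc1
        refine key (-m) m (m ^ 2) ?_
        rw [hc, hc2, quad]
        simp only [C_neg, C_pow]
        ring
    · exact key t (a - t) (t ^ 2) hat
  · exact ⟨g, k, hg, hk, h1, by omega, rfl⟩

/-- With nonpositive discriminant the roots are conjugate or a real double root, so their product
`c` is the squared modulus of each. -/
theorem quad_root_norm_sq {b c : ℝ} (h : b ^ 2 ≤ 4 * c) {w : ℂ} (hw : w ^ 2 + b * w + c = 0) :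
    ‖w‖ ^ 2 = c := by
  have hre := congrArg Complex.re hw
  have him := congrArg Complex.im hw
  simp [sq] at hre him
  rw [Complex.sq_norm, Complex.normSq_apply]
  have : w.im * (2 * w.re + b) = 0 := by linarith
  rcases mul_eq_zero.mp this with h0 | h0
  · rw [h0] at hre ⊢
    have h1 : (2 * w.re + b) ^ 2 ≤ 0 := by nlinarith
    have h2 : 2 * w.re + b = 0 := by nlinarith [sq_nonneg (2 * w.re + b)]
    nlinarith
  · linear_combination w.re * h0 - hre

theorem norm_root_quad {b c : ℤ} (h : b ^ 2 ≤ 4 * c) {z : ℂ} (hz : z ∈ (quad b c).aroots ℂ) :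
    ‖z‖ = Real.sqrt c := by
  have h1 := (mem_aroots_iff (monic_quad b c)).mp hz
  simp only [quad, map_add, map_mul, map_pow, aeval_X, eq_intCast, map_intCast] at h1
  have h2 := quad_root_norm_sq (b := b) (c := c) (by exact_mod_cast h)
    (by push_cast; exact h1)
  rw [← h2, Real.sqrt_sq (norm_nonneg _)]

end EqualModuli

/-! ### Quartics with exactly three dominant roots -/

section ThreeOfFour

/-- A rational algebraic integer is an integer. -/
theorem exists_int_of_isIntegral_of_mul {z : ℂ} (hz : IsIntegral ℤ z) {k l : ℤ} (hk : k ≠ 0)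
    (h : (k : ℂ) * z = l) : ∃ m : ℤ, z = m := by
  have h1 : z = algebraMap ℚ ℂ ((l : ℚ) / k) := by
    have hk' : (k : ℂ) ≠ 0 := by exact_mod_cast hk
    rw [map_div₀, map_intCast, map_intCast, eq_div_iff hk', mul_comm, h]
  rw [h1, isIntegral_algebraMap_iff (algebraMap ℚ ℂ).injective] at hz
  obtain ⟨m, hm⟩ := IsIntegrallyClosed.isIntegral_iff.mp hz
  refine ⟨m, ?_⟩
  rw [h1, ← hm]
  simp

/-- The root that is not dominant, when there is just one. -/
theorem exists_small_root {f : ℤ[X]} (hf : f.Monic) (h : numDominant f + 1 = f.natDegree) :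
    ∃ d : ℝ, (d : ℂ) ∈ f.aroots ℂ ∧ ‖(d : ℂ)‖ < house f ∧
      ∃ s : Multiset ℂ, f.aroots ℂ = (d : ℂ) ::ₘ s ∧ ∀ z ∈ s, ‖z‖ = house f := by
  classical
  set S := f.aroots ℂ with hS
  have hcard : (S.filter fun z => ¬ ‖z‖₊ = house f).card = 1 := by
    have h1 := Multiset.card_eq_countP_add_countP (fun z => ‖z‖₊ = house f) S
    rw [card_aroots hf, ← Multiset.countP_eq_card_filter] at *
    unfold numDominant at h
    change S.countP _ + 1 = _ at h
    omega
  obtain ⟨δ, hδ⟩ := Multiset.card_eq_one.mp hcard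
  have hδm : δ ∈ S.filter fun z => ¬ ‖z‖₊ = house f := by rw [hδ]; simp
  rw [Multiset.mem_filter] at hδm
  -- Conjugation preserves moduli, so the only root that is not dominant is fixed by it and
  -- therefore real.
  have hconj : starRingEnd ℂ δ ∈ S.filter fun z => ¬ ‖z‖₊ = house f := by
    rw [Multiset.mem_filter, nnnorm_conj]
    exact ⟨conj_mem_aroots hδm.1, hδm.2⟩
  rw [hδ, Multiset.mem_singleton] at hconj
  obtain ⟨d, rfl⟩ := Complex.conj_eq_iff_real.mp hconj
  refine ⟨d, hδm.1, ?_, S.filter fun z => ‖z‖₊ = house f, ?_, ?_⟩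
  · exact lt_of_le_of_ne (nnnorm_le_house hδm.1) fun h => hδm.2 (NNReal.eq h)
  · rw [← Multiset.singleton_add, ← hδ, add_comm, Multiset.filter_add_not]
  · intro z hz
    rw [Multiset.mem_filter] at hz
    exact congrArg NNReal.toReal hz.2

/-- If a reducible quartic has exactly three dominant roots, the fourth root is an integer. -/
theorem exists_int_small_root {f : ℤ[X]} (hf : f.Monic) (hd : f.natDegree = 4)
    (h3 : numDominant f = 3) (hred : ¬ Irreducible f) :
    ∃ (d : ℤ) (g : ℤ[X]), g.Monic ∧ g.natDegree = 3 ∧ f = (X - C d) * g ∧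
      (∀ z ∈ g.aroots ℂ, ‖z‖ = house f) ∧ |(d : ℝ)| < house f := by
  obtain ⟨d, hd1, hd2, s, hs, hsr⟩ := exists_small_root hf (by omega)
  set r : ℝ := NNReal.toReal (house f)
  have hr0 : 0 < r := (norm_nonneg _).trans_lt hd2
  suffices hm : ∃ m : ℤ, (d : ℂ) = m by
    obtain ⟨m, hm⟩ := hm
    have hroot : IsRoot f m := by
      have h1 := (mem_aroots_iff hf).mp hd1
      rw [hm, aeval_def, eval₂_at_intCast, algebraMap_int_eq] at h1
      simpa using h1
    obtain ⟨g, hg⟩ := dvd_iff_isRoot.mpr hroot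
    have hgm : g.Monic := (monic_X_sub_C m).of_mul_monic_left (hg ▸ hf)
    refine ⟨m, g, hgm, ?_, hg, ?_, ?_⟩
    · have := (monic_X_sub_C m).natDegree_mul hgm
      rw [← hg, natDegree_X_sub_C, hd] at this
      omega
    · have h1 : f.aroots ℂ = (X - C m).aroots ℂ + g.aroots ℂ := by
        rw [hg]; exact aroots_mul_monic (monic_X_sub_C m) hgm
      rw [hs, aroots_X_sub_C, Multiset.singleton_add, algebraMap_int_eq, eq_intCast, hm,
        Multiset.cons_inj_right] at h1
      rw [← h1]
      exact hsr
    · rwa [hm, Complex.norm_intCast] at hd2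
  have hint := isIntegral_of_mem_aroots hf hd1
  -- Let `g` be the factor that has `d` as a root. All roots of `k` have modulus `r`, so a power of
  -- `r` is an integer, which makes `d` rational.
  obtain ⟨g, k, hg, hk, hgk, hdeg⟩ : ∃ g k : ℤ[X], g.Monic ∧ k.Monic ∧ f = g * k ∧
      (d : ℂ) ∈ g.aroots ℂ ∧ 1 ≤ g.natDegree ∧ 1 ≤ k.natDegree ∧
      g.natDegree + k.natDegree = 4 := by
    obtain ⟨g, k, hg, hk, hgk, h1, h2, h3⟩ := exists_factor_of_not_irreducible hf (by omega) hred
    have h4 : f.aroots ℂ = g.aroots ℂ + k.aroots ℂ := by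
      rw [← hgk]; exact aroots_mul_monic hg hk
    rw [h4, Multiset.mem_add] at hd1
    rcases hd1 with h | h
    · exact ⟨g, k, hg, hk, hgk.symm, h, by omega, by omega, by omega⟩
    · exact ⟨k, g, hk, hg, by rw [mul_comm, hgk], h, by omega, by omega, by omega⟩
  obtain ⟨hdg, h1, h2, h4⟩ := hdeg
  obtain ⟨u, hu⟩ := Multiset.exists_cons_of_mem hdg
  have h5 : f.aroots ℂ = g.aroots ℂ + k.aroots ℂ := by rw [hgk]; exact aroots_mul_monic hg hk
  rw [hs, hu, Multiset.cons_add, Multiset.cons_inj_right] at h5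
  have hur : ∀ z ∈ u, ‖z‖ = r := fun z hz => hsr z (by rw [h5]; simp [hz])
  have hkr : ∀ z ∈ k.aroots ℂ, ‖z‖ = r := fun z hz => hsr z (by rw [h5]; simp [hz])
  have hk0 := norm_coeff_zero_of_forall hk hkr
  have hucard : u.card + 1 = g.natDegree := by
    rw [← card_aroots hg, hu, Multiset.card_cons]
  obtain h | h | h : g.natDegree = 1 ∨ g.natDegree = 2 ∨ g.natDegree = 3 := by omega
  · refine ⟨-g.coeff 0, ?_⟩
    have h6 := (mem_aroots_iff hg).mp hdg
    rw [eq_linear hg h] at h6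
    simp only [map_add, aeval_X, eq_intCast, map_intCast] at h6
    push_cast
    linear_combination h6
  -- The other root `y` of `g` is real with `y ^ 2 = r ^ 2 = |k.coeff 0|`. Since `g.coeff 1 = -(d +
  -- y)`, the product `g.coeff 1 * d` equals `y ^ 2 + d * y - (d + y) ^ 2`, an integer; `g.coeff 1 ≠
  -- 0` because `|d| < |y|`.
  · obtain ⟨w, rfl⟩ := Multiset.card_eq_one.mp (by omega : u.card = 1)
    obtain ⟨e1, e0⟩ := coeffs_of_aroots_eq_two hg (x := d) (y := w) hu
    rw [show k.natDegree = 2 by omega] at hk0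
    have hwr := hur w (by simp)
    have hwre : w = ((-(g.coeff 1) - d : ℝ) : ℂ) := by push_cast; linear_combination e1
    set y : ℝ := -(g.coeff 1) - d with hy
    have hwk : y ^ 2 = ((|k.coeff 0| : ℤ) : ℝ) := by
      push_cast
      rw [hk0, ← hwr, hwre, Complex.norm_real, Real.norm_eq_abs, sq_abs]
    have e0' : (g.coeff 0 : ℝ) = d * y := by rw [hwre] at e0; exact_mod_cast e0
    have hg1 : g.coeff 1 ≠ 0 := by
      intro h0
      rw [hwre, Complex.norm_real] at hwr
      rw [Complex.norm_real] at hd2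
      rw [hy, h0, Int.cast_zero, neg_zero, zero_sub, norm_neg] at hwr
      linarith
    refine exists_int_of_isIntegral_of_mul hint hg1
      (l := |k.coeff 0| + g.coeff 0 - g.coeff 1 ^ 2) ?_
    have : (g.coeff 1 : ℝ) * d = ((|k.coeff 0| + g.coeff 0 - g.coeff 1 ^ 2 : ℤ) : ℝ) := by
      rw [Int.cast_sub, Int.cast_add, ← hwk, e0', Int.cast_pow, hy]
      ring
    rw [← Complex.ofReal_intCast, ← Complex.ofReal_mul, this, Complex.ofReal_intCast]
  -- Here `r = |k.coeff 0|` is an integer and `|g.coeff 0| = |d| * r ^ 2`.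
  · obtain ⟨w, w', rfl⟩ := Multiset.card_eq_two.mp (by omega : u.card = 2)
    obtain ⟨-, -, e0⟩ := coeffs_of_aroots_eq_three hg (x := d) (y := w) (z := w') hu
    rw [show k.natDegree = 1 by omega, pow_one] at hk0
    have h6 : |(g.coeff 0 : ℝ)| = |d| * (k.coeff 0 : ℝ) ^ 2 := by
      rw [← Complex.norm_intCast, e0, norm_neg, norm_mul, norm_mul, hur w (by simp),
        hur w' (by simp), ← sq_abs (k.coeff 0 : ℝ), hk0, Complex.norm_real, Real.norm_eq_abs]
      ring
    have hk00 : k.coeff 0 ≠ 0 := by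
      intro h0
      rw [h0] at hk0
      simp only [Int.cast_zero, abs_zero] at hk0
      linarith
    rw [← abs_of_nonneg (sq_nonneg (k.coeff 0 : ℝ)), ← abs_mul, abs_eq_abs] at h6
    rcases h6 with h6 | h6
    · refine exists_int_of_isIntegral_of_mul hint (pow_ne_zero 2 hk00) (l := g.coeff 0) ?_
      have := congrArg (fun x : ℝ => (x : ℂ)) h6
      push_cast at this ⊢
      rw [this]; ring
    · refine exists_int_of_isIntegral_of_mul hint (pow_ne_zero 2 hk00) (l := -g.coeff 0) ?_
      have := congrArg (fun x : ℝ => (x : ℂ)) h6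
      push_cast at this ⊢
      rw [this]; ring

/-- An irreducible quartic does not have exactly three dominant roots. -/
theorem numDominant_ne_three_of_irreducible {f : ℤ[X]} (hf : f.Monic) (hd : f.natDegree = 4)
    (hi : Irreducible f) : numDominant f ≠ 3 := by
  intro h3
  obtain ⟨d, hd1, hd2, s, hs, hsr⟩ := exists_small_root hf (by omega)
  set r : ℝ := NNReal.toReal (house f)
  have hcard : s.card = 3 := by
    have := card_aroots hf
    rw [hs, Multiset.card_cons] at this
    omega
  have hnodup := nodup_aroots hf hi
  have hsub : ∀ z ∈ s, z ∈ f.aroots ℂ := fun z hz => by rw [hs]; exact Multiset.mem_cons_of_mem hz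
  have hsd : ∀ z ∈ f.aroots ℂ, z ≠ d → z ∈ s := fun z hz hzd => by
    rw [hs, Multiset.mem_cons] at hz
    exact hz.resolve_left hzd
  have hconj : ∀ z ∈ s, starRingEnd ℂ z ∈ s := fun z hz => by
    refine hsd _ (conj_mem_aroots (hsub z hz)) fun h => ?_
    have := hsr z hz
    rw [← RCLike.norm_conj, h] at this
    linarith
  obtain ⟨x, y, z, hxyz⟩ := Multiset.card_eq_three.mp hcard
  -- a real dominant root, and the product of the two others
  obtain ⟨x, y, z, hx, hy, hz, hxy, hxz, hrel⟩ : ∃ x y z, x ∈ s ∧ y ∈ s ∧ z ∈ s ∧ x ≠ y ∧ x ≠ z ∧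
      y * z = x * x := by
    have hnd : ({x, y, z} : Multiset ℂ).Nodup := by
      rw [← hxyz]
      rw [hs, Multiset.nodup_cons] at hnodup
      exact hnodup.2
    simp only [Multiset.insert_eq_cons, Multiset.nodup_cons, Multiset.mem_cons,
      Multiset.mem_singleton, not_or] at hnd
    obtain ⟨⟨hxy, hxz⟩, hyz, -⟩ := hnd
    replace hxy : x ≠ y := hxy
    replace hxz : x ≠ z := hxz
    replace hyz : y ≠ z := hyz
    have hx : x ∈ s := by simp [hxyz]
    have hy : y ∈ s := by simp [hxyz]
    have hz : z ∈ s := by simp [hxyz]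
    have hmem : ∀ w ∈ s, w = x ∨ w = y ∨ w = z := fun w hw => by simpa [hxyz] using hw
    -- Given a real dominant root `p`, the other two are conjugate with product `r ^ 2 = p ^ 2`:
    -- otherwise all three would be distinct reals of modulus `r`.
    have key : ∀ p q t : ℂ, p ∈ s → q ∈ s → t ∈ s → p ≠ q → p ≠ t → q ≠ t →
        (∀ w ∈ s, w = p ∨ w = q ∨ w = t) → starRingEnd ℂ p = p → q * t = p * p := by
      intro p q t hp hq ht hpq hpt hqt hw hpp
      have hpr : ∀ w ∈ s, starRingEnd ℂ w = w → w * w = ((r ^ 2 : ℝ) : ℂ) := fun w hws hww => by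
        rw [← mul_conj_of_norm (hsr w hws), hww]
      rcases hw _ (hconj q hq) with h | h | h
      · exact absurd (by rw [← hpp, ← h, Complex.conj_conj]) hpq
      · rcases hw _ (hconj t ht) with h' | h' | h'
        · exact absurd (by rw [← hpp, ← h', Complex.conj_conj]) hpt
        · exact absurd ((starRingEnd ℂ).injective (h.trans h'.symm)) hqt
        · have e1 := (hpr q hq h).trans (hpr p hp hpp).symm
          have e2 := (hpr t ht h').trans (hpr p hp hpp).symm
          rcases mul_self_eq_mul_self_iff.mp e1 with h1 | h1
          · exact absurd h1.symm hpq
          · rcases mul_self_eq_mul_self_iff.mp e2 with h2 | h2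
            · exact absurd h2.symm hpt
            · exact absurd (h1.trans h2.symm) hqt
      · rw [← h, mul_conj_of_norm (hsr q hq), hpr p hp hpp]
    rcases hmem _ (hconj x hx) with h | h | h
    · exact ⟨x, y, z, hx, hy, hz, hxy, hxz, key x y z hx hy hz hxy hxz hyz hmem h⟩
    · have hzz : starRingEnd ℂ z = z := by
        rcases hmem _ (hconj z hz) with h' | h' | h'
        · exact absurd (by rw [← h, ← h', Complex.conj_conj]) hyz
        · exact absurd ((starRingEnd ℂ).injective (h.trans h'.symm)) hxz
        · exact h'
      exact ⟨z, x, y, hz, hx, hy, hxz.symm, hyz.symm, key z x y hz hx hy hxz.symm hyz.symm hxy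
        (fun w hw => by have := hmem w hw; tauto) hzz⟩
    · have hyy : starRingEnd ℂ y = y := by
        rcases hmem _ (hconj y hy) with h' | h' | h'
        · exact absurd (by rw [← h, ← h', Complex.conj_conj]) hyz
        · exact h'
        · exact absurd ((starRingEnd ℂ).injective (h.trans h'.symm)) hxy
      exact ⟨y, x, z, hy, hx, hz, hxy.symm, hyz, key y x z hy hx hz hxy.symm hyz hxz
        (fun w hw => by have := hmem w hw; tauto) hyy⟩
  -- All roots lie in `L`, and irreducibility makes `d` a conjugate of `x`, so some embedding `σ` of
  -- `L` into `ℂ` takes `x` to `d`.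
  let L := algebraicClosure ℚ ℂ
  have hL : ∀ w ∈ s, w ∈ L := fun w hw => mem_algebraicClosure_iff'.mpr
    (isIntegral_of_mem_aroots hf (hsub w hw)).tower_top
  have hirr : Irreducible (f.map (algebraMap ℤ ℚ)) :=
    (hf.irreducible_iff_irreducible_map_fraction_map).mp hi
  have haeval : ∀ w : L, aeval w (f.map (algebraMap ℤ ℚ)) = 0 ↔ (w : ℂ) ∈ f.aroots ℂ := fun w => by
    rw [mem_aroots_iff hf, aeval_map_algebraMap, ← aeval_algebraMap_eq_zero_iff ℂ]
    rfl
  set x' : L := ⟨x, hL x hx⟩ with hx'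
  set y' : L := ⟨y, hL y hy⟩ with hy'
  set z' : L := ⟨z, hL z hz⟩ with hz'
  have hmin : minpoly ℚ x' = f.map (algebraMap ℤ ℚ) :=
    (minpoly.eq_of_irreducible_of_monic hirr ((haeval x').mpr (hsub x hx)) (hf.map _)).symm
  have hdx : aeval (d : ℂ) (minpoly ℚ x') = 0 := by
    rw [hmin, aeval_map_algebraMap]
    exact (mem_aroots_iff hf).mp hd1
  obtain ⟨σ, hσ⟩ := IntermediateField.exists_algHom_of_splits_of_aeval (F := ℚ) (E := L) (K := ℂ)
    (fun w => ⟨(isIntegral_algHom_iff L.val L.val.injective).mp (mem_algebraicClosure_iff'.mp w.2),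
      IsAlgClosed.splits _⟩) (x := x') (y := (d : ℂ)) hdx
  have himg : ∀ w : L, (w : ℂ) ∈ s → w ≠ x' → ‖σ w‖ = r := fun w hw hwx => by
    refine hsr _ (hsd _ ?_ fun h => hwx (σ.injective (h.trans hσ.symm)))
    rw [mem_aroots_iff hf, ← aeval_map_algebraMap ℚ, aeval_algHom_apply,
      (haeval w).mpr (hsub _ hw), map_zero]
  -- By injectivity `σ y'` and `σ z'` are roots other than `d`, hence of modulus `r`. This gives `r
  -- ^ 2 = |d| ^ 2`, contrary to `|d| < r`.
  have hmul : σ y' * σ z' = d * d := by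
    rw [← map_mul, show y' * z' = x' * x' from Subtype.ext hrel, map_mul, hσ]
  have hnorm := congrArg norm hmul
  rw [norm_mul, norm_mul, himg y' hy fun h => hxy (congrArg Subtype.val h).symm,
    himg z' hz fun h => hxz (congrArg Subtype.val h).symm] at hnorm
  nlinarith [norm_nonneg (d : ℂ)]

end ThreeOfFour

/-! ### Parameter ranges of size `⌊K * H ^ θ⌋₊` -/

section Auxiliary

theorem eventually_floor_ge {K θ : ℝ} (hK : 0 < K) (hθ : 0 < θ) :
    ∀ᶠ H : ℕ in Filter.atTop, K / 2 * (H : ℝ) ^ θ ≤ (⌊K * (H : ℝ) ^ θ⌋₊ : ℝ) := by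
  refine eventually_sub_rpow_ge (C := 1) (a := 0) hK hθ (Filter.Eventually.of_forall fun H => ?_)
  rw [Real.rpow_zero, mul_one]
  exact (Nat.sub_one_lt_floor _).le

/-- Lower bounds for counting functions in terms of `⌊K * H ^ θ⌋₊`. -/
theorem eventually_lower_of_pow_floor {U : ℕ → ℕ} {K θ e : ℝ} {m : ℕ} (hK : 0 < K) (hθ : 0 < θ)
    (hm : θ * m = e) (h : ∀ H : ℕ, 1 ≤ H → ⌊K * (H : ℝ) ^ θ⌋₊ ^ m ≤ U H) :
    ∀ᶠ H : ℕ in Filter.atTop, (K / 2) ^ m * (H : ℝ) ^ e ≤ U H := by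
  filter_upwards [eventually_floor_ge hK hθ, Filter.eventually_ge_atTop 1] with H h1 h2
  calc (K / 2) ^ m * (H : ℝ) ^ e = (K / 2 * (H : ℝ) ^ θ) ^ m := by
        rw [mul_pow, ← hm, Real.rpow_mul (Nat.cast_nonneg _), Real.rpow_natCast]
    _ ≤ (⌊K * (H : ℝ) ^ θ⌋₊ : ℝ) ^ m := by gcongr
    _ ≤ _ := by exact_mod_cast h H h2

theorem pow_floor_le {K θ : ℝ} {m c H : ℕ} (hK : 0 < K) (hm : θ * m = 1) (hc : c * K ^ m ≤ 1) :
    c * ⌊K * (H : ℝ) ^ θ⌋₊ ^ m ≤ H := by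
  have h1 : (⌊K * (H : ℝ) ^ θ⌋₊ : ℝ) ≤ K * (H : ℝ) ^ θ := Nat.floor_le (by positivity)
  have h2 : ((H : ℝ) ^ θ) ^ m = H := by
    rw [← Real.rpow_natCast, ← Real.rpow_mul (Nat.cast_nonneg _), hm, Real.rpow_one]
  have h3 : (c * ⌊K * (H : ℝ) ^ θ⌋₊ ^ m : ℝ) ≤ H := by
    calc (c * ⌊K * (H : ℝ) ^ θ⌋₊ ^ m : ℝ) ≤ c * (K * (H : ℝ) ^ θ) ^ m := by gcongr
      _ = (c * K ^ m) * H := by rw [mul_pow, h2]; ring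
      _ ≤ 1 * H := by gcongr
      _ = H := one_mul _
  exact_mod_cast h3

theorem abs_le_rpow_of_pow_le {x θ : ℝ} {m H : ℕ} (hm : θ * m = 1) (hx : 0 ≤ x)
    (h : x ^ m ≤ H) : x ≤ (H : ℝ) ^ θ := by
  have hm0 : (m : ℝ) ≠ 0 := by rintro h0; rw [h0] at hm; simp at hm
  calc x = (x ^ m) ^ θ := by
        rw [← Real.rpow_natCast, ← Real.rpow_mul hx, mul_comm, hm, Real.rpow_one]
    _ ≤ _ := by
      have : 0 ≤ θ := by
        by_contra! hneg
        have : θ * m ≤ 0 := mul_nonpos_of_nonpos_of_nonneg hneg.le (Nat.cast_nonneg _)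
        linarith
      gcongr

theorem abs_coeff_le {f : ℤ[X]} {H : ℕ} (h : polyHeight f ≤ H) (i : ℕ) :
    |(f.coeff i : ℝ)| ≤ H := by
  rw [← Int.cast_abs, Int.abs_eq_natAbs]
  exact_mod_cast polyHeight_le_iff.mp h i

theorem X_pow_mem_dominantSet {n : ℕ} (hn : 1 ≤ n) : (X : ℤ[X]) ^ n ∈ dominantSet n n 1 := by
  refine ⟨monic_X_pow n, natDegree_X_pow n, ?_, ?_⟩
  · rw [polyHeight_le_iff]
    intro i
    rw [coeff_X_pow]
    split_ifs <;> simp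
  · refine (numDominant_eq_natDegree_of_forall (r := 0) (monic_X_pow n) (by simpa) ?_).trans
      (natDegree_X_pow n)
    intro z hz
    rw [aroots_X_pow n z hz, nnnorm_zero]

theorem one_le_redCount_self {n H : ℕ} (hn : 2 ≤ n) (hH : 1 ≤ H) : 1 ≤ redCount n n H := by
  refine one_le_redCount (X_pow_mem_dominantSet (by omega)) ?_ hH
  obtain ⟨m, rfl⟩ : ∃ m, n = m + 1 := ⟨n - 1, by omega⟩
  rw [pow_succ]
  exact not_irreducible_mul_monic (monic_X_pow m) monic_X (by rw [natDegree_X_pow]; omega) (by simp)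

end Auxiliary

/-! ### Cubics with three dominant roots -/

section Cubics

theorem natDegree_X_cube_add_C (c : ℤ) : (X ^ 3 + C c : ℤ[X]).natDegree = 3 :=
  natDegree_X_pow_add_C

theorem monic_X_cube_add_C (c : ℤ) : (X ^ 3 + C c : ℤ[X]).Monic :=
  monic_X_pow_add_C c (by norm_num)

theorem norm_root_X_cube_add_C {c : ℤ} {z : ℂ} (hz : z ∈ (X ^ 3 + C c : ℤ[X]).aroots ℂ) :
    ‖z‖ ^ 3 = |(c : ℝ)| := by
  have h1 := (mem_aroots_iff (monic_X_cube_add_C c)).mp hz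
  simp only [map_add, map_pow, aeval_X, eq_intCast, map_intCast] at h1
  rw [← norm_pow, eq_neg_of_add_eq_zero_left h1, norm_neg, Complex.norm_intCast]

theorem numDominant_X_cube_add_C (c : ℤ) : numDominant (X ^ 3 + C c : ℤ[X]) = 3 := by
  have hm := monic_X_cube_add_C c
  have hd := natDegree_X_cube_add_C c
  obtain ⟨w, hw, -⟩ := exists_nnnorm_eq_house hm (by omega)
  refine (numDominant_of_forall_norm hm (by omega) (r := ‖w‖) fun z hz => ?_).trans hd
  exact (pow_left_inj₀ (norm_nonneg _) (norm_nonneg _) (by norm_num)).mp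
    ((norm_root_X_cube_add_C hz).trans (norm_root_X_cube_add_C hw).symm)

theorem irreducible_X_cube_add_C_iff (c : ℤ) :
    Irreducible (X ^ 3 + C c : ℤ[X]) ↔ ∀ t : ℤ, t ^ 3 ≠ -c := by
  have hm := monic_X_cube_add_C c
  have hd := natDegree_X_cube_add_C c
  rw [hm.irreducible_iff_roots_eq_zero_of_degree_le_three (by omega) (by omega),
    Multiset.eq_zero_iff_forall_notMem]
  refine forall_congr' fun t => not_congr ?_
  rw [mem_roots hm.ne_zero, IsRoot.def]
  simp only [eval_add, eval_pow, eval_X, eval_C]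
  constructor <;> intro h <;> linarith

theorem X_cube_add_C_mem_dominantSet {c : ℤ} {H : ℕ} (hH : 1 ≤ H) (hc : |c| ≤ H) :
    (X ^ 3 + C c : ℤ[X]) ∈ dominantSet 3 3 H := by
  refine ⟨monic_X_cube_add_C c, natDegree_X_cube_add_C c, ?_, numDominant_X_cube_add_C c⟩
  rw [polyHeight_le_iff]
  intro i
  simp only [coeff_add, coeff_X_pow, coeff_C]
  have := abs_le.mp hc
  split_ifs <;> omega

theorem hasGrowth_cubes : HasGrowth (fun H => {c : ℤ | |c| ≤ H ∧ ∃ t : ℤ, t ^ 3 = -c})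
    (1 / 3 : ℝ) := by
  refine ((HasGrowth.int_abs_le (e := 1 / 3) 1 one_pos.le (by norm_num)).image
    fun t => -t ^ 3).subset ?_
  rintro H - c ⟨hc, t, ht⟩
  refine ⟨t, ?_, by simp [ht]⟩
  rw [Set.mem_ofPred_eq, one_mul]
  refine abs_le_rpow_of_pow_le (m := 3) (by norm_num) (abs_nonneg _) ?_
  rw [← abs_pow]
  have : |t ^ 3| ≤ H := by rw [ht, abs_neg]; exact hc
  exact_mod_cast this

/-- The second shape in `cubic_form` is visibly reducible, so the polynomials counted are the `X ^ 3
+ c` with `-c` not a cube, and cubes remove only `O(H ^ (1 / 3))` values of `c`. -/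
theorem asympEquiv_irredCount_three :
    AsympEquiv (fun H => (irredCount 3 3 H : ℝ)) (fun H => 2 * (H : ℝ)) := by
  obtain ⟨C₀, hC0, hC⟩ := hasGrowth_cubes.exists_nonneg
  have hinj : Function.Injective fun c : ℤ => (X ^ 3 + C c : ℤ[X]) := fun c d h =>
    C_injective (add_left_cancel h)
  have hcard : ∀ H : ℕ, (Set.Icc (-(H : ℤ)) H).ncard = 2 * H + 1 := fun H => by
    rw [← Finset.coe_Icc, Set.ncard_coe_finset, Int.card_Icc]
    omega
  have hlow : ∀ H : ℕ, 1 ≤ H →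
      1 - C₀ * (H : ℝ) ^ (-(2 / 3 : ℝ)) ≤ irredCount 3 3 H / (2 * (H : ℝ)) := by
    intro H hH
    have h0 : (1 : ℝ) ≤ H := by exact_mod_cast hH
    obtain ⟨hfin, hb⟩ := hC H hH
    have hA : {c : ℤ | |c| ≤ H ∧ Irreducible (X ^ 3 + C c : ℤ[X])}.ncard ≤ irredCount 3 3 H :=
      Set.ncard_le_ncard_of_injOn (fun c : ℤ => (X ^ 3 + C c : ℤ[X]))
        (fun c hc => ⟨X_cube_add_C_mem_dominantSet hH hc.1, hc.2⟩) hinj.injOn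
        ((dominantSet_finite 3 3 H).subset fun _ hf => hf.1)
    have hsub : Set.Icc (-(H : ℤ)) H ⊆ {c : ℤ | |c| ≤ H ∧ Irreducible (X ^ 3 + C c : ℤ[X])} ∪
        {c : ℤ | |c| ≤ H ∧ ∃ t : ℤ, t ^ 3 = -c} := by
      intro c hc
      have hc' : |c| ≤ H := abs_le.mpr hc
      by_cases h : ∃ t : ℤ, t ^ 3 = -c
      · exact Or.inr ⟨hc', h⟩
      · exact Or.inl ⟨hc', (irreducible_X_cube_add_C_iff c).mpr fun t ht => h ⟨t, ht⟩⟩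
    have hfinA : {c : ℤ | |c| ≤ H ∧ Irreducible (X ^ 3 + C c : ℤ[X])}.Finite :=
      (Set.finite_Icc (-(H : ℤ)) H).subset fun c hc => abs_le.mp hc.1
    have h1 := (Set.ncard_le_ncard hsub (hfinA.union hfin)).trans (Set.ncard_union_le _ _)
    rw [hcard] at h1
    have h2 : 2 * (H : ℝ) + 1 ≤ irredCount 3 3 H +
        ({c : ℤ | |c| ≤ H ∧ ∃ t : ℤ, t ^ 3 = -c}.ncard : ℝ) := by
      exact_mod_cast h1.trans (Nat.add_le_add_right hA _)
    rw [le_div_iff₀ (by positivity), sub_mul, one_mul]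
    have h4 : (H : ℝ) ^ (1 / 3 : ℝ) = (H : ℝ) ^ (-(2 / 3 : ℝ)) * H := by
      nth_rewrite 3 [← Real.rpow_one (H : ℝ)]
      rw [← Real.rpow_add (by linarith)]
      norm_num
    have h5 : 0 ≤ C₀ * ((H : ℝ) ^ (-(2 / 3 : ℝ)) * H) := by positivity
    rw [h4] at hb
    nlinarith
  have hup : ∀ H : ℕ, 1 ≤ H →
      irredCount 3 3 H / (2 * (H : ℝ)) ≤ 1 + 1 / 2 * (H : ℝ)⁻¹ := by
    intro H hH
    have h0 : (1 : ℝ) ≤ H := by exact_mod_cast hH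
    have h1 : irredCount 3 3 H ≤ 2 * H + 1 := by
      rw [← hcard]
      have hsub : {f ∈ dominantSet 3 3 H | Irreducible f} ⊆
          (fun c : ℤ => (X ^ 3 + C c : ℤ[X])) '' Set.Icc (-(H : ℤ)) H := by
        rintro f ⟨⟨hf, hd, hfH, h3⟩, hi⟩
        rcases cubic_form hf hd h3 with ⟨c, rfl⟩ | ⟨a, t, -, -, rfl⟩
        · refine ⟨c, ?_, rfl⟩
          have := polyHeight_le_iff.mp hfH 0
          simp only [coeff_add, coeff_X_pow, coeff_C] at this
          simp only [Set.mem_Icc]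
          norm_num at this
          omega
        · exact absurd hi (not_irreducible_mul_monic (monic_X_add_C t) (monic_quad (a - t) (t ^ 2))
            (natDegree_X_add_C t).ge ((natDegree_quad (a - t) (t ^ 2)).ge.trans' (by norm_num)))
      exact (Set.ncard_le_ncard hsub ((Set.finite_Icc _ _).image _)).trans
        (Set.ncard_image_le (Set.finite_Icc _ _))
    rw [div_le_iff₀ (by positivity)]
    have h2 : (1 + 1 / 2 * (H : ℝ)⁻¹) * (2 * H) = 2 * H + 1 := by field_simp
    rw [h2]
    exact_mod_cast h1
  have t1 : Filter.Tendsto (fun H : ℕ => 1 - C₀ * (H : ℝ) ^ (-(2 / 3 : ℝ))) Filter.atTop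
      (nhds 1) := by
    have := (((tendsto_rpow_neg_atTop (by norm_num : (0 : ℝ) < 2 / 3)).comp
      tendsto_natCast_atTop_atTop).const_mul C₀).const_sub 1
    simpa using this
  have t2 : Filter.Tendsto (fun H : ℕ => 1 + 1 / 2 * (H : ℝ)⁻¹) Filter.atTop (nhds 1) := by
    have := ((tendsto_inv_atTop_nhds_zero_nat (𝕜 := ℝ)).const_mul (1 / 2)).const_add 1
    simpa using this
  exact tendsto_of_tendsto_of_tendsto_of_le_of_le' t1 t2
    (Filter.eventually_atTop.mpr ⟨1, hlow⟩) (Filter.eventually_atTop.mpr ⟨1, hup⟩)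

/-- The cubics `X ^ 3 + a * X ^ 2 + a * t * X + t ^ 3`, in factored form. -/
noncomputable def cubicFam (a t : ℤ) : ℤ[X] := (X + C t) * quad (a - t) (t ^ 2)

theorem cubicFam_eq (a t : ℤ) :
    cubicFam a t = X ^ 3 + C a * X ^ 2 + C (a * t) * X + C (t ^ 3) := by
  rw [cubicFam, quad]
  simp only [C_sub, C_pow, C_mul]
  ring

theorem coeff_cubic (a b c : ℤ) (i : ℕ) :
    (X ^ 3 + C a * X ^ 2 + C b * X + C c : ℤ[X]).coeff i =
      if i = 3 then 1 else if i = 2 then a else if i = 1 then b else if i = 0 then c else 0 := by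
  simp only [coeff_add, coeff_C_mul, coeff_X_pow, coeff_X, coeff_C]
  split_ifs <;> omega

theorem monic_cubicFam (a t : ℤ) : (cubicFam a t).Monic := (monic_X_add_C t).mul (monic_quad _ _)

theorem natDegree_cubicFam (a t : ℤ) : (cubicFam a t).natDegree = 3 := by
  rw [cubicFam, (monic_X_add_C t).natDegree_mul (monic_quad _ _), natDegree_X_add_C, natDegree_quad]

theorem not_irreducible_cubicFam (a t : ℤ) : ¬ Irreducible (cubicFam a t) :=
  not_irreducible_mul_monic (monic_X_add_C t) (monic_quad _ _) (natDegree_X_add_C t).ge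
    ((natDegree_quad _ _).ge.trans' (by norm_num))

theorem X_cube_add_C_cube (t : ℤ) : (X ^ 3 + C (t ^ 3) : ℤ[X]) = cubicFam 0 t := by
  rw [cubicFam_eq]; simp

theorem abs_le_of_polyHeight_cubicFam {a t : ℤ} {H : ℕ} (h : polyHeight (cubicFam a t) ≤ H) :
    |(t : ℝ)| ≤ 1 * (H : ℝ) ^ (1 / 3 : ℝ) := by
  rw [one_mul]
  refine abs_le_rpow_of_pow_le (m := 3) (by norm_num) (abs_nonneg _) ?_
  have := abs_coeff_le h 0
  rw [cubicFam_eq, coeff_cubic] at this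
  rw [← abs_pow]
  simpa using this

/-- A reducible `X ^ 3 + c` has `c` a cube and thus belongs to `cubicFam` with `a = 0`. In this
family `|t| ^ 3 ≤ H` and `|a| ≤ 3 * |t|`. -/
theorem hasGrowth_redCount_three :
    HasGrowth (fun H => {f ∈ dominantSet 3 3 H | ¬ Irreducible f}) (2 / 3 : ℝ) := by
  refine ((((HasGrowth.int_abs_le (e := 1 / 3) 3 (by norm_num) (by norm_num)).prod
    (HasGrowth.int_abs_le (e := 1 / 3) 1 one_pos.le (by norm_num))).image
    fun p : ℤ × ℤ => cubicFam p.1 p.2).mono (by norm_num)).subset ?_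
  rintro H - f ⟨⟨hf, hd, hfH, h3⟩, hi⟩
  obtain ⟨a, t, hat, rfl⟩ : ∃ a t : ℤ, |a| ≤ 3 * |t| ∧ f = cubicFam a t := by
    rcases cubic_form hf hd h3 with ⟨c, rfl⟩ | ⟨a, t, hat, -, rfl⟩
    · rw [irreducible_X_cube_add_C_iff] at hi
      push Not at hi
      obtain ⟨t, ht⟩ := hi
      refine ⟨0, -t, by simp, ?_⟩
      rw [← X_cube_add_C_cube, show (-t) ^ 3 = c by linarith [show (-t) ^ 3 = -t ^ 3 by ring]]
    · exact ⟨a, t, hat, rfl⟩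
  have ht := abs_le_of_polyHeight_cubicFam hfH
  refine ⟨(a, t), ⟨?_, ht⟩, rfl⟩
  have : |(a : ℝ)| ≤ 3 * |(t : ℝ)| := by exact_mod_cast hat
  rw [Set.mem_ofPred_eq]
  linarith

theorem numDominant_cubicFam {a t : ℤ} (h0 : 0 ≤ a) (h1 : a ≤ t) :
    numDominant (cubicFam a t) = 3 := by
  have hm := monic_cubicFam a t
  have hd := natDegree_cubicFam a t
  refine (numDominant_of_forall_norm hm (by omega) (r := |(t : ℝ)|) fun z hz => ?_).trans hd
  rw [cubicFam, aroots_mul_monic (monic_X_add_C t) (monic_quad _ _), Multiset.mem_add] at hz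
  rcases hz with hz | hz
  · have h2 := (mem_aroots_iff (monic_X_add_C t)).mp hz
    simp only [map_add, aeval_X, eq_intCast, map_intCast] at h2
    rw [eq_neg_of_add_eq_zero_left h2, norm_neg, Complex.norm_intCast]
  · rw [norm_root_quad (by nlinarith) hz]
    push_cast
    exact Real.sqrt_sq_eq_abs _

theorem asympFrom_redCount_three :
    AsympFrom 1 (fun H => (redCount 3 3 H : ℝ)) (fun H => (H : ℝ) ^ (2 / 3 : ℝ)) := by
  refine asympFrom_rpow le_rfl hasGrowth_redCount_three.upper
    (fun H hH => one_le_redCount_self (by norm_num) hH) (c := (1 / 2 / 2) ^ 2) (by norm_num)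
    (eventually_lower_of_pow_floor (K := 1 / 2) (θ := 1 / 3) (by norm_num) (by norm_num)
      (by norm_num) fun H hH => ?_)
  have hN := pow_floor_le (K := 1 / 2) (θ := 1 / 3) (m := 3) (c := 8) (H := H) (by norm_num)
    (by norm_num) (by norm_num)
  set N := ⌊1 / 2 * (H : ℝ) ^ (1 / 3 : ℝ)⌋₊
  -- Here `a ≤ N < t`, so the quadratic factor has nonpositive discriminant `(a - t) ^ 2 - 4 * t ^
  -- 2`, and `t ^ 3 ≤ 8 * N ^ 3 ≤ H`.
  set F : Finset (ℤ × ℤ) := Finset.Icc 1 (N : ℤ) ×ˢ Finset.Icc (N + 1 : ℤ) (2 * N)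
  have hF : F.card = N ^ 2 := by
    rw [Finset.card_product, Int.card_Icc, Int.card_Icc, sq]
    congr 1 <;> omega
  rw [← hF, ← Set.ncard_coe_finset]
  refine Set.ncard_le_ncard_of_injOn (fun p : ℤ × ℤ => cubicFam p.1 p.2) ?_ ?_
    ((dominantSet_finite 3 3 H).subset fun _ hf => hf.1)
  · rintro ⟨a, t⟩ hat
    simp only [F, Finset.coe_product, Finset.coe_Icc, Set.mem_prod, Set.mem_Icc] at hat
    obtain ⟨⟨ha1, ha2⟩, ht1, ht2⟩ := hat
    refine ⟨⟨monic_cubicFam a t, natDegree_cubicFam a t, ?_,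
      numDominant_cubicFam (by omega) (by omega)⟩, not_irreducible_cubicFam a t⟩
    have hN' : 8 * (N : ℤ) ^ 3 ≤ H := by exact_mod_cast hN
    have ht0 : 0 ≤ t := by omega
    have ht3 : t ^ 3 ≤ H := by
      calc t ^ 3 ≤ (2 * N) ^ 3 := by gcongr
        _ = 8 * (N : ℤ) ^ 3 := by ring
        _ ≤ H := hN'
    have hat3 : a * t ≤ t ^ 3 := by
      calc a * t ≤ t * t := by gcongr; omega
        _ ≤ t * t * t := le_mul_of_one_le_right (by positivity) (by omega)
        _ = t ^ 3 := by ring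
    have hat4 : a ≤ a * t := le_mul_of_one_le_right (by omega) (by omega)
    have ht4 : 0 ≤ t ^ 3 := by positivity
    rw [polyHeight_le_iff]
    intro i
    rw [cubicFam_eq, coeff_cubic]
    dsimp only
    split_ifs <;> omega
  · rintro ⟨a, t⟩ - ⟨a', t'⟩ - h
    simp only [cubicFam_eq] at h
    have h2 := congrArg (fun p => coeff p 2) h
    have h0 := congrArg (fun p => coeff p 0) h
    simp only [coeff_cubic] at h2 h0
    norm_num at h2 h0
    rw [Odd.pow_inj (by decide : Odd 3)] at h0
    rw [h2, h0]

end Cubics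

/-! ### Quartics with four dominant roots -/

section Quartics

theorem coeff_quartic (a b c d : ℤ) (i : ℕ) :
    (X ^ 4 + C a * X ^ 3 + C b * X ^ 2 + C c * X + C d : ℤ[X]).coeff i =
      if i = 4 then 1 else if i = 3 then a else if i = 2 then b else if i = 1 then c else
        if i = 0 then d else 0 := by
  simp only [coeff_add, coeff_C_mul, coeff_X_pow, coeff_X, coeff_C]
  split_ifs <;> omega

theorem monic_quartic (a b c d : ℤ) :
    (X ^ 4 + C a * X ^ 3 + C b * X ^ 2 + C c * X + C d : ℤ[X]).Monic := by
  monicity!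

theorem natDegree_quartic (a b c d : ℤ) :
    (X ^ 4 + C a * X ^ 3 + C b * X ^ 2 + C c * X + C d : ℤ[X]).natDegree = 4 := by
  compute_degree!

/-- The constraints on the coefficients of a quartic whose roots have equal modulus. -/
theorem quartic_coeff_bounds {f : ℤ[X]} {H : ℕ} (hf : f ∈ dominantSet 4 4 H) :
    |(f.coeff 0 : ℝ)| = (house f : ℝ) ^ 4 ∧ (house f : ℝ) ≤ (H : ℝ) ^ (1 / 4 : ℝ) ∧
      (house f : ℝ) ^ 2 ≤ (H : ℝ) ^ (1 / 2 : ℝ) := by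
  obtain ⟨hf, hd, hH, h4⟩ := hf
  have hr := norm_eq_house_of_numDominant hf (h4.trans hd.symm)
  have h0 := norm_coeff_zero_of_forall hf hr
  rw [hd] at h0
  have h1 : (house f : ℝ) ^ 4 ≤ H := h0 ▸ abs_coeff_le hH 0
  refine ⟨h0, abs_le_rpow_of_pow_le (m := 4) (by norm_num) (NNReal.coe_nonneg _) h1,
    abs_le_rpow_of_pow_le (m := 2) (by norm_num) (by positivity) ?_⟩
  rwa [← pow_mul]

/-- By `quartic_relation`, either the odd coefficients vanish, leaving `O(H ^ (1 / 2))` choices for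
the middle and `O(H)` for the constant coefficient, or `a₁ = k * a₃` and `a₀ = ±k ^ 2`. The second
case contributes only `O(H ^ (1 / 4 + 1 / 2 + 1 / 2))`. -/
theorem hasGrowth_dominantSet_four : HasGrowth (dominantSet 4 4) (3 / 2 : ℝ) := by
  have hbi : HasGrowth (fun H => (fun p : ℤ × ℤ =>
      (X ^ 4 + C 0 * X ^ 3 + C p.1 * X ^ 2 + C 0 * X + C p.2 : ℤ[X])) ''
      ({x : ℤ | |(x : ℝ)| ≤ 6 * (H : ℝ) ^ (1 / 2 : ℝ)} ×ˢ
        {x : ℤ | |(x : ℝ)| ≤ 1 * (H : ℝ) ^ (1 : ℝ)})) (3 / 2 : ℝ) :=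
    (((HasGrowth.int_abs_le 6 (by norm_num) (by norm_num)).prod
      (HasGrowth.int_abs_le 1 (by norm_num) (by norm_num))).mono (by norm_num)).image _
  have htri : ∀ s : ℤ, HasGrowth (fun H => (fun p : ℤ × ℤ × ℤ =>
      (X ^ 4 + C p.1 * X ^ 3 + C p.2.1 * X ^ 2 + C (p.1 * p.2.2) * X + C (s * p.2.2 ^ 2) :
        ℤ[X])) ''
      ({x : ℤ | |(x : ℝ)| ≤ 4 * (H : ℝ) ^ (1 / 4 : ℝ)} ×ˢ
        ({x : ℤ | |(x : ℝ)| ≤ 6 * (H : ℝ) ^ (1 / 2 : ℝ)} ×ˢ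
        {x : ℤ | |(x : ℝ)| ≤ 1 * (H : ℝ) ^ (1 / 2 : ℝ)}))) (3 / 2 : ℝ) := fun s =>
    (((HasGrowth.int_abs_le 4 (by norm_num) (by norm_num)).prod
      ((HasGrowth.int_abs_le 6 (by norm_num) (by norm_num)).prod
      (HasGrowth.int_abs_le 1 (by norm_num) (by norm_num)))).mono (by norm_num)).image _
  refine ((hbi.union (htri 1)).union (htri (-1))).subset fun H hH f hfm => ?_
  obtain ⟨h0, h1, h2⟩ := quartic_coeff_bounds hfm
  obtain ⟨hf, hd, hfH, h4⟩ := hfm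
  have hr := norm_eq_house_of_numDominant hf (h4.trans hd.symm)
  have hrel := quartic_relation hf hd hr
  have hb2 : |(f.coeff 2 : ℝ)| ≤ 6 * (H : ℝ) ^ (1 / 2 : ℝ) :=
    (quartic_abs_coeff_two_le hf hd hr).trans (by linarith)
  have hb3 : |(f.coeff 3 : ℝ)| ≤ 4 * (H : ℝ) ^ (1 / 4 : ℝ) := by
    have := abs_coeff_pred_le hf (by omega) fun z hz => (hr z hz).le
    rw [hd] at this
    push_cast at this
    linarith
  have hcase : (f.coeff 3 = 0 ∧ f.coeff 1 = 0) ∨ (f.coeff 0 ≠ 0 ∧ f.coeff 3 ≠ 0) := by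
    by_cases hr0 : house f = 0
    · rw [eq_X_pow_of_house_eq_zero hf hr0, hd]
      simp [coeff_X_pow]
    · have hr0' : (house f : ℝ) ≠ 0 := by exact_mod_cast hr0
      by_cases h3 : f.coeff 3 = 0
      · rw [h3, Int.cast_zero, mul_zero, mul_eq_zero] at hrel
        exact Or.inl ⟨h3, by exact_mod_cast hrel.resolve_left (pow_ne_zero 2 hr0')⟩
      · refine Or.inr ⟨fun h => ?_, h3⟩
        rw [h, Int.cast_zero, abs_zero] at h0
        exact pow_ne_zero 4 hr0' h0.symm
  have hfeq := eq_quartic hf hd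
  rcases hcase with ⟨h3, h1'⟩ | ⟨h00, h3⟩
  · refine Or.inl (Or.inl ⟨(f.coeff 2, f.coeff 0), ⟨hb2, ?_⟩, ?_⟩)
    · simpa using abs_coeff_le hfH 0
    · rw [h3, h1'] at hfeq
      exact hfeq.symm
  · have hsq : f.coeff 1 ^ 2 = |f.coeff 0| * f.coeff 3 ^ 2 := by
      have h5 : |(f.coeff 0 : ℝ)| * (f.coeff 1 : ℝ) ^ 2 =
          |(f.coeff 0 : ℝ)| * (|(f.coeff 0 : ℝ)| * (f.coeff 3 : ℝ) ^ 2) := by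
        rw [← mul_assoc, abs_mul_abs_self, h0]
        linear_combination (house f ^ 2 * (f.coeff 1 : ℝ) + f.coeff 0 * f.coeff 3) * hrel
      have h6 := mul_left_cancel₀ (abs_ne_zero.mpr (by exact_mod_cast h00)) h5
      exact_mod_cast h6
    obtain ⟨k, hk⟩ : f.coeff 3 ∣ f.coeff 1 :=
      (Int.pow_dvd_pow_iff two_ne_zero).mp ⟨|f.coeff 0|, by rw [hsq, mul_comm]⟩
    have hk2 : k ^ 2 = |f.coeff 0| := by
      rw [hk] at hsq
      exact mul_right_cancel₀ (pow_ne_zero 2 h3) (by linarith)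
    have hkb : |(k : ℝ)| ≤ 1 * (H : ℝ) ^ (1 / 2 : ℝ) := by
      rw [one_mul]
      refine abs_le_rpow_of_pow_le (m := 2) (by norm_num) (abs_nonneg _) ?_
      rw [sq_abs]
      have : ((k ^ 2 : ℤ) : ℝ) = |(f.coeff 0 : ℝ)| := by rw [hk2]; push_cast; rfl
      push_cast at this
      rw [this]
      exact abs_coeff_le hfH 0
    rw [hk] at hfeq
    rcases abs_choice (f.coeff 0) with h | h
    · refine Or.inl (Or.inr ⟨(f.coeff 3, f.coeff 2, k), ⟨hb3, hb2, hkb⟩, ?_⟩)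
      rw [show f.coeff 0 = 1 * k ^ 2 by rw [hk2, h, one_mul]] at hfeq
      exact hfeq.symm
    · refine Or.inr ⟨(f.coeff 3, f.coeff 2, k), ⟨hb3, hb2, hkb⟩, ?_⟩
      rw [show f.coeff 0 = -1 * k ^ 2 by rw [hk2, h]; ring] at hfeq
      exact hfeq.symm

theorem one_le_irredCount_four {H : ℕ} (hH : 1 ≤ H) : 1 ≤ irredCount 4 4 H := by
  have heq : (X ^ 4 + 1 : ℤ[X]) = cyclotomic 8 ℤ := by
    have := cyclotomic_prime_pow_eq_geom_sum (R := ℤ) (n := 2) Nat.prime_two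
    norm_num [Finset.sum_range_succ] at this
    rw [this, add_comm]
  have hC : (X ^ 4 + 1 : ℤ[X]) = X ^ 4 + C 1 := by simp
  have hm : (X ^ 4 + 1 : ℤ[X]).Monic := heq ▸ cyclotomic.monic 8 ℤ
  have hd : (X ^ 4 + 1 : ℤ[X]).natDegree = 4 := by rw [hC, natDegree_X_pow_add_C]
  refine one_le_irredCount (f := X ^ 4 + 1) ⟨hm, hd, ?_, ?_⟩ ?_ hH
  · rw [polyHeight_le_iff]
    intro i
    simp only [coeff_add, coeff_X_pow, coeff_one]
    split_ifs <;> omega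
  · refine (numDominant_of_forall_norm hm (by omega) (r := 1) fun z hz => ?_).trans hd
    have h1 := (mem_aroots_iff hm).mp hz
    simp only [map_add, map_pow, aeval_X, map_one] at h1
    refine (pow_eq_one_iff_of_nonneg (norm_nonneg _) (by norm_num : 4 ≠ 0)).mp ?_
    rw [← norm_pow, eq_neg_of_add_eq_zero_left h1, norm_neg, norm_one]
  · rw [heq]
    exact cyclotomic.irreducible (by norm_num)

/-- The biquadratic polynomials `X ^ 4 + 2 * i * X ^ 2 + (4 * j + 2)`. -/
noncomputable def biquadFam (i j : ℤ) : ℤ[X] :=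
  X ^ 4 + C 0 * X ^ 3 + C (2 * i) * X ^ 2 + C 0 * X + C (4 * j + 2)

/-- Eisenstein at `2`: the constant term is `2` modulo `4`. -/
theorem irreducible_biquadFam (i j : ℤ) : Irreducible (biquadFam i j) := by
  have hm : (biquadFam i j).Monic := monic_quartic _ _ _ _
  have hd : (biquadFam i j).natDegree = 4 := natDegree_quartic _ _ _ _
  have hp : (Ideal.span {(2 : ℤ)}).IsPrime :=
    (Ideal.span_singleton_prime two_ne_zero).mpr Int.prime_two
  refine irreducible_of_eisenstein_criterion hp ?_ ?_ ?_ ?_ hm.isPrimitive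
  · rw [hm.leadingCoeff, Ideal.mem_span_singleton]
    norm_num
  · intro n hn
    rw [degree_eq_natDegree hm.ne_zero, hd, Nat.cast_lt] at hn
    rw [Ideal.mem_span_singleton, biquadFam, coeff_quartic]
    split_ifs <;> omega
  · rw [degree_eq_natDegree hm.ne_zero, hd]
    norm_num
  · rw [Ideal.span_singleton_pow, Ideal.mem_span_singleton, biquadFam, coeff_quartic]
    norm_num

theorem numDominant_biquadFam {i j : ℤ} (h : i ^ 2 ≤ 4 * j + 2) :
    numDominant (biquadFam i j) = 4 := by
  have hm : (biquadFam i j).Monic := monic_quartic _ _ _ _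
  have hd : (biquadFam i j).natDegree = 4 := natDegree_quartic _ _ _ _
  have key : ∀ z ∈ (biquadFam i j).aroots ℂ, ‖z‖ ^ 4 = ((4 * j + 2 : ℤ) : ℝ) := by
    intro z hz
    have h1 := (mem_aroots_iff hm).mp hz
    simp only [biquadFam, map_add, map_mul, map_pow, aeval_X, eq_intCast, map_intCast] at h1
    have h2 := quad_root_norm_sq (b := ((2 * i : ℤ) : ℝ)) (c := ((4 * j + 2 : ℤ) : ℝ))
      (by exact_mod_cast (by linarith : (2 * i) ^ 2 ≤ 4 * (4 * j + 2))) (w := z ^ 2)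
      (by rw [← h1]; push_cast; ring)
    rw [← h2, norm_pow]
    ring
  obtain ⟨w, hw, -⟩ := exists_nnnorm_eq_house hm (by omega)
  refine (numDominant_of_forall_norm hm (by omega) (r := ‖w‖) fun z hz => ?_).trans hd
  exact (pow_left_inj₀ (norm_nonneg _) (norm_nonneg _) (by norm_num)).mp
    ((key z hz).trans (key w hw).symm)

theorem card_Icc_sq (N : ℕ) : (Finset.Icc (N ^ 2 + 1 : ℤ) (2 * N ^ 2)).card = N ^ 2 := by
  rw [Int.card_Icc, show (2 * N ^ 2 + 1 - (N ^ 2 + 1) : ℤ) = ((N ^ 2 : ℕ) : ℤ) by push_cast; ring,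
    Int.toNat_natCast]

theorem asympFrom_irredCount_four :
    AsympFrom 1 (fun H => (irredCount 4 4 H : ℝ)) (fun H => (H : ℝ) ^ (3 / 2 : ℝ)) := by
  refine asympFrom_rpow le_rfl (hasGrowth_dominantSet_four.subset fun H _ f hf => hf.1).upper
    (fun H hH => one_le_irredCount_four hH) (c := (1 / 4 / 2) ^ 3) (by norm_num)
    (eventually_lower_of_pow_floor (K := 1 / 4) (θ := 1 / 2) (by norm_num) (by norm_num)
      (by norm_num) fun H hH => ?_)
  have hN := pow_floor_le (K := 1 / 4) (θ := 1 / 2) (m := 2) (c := 10) (H := H) (by norm_num)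
    (by norm_num) (by norm_num)
  set N := ⌊1 / 4 * (H : ℝ) ^ (1 / 2 : ℝ)⌋₊
  -- Then `i ^ 2 ≤ N ^ 2 < j`, so the discriminant in `X ^ 2` is negative, and `4 * j + 2 ≤ 10 * N ^
  -- 2 ≤ H`.
  set F : Finset (ℤ × ℤ) := Finset.Icc 1 (N : ℤ) ×ˢ Finset.Icc (N ^ 2 + 1 : ℤ) (2 * N ^ 2)
  have hF : F.card = N ^ 3 := by
    rw [Finset.card_product, card_Icc_sq, Int.card_Icc, pow_succ' N 2]
    congr 1
    omega
  rw [← hF, ← Set.ncard_coe_finset]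
  refine Set.ncard_le_ncard_of_injOn (fun p : ℤ × ℤ => biquadFam p.1 p.2) ?_ ?_
    ((dominantSet_finite 4 4 H).subset fun _ hf => hf.1)
  · rintro ⟨i, j⟩ hij
    simp only [F, Finset.coe_product, Finset.coe_Icc, Set.mem_prod, Set.mem_Icc] at hij
    obtain ⟨⟨hi1, hi2⟩, hj1, hj2⟩ := hij
    have hN' : 10 * (N : ℤ) ^ 2 ≤ H := by exact_mod_cast hN
    have hi3 : i ^ 2 ≤ (N : ℤ) ^ 2 := by gcongr
    have hi4 : i ≤ i ^ 2 := by rw [sq]; exact le_mul_of_one_le_right (by omega) hi1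
    refine ⟨⟨monic_quartic _ _ _ _, natDegree_quartic _ _ _ _, ?_,
      numDominant_biquadFam (by linarith)⟩, irreducible_biquadFam i j⟩
    rw [polyHeight_le_iff]
    intro n
    rw [biquadFam, coeff_quartic]
    dsimp only
    split_ifs <;> omega
  · rintro ⟨i, j⟩ - ⟨i', j'⟩ - h
    simp only [biquadFam] at h
    have h2 := congrArg (fun p => coeff p 2) h
    have h0 := congrArg (fun p => coeff p 0) h
    simp only [coeff_quartic] at h2 h0
    norm_num at h2 h0
    rw [h2, h0]

theorem quad_mul_quad (b b' c c' : ℤ) : quad b c * quad b' c' =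
    X ^ 4 + C (b + b') * X ^ 3 + C (c + c' + b * b') * X ^ 2 + C (b * c' + b' * c) * X
      + C (c * c') := by
  simp only [quad, C_add, C_mul]
  ring

/-- `exists_quadratic_factors` gives two quadratics with constant terms `±r ^ 2` and linear
coefficients at most `2 * r`, where `r ≤ H ^ (1 / 4)`. The three free parameters give exponent `1 /
4 + 1 / 4 + 1 / 2`. -/
theorem hasGrowth_redCount_four :
    HasGrowth (fun H => {f ∈ dominantSet 4 4 H | ¬ Irreducible f}) (1 : ℝ) := by
  have hbox : ∀ s : ℤ, HasGrowth (fun H => (fun p : ℤ × ℤ × ℤ =>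
      quad p.1 p.2.2 * quad p.2.1 (s * p.2.2)) ''
      ({x : ℤ | |(x : ℝ)| ≤ 2 * (H : ℝ) ^ (1 / 4 : ℝ)} ×ˢ
        ({x : ℤ | |(x : ℝ)| ≤ 2 * (H : ℝ) ^ (1 / 4 : ℝ)} ×ˢ
        {x : ℤ | |(x : ℝ)| ≤ 1 * (H : ℝ) ^ (1 / 2 : ℝ)}))) (1 : ℝ) := fun s =>
    (((HasGrowth.int_abs_le 2 (by norm_num) (by norm_num)).prod
      ((HasGrowth.int_abs_le 2 (by norm_num) (by norm_num)).prod
      (HasGrowth.int_abs_le 1 (by norm_num) (by norm_num)))).mono (by norm_num)).image _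
  refine ((hbox 1).union (hbox (-1))).subset ?_
  rintro H hH f ⟨hfm, hi⟩
  obtain ⟨-, h1, h2⟩ := quartic_coeff_bounds hfm
  obtain ⟨hf, hd, hfH, h4⟩ := hfm
  have hr := norm_eq_house_of_numDominant hf (h4.trans hd.symm)
  obtain ⟨g, h, hg, hh, hgd, hhd, hgh⟩ := exists_quadratic_factors hf hd h4 hi
  set r : ℝ := NNReal.toReal (house f)
  obtain ⟨hrg, hrh⟩ := forall_norm_of_mul hg hh (r := r) (by rwa [hgh])
  have hb : ∀ p : ℤ[X], p.Monic → p.natDegree = 2 → (∀ z ∈ p.aroots ℂ, ‖z‖ = r) →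
      |(p.coeff 1 : ℝ)| ≤ 2 * (H : ℝ) ^ (1 / 4 : ℝ) ∧ |(p.coeff 0 : ℝ)| = r ^ 2 := by
    intro p hp hpd hrp
    have h5 := abs_coeff_pred_le hp (by omega) fun z hz => (hrp z hz).le
    have h6 := norm_coeff_zero_of_forall hp hrp
    rw [hpd] at h5 h6
    push_cast at h5
    exact ⟨h5.trans (by linarith), h6⟩
  obtain ⟨hg1, hg0⟩ := hb g hg hgd hrg
  obtain ⟨hh1, hh0⟩ := hb h hh hhd hrh
  have hg0' : |(g.coeff 0 : ℝ)| ≤ 1 * (H : ℝ) ^ (1 / 2 : ℝ) := by linarith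
  have habs : |h.coeff 0| = |g.coeff 0| := by exact_mod_cast hh0.trans hg0.symm
  have hge : quad (g.coeff 1) (g.coeff 0) = g := (eq_quadratic hg hgd).symm
  have hhe : quad (h.coeff 1) (h.coeff 0) = h := (eq_quadratic hh hhd).symm
  rcases abs_eq_abs.mp habs with h7 | h7
  · refine Or.inl ⟨(g.coeff 1, h.coeff 1, g.coeff 0), ⟨hg1, hh1, hg0'⟩, ?_⟩
    dsimp only
    rw [one_mul, ← h7, hhe, h7, hge, hgh]
  · refine Or.inr ⟨(g.coeff 1, h.coeff 1, g.coeff 0), ⟨hg1, hh1, hg0'⟩, ?_⟩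
    dsimp only
    rw [neg_one_mul, ← h7, hhe, hge, hgh]

theorem numDominant_quad_mul_quad {b b' c : ℤ} (h : b ^ 2 ≤ 4 * c) (h' : b' ^ 2 ≤ 4 * c) :
    numDominant (quad b c * quad b' c) = 4 := by
  have hm := (monic_quad b c).mul (monic_quad b' c)
  have hd : (quad b c * quad b' c).natDegree = 4 := by
    rw [(monic_quad b c).natDegree_mul (monic_quad b' c), natDegree_quad, natDegree_quad]
  refine (numDominant_of_forall_norm hm (by omega) (r := Real.sqrt c) fun z hz => ?_).trans hd
  rw [aroots_mul_monic (monic_quad _ _) (monic_quad _ _), Multiset.mem_add] at hz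
  exact hz.elim (norm_root_quad h) (norm_root_quad h')

/-- The product determines `c ^ 2`, `b + b'` and `b * b'`, hence `c` and the unordered pair; the
signs say which linear coefficient is which. -/
theorem quad_mul_quad_inj {b b' c d d' e : ℤ} (hb : b < 0) (hd' : 0 < d') (hc : 0 < c)
    (he : 0 < e)
    (h : quad b c * quad b' c = quad d e * quad d' e) : b = d ∧ b' = d' ∧ c = e := by
  rw [quad_mul_quad, quad_mul_quad] at h
  have h0 := congrArg (fun p => coeff p 0) h
  have h2 := congrArg (fun p => coeff p 2) h
  have h3 := congrArg (fun p => coeff p 3) h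
  simp only [coeff_quartic] at h0 h2 h3
  norm_num at h0 h2 h3
  have hce : c = e := by nlinarith
  have h4 : (b - d) * (b - d') = 0 := by
    rw [hce] at h2
    linear_combination b * h3 - h2
  have hbd : b = d := by
    rcases mul_eq_zero.mp h4 with h5 | h5 <;> omega
  exact ⟨hbd, by omega, hce⟩

theorem asympFrom_redCount_four :
    AsympFrom 1 (fun H => (redCount 4 4 H : ℝ)) (fun H => (H : ℝ)) := by
  have main : AsympFrom 1 (fun H => (redCount 4 4 H : ℝ)) (fun H => (H : ℝ) ^ (1 : ℝ)) := by
    refine asympFrom_rpow le_rfl hasGrowth_redCount_four.upper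
      (fun H hH => one_le_redCount_self (by norm_num) hH) (c := (1 / 2 / 2) ^ 4) (by norm_num)
      (eventually_lower_of_pow_floor (K := 1 / 2) (θ := 1 / 4) (by norm_num) (by norm_num)
        (by norm_num) fun H hH => ?_)
    have hN := pow_floor_le (K := 1 / 2) (θ := 1 / 4) (m := 4) (c := 4) (H := H) (by norm_num)
      (by norm_num) (by norm_num)
    set N := ⌊1 / 2 * (H : ℝ) ^ (1 / 4 : ℝ)⌋₊
    -- Since `c > N ^ 2`, both discriminants are negative. The largest coefficient bound needed is
    -- `c ^ 2 ≤ 4 * N ^ 4 ≤ H`.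
    set F : Finset (ℤ × ℤ × ℤ) := Finset.Icc (-N : ℤ) (-1) ×ˢ Finset.Icc 1 (N : ℤ) ×ˢ
      Finset.Icc (N ^ 2 + 1 : ℤ) (2 * N ^ 2)
    have hF : F.card = N ^ 4 := by
      rw [Finset.card_product, Finset.card_product, card_Icc_sq, Int.card_Icc, Int.card_Icc,
        show (-1 + 1 - -(N : ℤ)).toNat = N by omega, show ((N : ℤ) + 1 - 1).toNat = N by omega]
      ring
    rw [← hF, ← Set.ncard_coe_finset]
    refine Set.ncard_le_ncard_of_injOn
      (fun p : ℤ × ℤ × ℤ => quad p.1 p.2.2 * quad p.2.1 p.2.2) ?_ ?_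
      ((dominantSet_finite 4 4 H).subset fun _ hf => hf.1)
    · rintro ⟨b, b', c⟩ hp
      simp only [F, Finset.coe_product, Finset.coe_Icc, Set.mem_prod, Set.mem_Icc] at hp
      obtain ⟨⟨hb1, hb2⟩, ⟨hb1', hb2'⟩, hc1, hc2⟩ := hp
      have hN' : 4 * (N : ℤ) ^ 4 ≤ H := by exact_mod_cast hN
      have hN1 : (1 : ℤ) ≤ N := by omega
      have hN12 : (N : ℤ) ≤ N ^ 4 := le_self_pow₀ hN1 (by norm_num)
      have hN24 : (N : ℤ) ^ 2 ≤ N ^ 4 := pow_le_pow_right₀ hN1 (by norm_num)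
      have hN34 : (N : ℤ) ^ 3 ≤ N ^ 4 := pow_le_pow_right₀ hN1 (by norm_num)
      have hc0 : 0 ≤ c := by linarith [sq_nonneg (N : ℤ)]
      have hb : |b| ≤ N := abs_le.mpr ⟨hb1, by omega⟩
      have hb' : |b'| ≤ N := abs_le.mpr ⟨by omega, hb2'⟩
      have hs : |b + b'| ≤ N := abs_le.mpr ⟨by omega, by omega⟩
      have hbsq : b ^ 2 ≤ N ^ 2 := sq_le_sq.mpr (by rwa [Nat.abs_cast])
      have hbsq' : b' ^ 2 ≤ N ^ 2 := sq_le_sq.mpr (by rwa [Nat.abs_cast])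
      refine ⟨⟨(monic_quad _ _).mul (monic_quad _ _), ?_, ?_,
        numDominant_quad_mul_quad (by linarith) (by linarith)⟩,
        not_irreducible_mul_monic (monic_quad _ _) (monic_quad _ _)
          ((natDegree_quad _ _).ge.trans' (by norm_num))
          ((natDegree_quad _ _).ge.trans' (by norm_num))⟩
      · rw [(monic_quad _ _).natDegree_mul (monic_quad _ _), natDegree_quad, natDegree_quad]
      · have k3 : |c * c| ≤ H := by
          rw [abs_mul, abs_of_nonneg hc0]
          calc c * c ≤ (2 * N ^ 2) * (2 * N ^ 2) := by gcongr
            _ = 4 * (N : ℤ) ^ 4 := by ring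
            _ ≤ H := hN'
        have k2 : |b * c + b' * c| ≤ H := by
          rw [← add_mul, abs_mul, abs_of_nonneg hc0]
          calc |b + b'| * c ≤ N * (2 * N ^ 2) := by gcongr
            _ = 2 * (N : ℤ) ^ 3 := by ring
            _ ≤ H := by linarith
        have k4 : |c + c + b * b'| ≤ H := by
          have hbb : |b * b'| ≤ N ^ 2 := by
            rw [abs_mul, sq]
            gcongr
          have := abs_le.mp hbb
          have : b * b' ≤ 0 := mul_nonpos_of_nonpos_of_nonneg (by omega) (by omega)
          rw [abs_le]
          constructor <;> linarith
        have := abs_le.mp k2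
        have := abs_le.mp k3
        have := abs_le.mp k4
        rw [polyHeight_le_iff]
        intro n
        rw [quad_mul_quad, coeff_quartic]
        dsimp only
        split_ifs <;> omega
    · rintro ⟨b, b', c⟩ hp ⟨d, d', e⟩ hp' h
      simp only [F, Finset.coe_product, Finset.coe_Icc, Set.mem_prod, Set.mem_Icc] at hp hp'
      have hN0 : (0 : ℤ) ≤ N ^ 2 := by positivity
      dsimp only at h
      obtain ⟨rfl, rfl, rfl⟩ := quad_mul_quad_inj (by omega) (by omega) (by omega) (by omega) h
      rfl
  simpa only [Real.rpow_one] using main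

end Quartics

/-! ### Counting quartics with exactly three dominant roots -/

section QuarticsThree

theorem irredCount_four_three (H : ℕ) : irredCount 4 3 H = 0 := by
  have h : {f ∈ dominantSet 4 3 H | Irreducible f} = ∅ := by
    refine Set.eq_empty_of_forall_notMem ?_
    rintro f ⟨⟨hf, hd, -, h3⟩, hi⟩
    exact numDominant_ne_three_of_irreducible hf hd hi h3
  rw [irredCount, h, Set.ncard_empty]

/-- The constant coefficient of the product is `-d * g.coeff 0`. It bounds `g.coeff 0` unless `d =
0`, in which case the linear coefficient is `g.coeff 0`. -/
theorem abs_coeff_zero_le_of_X_sub_C_mul {d : ℤ} {g : ℤ[X]} {H : ℕ}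
    (h : polyHeight ((X - C d) * g) ≤ H) :
    |g.coeff 0| ≤ H ∧ |d * g.coeff 0| ≤ H := by
  have h0 := polyHeight_le_iff.mp h 0
  have h1 := polyHeight_le_iff.mp h 1
  rw [sub_mul, coeff_sub, coeff_C_mul] at h0 h1
  rw [coeff_X_mul_zero, zero_sub] at h0
  rw [show (1 : ℕ) = 0 + 1 from rfl, coeff_X_mul] at h1
  have h2 : |d * g.coeff 0| ≤ H := by rw [abs_le]; omega
  refine ⟨?_, h2⟩
  by_cases hd : d = 0
  · subst hd
    rw [abs_le]
    omega
  · refine le_trans ?_ h2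
    rw [abs_mul]
    exact le_mul_of_one_le_left (abs_nonneg _) (Int.one_le_abs hd)

/-- The number of pairs of nonzero integers with product at most `H` in absolute value. -/
theorem ncard_mul_le (H : ℕ) :
    {p : ℤ × ℤ | p.1 ≠ 0 ∧ p.2 ≠ 0 ∧ |p.1 * p.2| ≤ H}.Finite ∧
    ({p : ℤ × ℤ | p.1 ≠ 0 ∧ p.2 ≠ 0 ∧ |p.1 * p.2| ≤ H}.ncard : ℝ) ≤
      6 * (H * (1 + Real.log H)) := by
  set F : Finset (ℤ × ℤ) := (Finset.Icc 1 H).biUnion fun k =>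
    ({(k : ℤ), -(k : ℤ)} : Finset ℤ) ×ˢ Finset.Icc (-((H / k : ℕ) : ℤ)) ((H / k : ℕ) : ℤ)
  have hsub : {p : ℤ × ℤ | p.1 ≠ 0 ∧ p.2 ≠ 0 ∧ |p.1 * p.2| ≤ H} ⊆ (F : Set (ℤ × ℤ)) := by
    rintro ⟨d, c⟩ ⟨hd, hc, h⟩
    dsimp only at hd hc h
    have h1 : d.natAbs * c.natAbs ≤ H := by
      rw [← Int.natAbs_mul]
      rw [Int.abs_eq_natAbs] at h
      exact_mod_cast h
    have hd1 : 1 ≤ d.natAbs := Int.natAbs_pos.mpr hd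
    have hc1 : 1 ≤ c.natAbs := Int.natAbs_pos.mpr hc
    have h2 : c.natAbs ≤ H / d.natAbs := (Nat.le_div_iff_mul_le hd1).mpr (by rwa [mul_comm])
    simp only [F, Finset.coe_biUnion, Set.mem_iUnion, Finset.coe_product, Set.mem_prod,
      Finset.mem_coe, Finset.mem_Icc, Finset.mem_insert, Finset.mem_singleton]
    exact ⟨d.natAbs, ⟨hd1, (Nat.le_mul_of_pos_right _ hc1).trans h1⟩, by omega, by omega, by omega⟩
  refine ⟨F.finite_toSet.subset hsub, ?_⟩
  have hcard : ({p : ℤ × ℤ | p.1 ≠ 0 ∧ p.2 ≠ 0 ∧ |p.1 * p.2| ≤ H}.ncard : ℝ) ≤ F.card := by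
    rw [← Set.ncard_coe_finset]
    exact_mod_cast Set.ncard_le_ncard hsub F.finite_toSet
  refine hcard.trans ?_
  -- Two signs for the first entry, and `2 * (H / k) + 1 ≤ 3 * (H / k)` values for the second.
  have h1 : F.card ≤ ∑ k ∈ Finset.Icc 1 H, 6 * (H / k) := by
    refine Finset.card_biUnion_le.trans (Finset.sum_le_sum fun k hk => ?_)
    rw [Finset.mem_Icc] at hk
    have h2 : 1 ≤ H / k := (Nat.one_le_div_iff (by omega)).mpr hk.2
    rw [Finset.card_product, Int.card_Icc]
    refine (Nat.mul_le_mul_right _ Finset.card_le_two).trans ?_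
    omega
  calc (F.card : ℝ) ≤ ((∑ k ∈ Finset.Icc 1 H, 6 * (H / k) : ℕ) : ℝ) := by exact_mod_cast h1
    _ ≤ ∑ k ∈ Finset.Icc 1 H, 6 * (H * (k : ℝ)⁻¹) := by
      push_cast
      gcongr
      rw [← div_eq_mul_inv]
      exact Nat.cast_div_le
    _ = 6 * (H * (harmonic H : ℝ)) := by
      rw [harmonic_eq_sum_Icc, ← Finset.mul_sum, ← Finset.mul_sum]
      push_cast
      rfl
    _ ≤ _ := by
      gcongr
      exact harmonic_le_one_add_log H

/-- Most reducible quartics with three dominant roots have the form `(X - d) * (X ^ 3 + c)`. -/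
theorem redCount_four_three_upper :
    ∃ C₀ : ℝ, ∀ H : ℕ, 2 ≤ H → (redCount 4 3 H : ℝ) ≤ C₀ * (H * Real.log H) := by
  have hlin : HasGrowth (fun H => (fun c : ℤ => (X - C 0) * (X ^ 3 + C c : ℤ[X])) ''
      {x : ℤ | |(x : ℝ)| ≤ 1 * (H : ℝ) ^ (1 : ℝ)}) (1 : ℝ) :=
    (HasGrowth.int_abs_le 1 (by norm_num) (by norm_num)).image _
  have hcub : HasGrowth (fun H => (fun p : ℤ × ℤ × ℤ => (X - C p.1) * cubicFam p.2.1 p.2.2) ''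
      ({x : ℤ | |(x : ℝ)| ≤ 1 * (H : ℝ) ^ (1 / 3 : ℝ)} ×ˢ
        ({x : ℤ | |(x : ℝ)| ≤ 3 * (H : ℝ) ^ (1 / 3 : ℝ)} ×ˢ
        {x : ℤ | |(x : ℝ)| ≤ 1 * (H : ℝ) ^ (1 / 3 : ℝ)}))) (1 : ℝ) :=
    (((HasGrowth.int_abs_le 1 (by norm_num) (by norm_num)).prod
      ((HasGrowth.int_abs_le 3 (by norm_num) (by norm_num)).prod
      (HasGrowth.int_abs_le 1 (by norm_num) (by norm_num)))).mono (by norm_num)).image _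
  obtain ⟨C₀, hC0, hC⟩ := (hlin.union hcub).exists_nonneg
  -- For `H ≥ 2` one has `H ≤ 2 * H * log H`, so the divisor sum contributes `6 * (2 + 1)` and the
  -- `O(H)` families `2 * C₀`.
  refine ⟨18 + 2 * C₀, fun H hH => ?_⟩
  obtain ⟨hfin, hb⟩ := hC H (by omega)
  set B : Set ℤ[X] := _ ∪ _
  obtain ⟨hfinA, hA⟩ := ncard_mul_le H
  set A := {p : ℤ × ℤ | p.1 ≠ 0 ∧ p.2 ≠ 0 ∧ |p.1 * p.2| ≤ H}
  have hsub : {f ∈ dominantSet 4 3 H | ¬ Irreducible f} ⊆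
      (fun p : ℤ × ℤ => (X - C p.1) * (X ^ 3 + C p.2)) '' A ∪ B := by
    rintro f ⟨⟨hf, hd, hfH, h3⟩, hi⟩
    obtain ⟨d, g, hg, hgd, rfl, hr, hdr⟩ := exists_int_small_root hf hd h3 hi
    set r : ℝ := NNReal.toReal (house ((X - C d) * g))
    obtain ⟨h0, h0'⟩ := abs_coeff_zero_le_of_X_sub_C_mul hfH
    obtain ⟨w, hw, hwg⟩ := exists_nnnorm_eq_house hg (by omega)
    rcases cubic_form hg hgd ((numDominant_of_forall_norm hg (by omega) hr).trans hgd) with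
      ⟨c, rfl⟩ | ⟨a, t, hat, hht, hgt⟩
    · have hc : (X ^ 3 + C c : ℤ[X]).coeff 0 = c := by simp
      rw [hc] at h0 h0'
      by_cases hd0 : d = 0
      · refine Or.inr (Or.inl ⟨c, ?_, by rw [hd0]⟩)
        rw [Set.mem_ofPred_eq, one_mul, Real.rpow_one]
        exact_mod_cast h0
      · refine Or.inl ⟨(d, c), ⟨hd0, ?_, h0'⟩, rfl⟩
        rintro rfl
        have h4 := norm_root_X_cube_add_C hw
        rw [hr w hw, Int.cast_zero, abs_zero, pow_eq_zero_iff (by norm_num)] at h4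
        exact absurd hdr (by rw [h4]; exact not_lt.mpr (abs_nonneg _))
    · have hgt' : g = cubicFam a t := hgt
      have hrt : r = |(t : ℝ)| := by
        rw [← hht, ← hwg, ← hr w hw]
        rfl
      have ht : |(t : ℝ)| ≤ (H : ℝ) ^ (1 / 3 : ℝ) := by
        refine abs_le_rpow_of_pow_le (m := 3) (by norm_num) (abs_nonneg _) ?_
        rw [hgt', cubicFam_eq, coeff_cubic] at h0
        norm_num at h0
        exact_mod_cast h0
      have ha : |(a : ℝ)| ≤ 3 * |(t : ℝ)| := by exact_mod_cast hat
      refine Or.inr (Or.inr ⟨(d, a, t), ⟨?_, ?_, ?_⟩, by rw [hgt']⟩)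
      · rw [Set.mem_ofPred_eq]; linarith
      · rw [Set.mem_ofPred_eq]; linarith
      · rw [Set.mem_ofPred_eq]; linarith
  have h1 : redCount 4 3 H ≤ A.ncard + B.ncard :=
    (Set.ncard_le_ncard hsub ((hfinA.image _).union hfin)).trans
      ((Set.ncard_union_le _ _).trans (Nat.add_le_add_right (Set.ncard_image_le hfinA) _))
  have h2 : (redCount 4 3 H : ℝ) ≤ A.ncard + B.ncard := by exact_mod_cast h1
  have hlog : 1 ≤ 2 * Real.log H := by
    have : Real.log 2 ≤ Real.log H := Real.log_le_log (by norm_num) (by exact_mod_cast hH)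
    linarith [Real.log_two_gt_d9]
  rw [Real.rpow_one] at hb
  have h3 : (H : ℝ) ≤ 2 * (H * Real.log H) := by
    nlinarith [(Nat.cast_nonneg H : (0 : ℝ) ≤ H)]
  nlinarith

theorem X_cube_add_C_mul_X_sub_C (c d : ℤ) : (X ^ 3 + C c) * (X - C d) =
    X ^ 4 + C (-d) * X ^ 3 + C 0 * X ^ 2 + C c * X + C (-(c * d)) := by
  simp only [C_neg, C_mul, C_0]
  ring

theorem numDominant_X_cube_add_C_mul_X_sub_C {c d : ℤ} (hd : 0 ≤ d) (h : d ^ 3 < c) :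
    numDominant ((X ^ 3 + C c) * (X - C d)) = 3 := by
  have hm := monic_X_cube_add_C c
  rw [numDominant_mul_of_lt hm (monic_X_sub_C d) (by rw [natDegree_X_cube_add_C]; norm_num),
    numDominant_X_cube_add_C]
  intro z hz
  obtain ⟨w, hw, hwh⟩ := exists_nnnorm_eq_house hm (by rw [natDegree_X_cube_add_C]; norm_num)
  rw [← hwh, ← NNReal.coe_lt_coe, coe_nnnorm, coe_nnnorm]
  have hz' := (mem_aroots_iff (monic_X_sub_C d)).mp hz
  simp only [map_sub, aeval_X, eq_intCast, map_intCast] at hz'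
  refine lt_of_pow_lt_pow_left₀ 3 (norm_nonneg _) ?_
  rw [norm_root_X_cube_add_C hw, sub_eq_zero.mp hz', Complex.norm_intCast, ← abs_pow]
  have h1 : |d ^ 3| < |c| := by
    rw [abs_of_nonneg (pow_nonneg hd 3)]
    exact h.trans_le (le_abs_self c)
  exact_mod_cast h1

/-- Counts the products `(X ^ 3 + c) * (X - d)` with `d ^ 3 < c ≤ H / d`: the lower bound on `c`
makes `d` the small root, the upper one controls the height. -/
theorem sum_le_redCount_four_three {N H : ℕ} (hN : N ≤ H) :
    ∑ d ∈ Finset.Icc 1 N, (H / d - d ^ 3) ≤ redCount 4 3 H := by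
  set F : Finset (Σ _ : ℕ, ℕ) := (Finset.Icc 1 N).sigma fun d => Finset.Icc (d ^ 3 + 1) (H / d)
  have hF : F.card = ∑ d ∈ Finset.Icc 1 N, (H / d - d ^ 3) := by
    rw [Finset.card_sigma]
    refine Finset.sum_congr rfl fun d _ => ?_
    rw [Nat.card_Icc]
    omega
  rw [← hF, ← Set.ncard_coe_finset]
  refine Set.ncard_le_ncard_of_injOn
    (fun p : Σ _ : ℕ, ℕ => (X ^ 3 + C (p.2 : ℤ)) * (X - C (p.1 : ℤ))) ?_ ?_
    ((dominantSet_finite 4 3 H).subset fun _ hf => hf.1)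
  · rintro ⟨d, c⟩ hp
    simp only [F, Finset.mem_coe, Finset.mem_sigma, Finset.mem_Icc] at hp
    obtain ⟨⟨hd1, hd2⟩, hc1, hc2⟩ := hp
    have hcd : c * d ≤ H := (Nat.le_div_iff_mul_le hd1).mp hc2
    have hcd' : (c : ℤ) * d ≤ H := by exact_mod_cast hcd
    have hcH : c ≤ H := (Nat.le_mul_of_pos_right c hd1).trans hcd
    have hcd0 : (0 : ℤ) ≤ c * d := by positivity
    refine ⟨⟨(monic_X_cube_add_C _).mul (monic_X_sub_C _), ?_, ?_,
      numDominant_X_cube_add_C_mul_X_sub_C (Nat.cast_nonneg d) (by exact_mod_cast hc1)⟩,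
      not_irreducible_mul_monic (monic_X_cube_add_C _) (monic_X_sub_C _)
        (by rw [natDegree_X_cube_add_C]; norm_num) (natDegree_X_sub_C _).ge⟩
    · rw [X_cube_add_C_mul_X_sub_C, natDegree_quartic]
    · rw [polyHeight_le_iff]
      intro n
      rw [X_cube_add_C_mul_X_sub_C, coeff_quartic]
      dsimp only
      split_ifs <;> omega
  · rintro ⟨d, c⟩ - ⟨d', c'⟩ - h
    simp only [X_cube_add_C_mul_X_sub_C] at h
    have h1 := congrArg (fun p => coeff p 1) h
    have h3 := congrArg (fun p => coeff p 3) h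
    simp only [coeff_quartic] at h1 h3
    norm_num at h1 h3
    rw [h1, h3]

theorem redCount_four_three_lower :
    ∀ᶠ H : ℕ in Filter.atTop, 1 / 16 * (H * Real.log H) ≤ (redCount 4 3 H : ℝ) := by
  have hlog : Filter.Tendsto (fun H : ℕ => Real.log H) Filter.atTop Filter.atTop :=
    Real.tendsto_log_atTop.comp tendsto_natCast_atTop_atTop
  filter_upwards [eventually_floor_ge (K := 1 / 2) (θ := 1 / 4) (by norm_num) (by norm_num),
    Filter.eventually_ge_atTop 1, hlog.eventually_ge_atTop (8 * Real.log 4)] with H h1 h2 h3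
  have hN := pow_floor_le (K := 1 / 2) (θ := 1 / 4) (m := 4) (c := 16) (H := H) (by norm_num)
    (by norm_num) (by norm_num)
  set N := ⌊1 / 2 * (H : ℝ) ^ (1 / 4 : ℝ)⌋₊
  have hH0 : (0 : ℝ) < H := by exact_mod_cast h2
  have hNH : N ≤ H := by
    have : N ≤ N ^ 4 := Nat.le_self_pow (by norm_num) N
    omega
  -- From `N ≥ H ^ (1 / 4) / 4` the logarithm is at least `log H / 4 - log 4`, and half of the main
  -- term absorbs `log 4` once `log H ≥ 8 * log 4`.
  have hlogN : 1 / 8 * Real.log H ≤ Real.log (N + 1) := by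
    have h4 : Real.log (1 / 2 / 2 * (H : ℝ) ^ (1 / 4 : ℝ)) ≤ Real.log (N + 1) :=
      Real.log_le_log (by positivity) (by linarith)
    rw [Real.log_mul (by norm_num) (by positivity), Real.log_rpow hH0,
      show (1 / 2 / 2 : ℝ) = 4⁻¹ by norm_num, Real.log_inv] at h4
    linarith
  -- As `16 * d ^ 4 ≤ H`, the subtracted `d ^ 3` and the rounding of `H / d` together cost less than
  -- half of `H / d`.
  have hterm : ∀ d ∈ Finset.Icc 1 N, (H : ℝ) / 2 * (d : ℝ)⁻¹ ≤ ((H / d - d ^ 3 : ℕ) : ℝ) := by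
    intro d hd
    rw [Finset.mem_Icc] at hd
    have hd0 : (1 : ℝ) ≤ d := by exact_mod_cast hd.1
    have h5 : 16 * d ^ 3 * d ≤ H := by
      calc 16 * d ^ 3 * d = 16 * d ^ 4 := by ring
        _ ≤ 16 * N ^ 4 := by gcongr; exact hd.2
        _ ≤ H := hN
    have h6 : 16 * d ^ 3 ≤ H / d := (Nat.le_div_iff_mul_le hd.1).mpr h5
    have h7 : (16 * (d : ℝ) ^ 3) ≤ H / d := by
      rw [le_div_iff₀ (by linarith)]
      exact_mod_cast h5
    have h8 : (H : ℝ) / d < ((H / d : ℕ) : ℝ) + 1 := by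
      rw [← Nat.floor_div_eq_div (K := ℝ)]
      exact Nat.lt_floor_add_one _
    have h9 : (1 : ℝ) ≤ (d : ℝ) ^ 3 := one_le_pow₀ hd0
    rw [Nat.cast_sub (by omega), Nat.cast_pow,
      show (H : ℝ) / 2 * (d : ℝ)⁻¹ = 1 / 2 * (H / d) by ring]
    linarith
  calc 1 / 16 * (H * Real.log H) = (H : ℝ) / 2 * (1 / 8 * Real.log H) := by ring
    _ ≤ (H : ℝ) / 2 * Real.log (N + 1) := by gcongr
    _ ≤ (H : ℝ) / 2 * (harmonic N : ℝ) := by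
      gcongr
      exact_mod_cast log_add_one_le_harmonic N
    _ = ∑ d ∈ Finset.Icc 1 N, (H : ℝ) / 2 * (d : ℝ)⁻¹ := by
      rw [harmonic_eq_sum_Icc, ← Finset.mul_sum]
      push_cast
      rfl
    _ ≤ ∑ d ∈ Finset.Icc 1 N, ((H / d - d ^ 3 : ℕ) : ℝ) := Finset.sum_le_sum hterm
    _ ≤ redCount 4 3 H := by exact_mod_cast sum_le_redCount_four_three hNH

theorem one_le_redCount_four_three {H : ℕ} (hH : 1 ≤ H) : 1 ≤ redCount 4 3 H := by
  have hm := monic_X_cube_add_C 1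
  have hd := natDegree_X_cube_add_C 1
  have h0 : 0 < house (X ^ 3 + C 1 : ℤ[X]) := by
    obtain ⟨w, hw, hwh⟩ := exists_nnnorm_eq_house hm (by omega)
    have := norm_root_X_cube_add_C hw
    rw [← hwh, pos_iff_ne_zero, Ne, nnnorm_eq_zero]
    rintro rfl
    norm_num at this
  refine one_le_redCount (mul_X_pow_mem_dominantSet (m := 1)
    (X_cube_add_C_mem_dominantSet le_rfl (by norm_num)) (by norm_num) h0) ?_ hH
  exact not_irreducible_mul_monic hm (monic_X_pow 1) (by omega) (by rw [natDegree_X_pow])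

theorem asympFrom_redCount_four_three :
    AsympFrom 2 (fun H => (redCount 4 3 H : ℝ)) (fun H => (H : ℝ) * Real.log H) := by
  obtain ⟨C₀, hC⟩ := redCount_four_three_upper
  refine asympFrom_of_eventually (C := C₀) (c := 1 / 16) (fun H hH => ?_) hC (fun H hH => ?_)
    (by norm_num) redCount_four_three_lower
  · exact mul_nonneg (Nat.cast_nonneg _) (Real.log_natCast_nonneg H)
  · exact_mod_cast one_le_redCount_four_three (by omega)

end QuarticsThree

theorem theorem1p4 :
    (∀ n : ℕ, 3 ≤ n →
      AsympEquiv (fun H => (irredCount n 1 H : ℝ)) (fun H => (2 * (H : ℝ)) ^ n) ∧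
      AsympFrom 1 (fun H => (redCount n 1 H : ℝ)) (fun H => (H : ℝ) ^ ((n : ℝ) - 1)) ∧
      AsympFrom 1 (fun H => (irredCount n 2 H : ℝ)) (fun H => (H : ℝ) ^ ((n : ℝ) - 1 / 2)) ∧
      AsympFrom 1 (fun H => (redCount n 2 H : ℝ)) (fun H => (H : ℝ) ^ ((n : ℝ) - 3 / 2))) ∧
    AsympEquiv (fun H => (irredCount 3 3 H : ℝ)) (fun H => 2 * (H : ℝ)) ∧
    AsympFrom 1 (fun H => (redCount 3 3 H : ℝ)) (fun H => (H : ℝ) ^ (2 / 3 : ℝ)) ∧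
    (∀ H : ℕ, 1 ≤ H → irredCount 4 3 H = 0) ∧
    AsympFrom 2 (fun H => (redCount 4 3 H : ℝ)) (fun H => (H : ℝ) * Real.log H) ∧
    AsympFrom 1 (fun H => (irredCount 4 4 H : ℝ)) (fun H => (H : ℝ) ^ (3 / 2 : ℝ)) ∧
    AsympFrom 1 (fun H => (redCount 4 4 H : ℝ)) (fun H => (H : ℝ)) := by
  refine ⟨fun n hn => ⟨asympEquiv_irredCount_one hn, asympFrom_redCount_one hn,
    asympFrom_irredCount_two hn, asympFrom_redCount_two hn⟩, asympEquiv_irredCount_three,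
    asympFrom_redCount_three, fun H _ => irredCount_four_three H, asympFrom_redCount_four_three,
    asympFrom_irredCount_four, asympFrom_redCount_four⟩
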